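/- Let $G$ be a finite-dimensional real Lie group with Lie algebra $\mathfrak g$, and let $G^c$ be a complexification of $G$: a complex Lie group, with complex structure $J$, containing $G$ as a closed Lie subgroup in such a way that $T_eG^c=T_eG\oplus J\,T_eG$ (so that $\mathrm{Lie}(G^c)=\mathfrak g\otimes\mathbb C$). Let $\pi:G^c\to G^c/G$, $g\mapsto gG$, be the projection, where $G^c/G$ carries its manifold structure as a homogeneous space (the one making $\pi$ a smooth submersion). The geodesics of $G^c/G$ are the curves $\pi(g_t)$, $t\in\mathbb R$, with $\frac{d}{dt}g_t=J(L_{g_t})_*X$ for some $X\in T_eG$. Let $f:G^c/G\to\mathbb R$ be a smooth function which is strictly convex along every geodesic with $X\neq 0$. Put $F:=\pi^*f=f\circ\pi$, $d^cF:=-dF\circ J$ and $\omega_f:=i\partial\bar\partial F=\tfrac12\,dd^cF$. For $X\in\mathfrak g$ let $\tilde X_g=\frac{d}{dt}\big(g\exp(tX)\big)|_{t=0}$ be the fundamental vector field of the right action of $G$ on $G^c$. Then: 1. $\omega_f$ is a smooth closed real $2$-form of type $(1,1)$ on $G^c$ (hence a Kähler form whenever it is positive), and it is preserved by the right action of $G$.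 With respect to $\omega_f$ this action is Hamiltonian with moment map $$\mu_f:=-\tfrac12 d^cF=\tfrac12\,dF\circ J:\ G^c\to\mathfrak g^*,\qquad \mu_f(g)(X)=\tfrac12\,dF_g(J\tilde X_g);$$ that is, $\mu_f$ is smooth, $d(\mu_f\cdot X)=\omega_f(\tilde X,\cdot)$ for all $X\in\mathfrak g$, and $\mu_f(gh)(X)=\mu_f(g)(\mathrm{Ad}_hX)$ for all $g\in G^c$, $h\in G$, $X\in\mathfrak g$. 2. $\mu_f^{-1}(0)=\pi^{-1}(\mathrm{Crit}(f))$, where $\mathrm{Crit}(f)=\{p\in G^c/G:\ df_p=0\}$. 3. If $G^c/G$ is connected (for instance if $G^c$ is connected), then $\mathrm{Crit}(f)$ is either empty or a single point, and therefore $\mu_f^{-1}(0)$ is either empty or a single orbit $g_0G$ of $G$ in $G^c$. -/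

import Mathlib

open scoped Manifold ContDiff Topology

noncomputable section

namespace CplxLie

/-! ### Differential forms on a manifold modelled on a normed space `E` -/

section Forms

variable (E : Type*) [NormedAddCommGroup E] [NormedSpace ℝ E]
  (M : Type*) [TopologicalSpace M] [ChartedSpace E M]

/-- A (not necessarily smooth) real differential `n`-form on `M`. -/
abbrev DiffForm (n : ℕ) : Type _ :=
  (x : M) → (TangentSpace 𝓘(ℝ, E) x) [⋀^Fin n]→L[ℝ] ℝ

variable {E M} {n : ℕ}

/-- The pull-back of a form to the model space, under the inverse of the preferred chart at `x`
(meaningful on the target of that chart). -/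
def chartRep (α : DiffForm E M n) (x : M) : E → E [⋀^Fin n]→L[ℝ] ℝ := fun y =>
  (α ((extChartAt 𝓘(ℝ, E) x).symm y)).compContinuousLinearMap
    (mfderiv 𝓘(ℝ, E) 𝓘(ℝ, E) (extChartAt 𝓘(ℝ, E) x).symm y : E →L[ℝ] _)

/-- A form is smooth if all its chart representations are. -/
def IsSmoothForm (α : DiffForm E M n) : Prop :=
  ∀ x : M, ContDiffOn ℝ ∞ (chartRep α x) (extChartAt 𝓘(ℝ, E) x).target

/-- The exterior derivative, computed at `x` in the preferred chart at `x`. -/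
def extD (α : DiffForm E M n) : DiffForm E M (n + 1) := fun x =>
  (extDeriv (chartRep α x) (extChartAt 𝓘(ℝ, E) x x)).compContinuousLinearMap
    (mfderiv 𝓘(ℝ, E) 𝓘(ℝ, E) (extChartAt 𝓘(ℝ, E) x) x : _ →L[ℝ] E)

end Forms

/-! ### The form `i∂∂̄F = ½ d dᶜ F` on a complex manifold -/

section Complex

variable {E : Type*} [NormedAddCommGroup E] [NormedSpace ℂ E]
  {M : Type*} [TopologicalSpace M] [ChartedSpace E M]

/-- The complex structure `J` of a complex manifold modelled on `E`, acting on the tangent spaces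
of the underlying real manifold. The tangent space at `x` is identified with `E` by the
(holomorphic) preferred chart at `x`, and `J` is multiplication by `i`. -/
def cplxJ (x : M) : TangentSpace 𝓘(ℝ, E) x →L[ℝ] TangentSpace 𝓘(ℝ, E) x :=
  (Complex.I • ContinuousLinearMap.id ℝ E : E →L[ℝ] E)

/-- The differential of a real function, as a real linear form on the tangent space. -/
def dReal (F : M → ℝ) (x : M) : TangentSpace 𝓘(ℝ, E) x →L[ℝ] ℝ :=
  (mfderiv 𝓘(ℝ, E) 𝓘(ℝ, ℝ) F x : _ →L[ℝ] ℝ)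

/-- The 1-form `dᶜF = i(∂̄ - ∂)F = - dF ∘ J`. -/
def dC (F : M → ℝ) : DiffForm E M 1 := fun x =>
  ContinuousAlternatingMap.ofSubsingleton ℝ (TangentSpace 𝓘(ℝ, E) x) ℝ (0 : Fin 1)
    (-(dReal F x ∘L cplxJ x))

/-- The 2-form `i∂∂̄F = ½ d dᶜ F`. -/
def ddbar (F : M → ℝ) : DiffForm E M 2 := fun x =>
  (1 / 2 : ℝ) • extD (dC (E := E) F) x

end Complex

/-! ### Complexified Lie groups -/

section Groups

variable {V : Type*} [NormedAddCommGroup V] [NormedSpace ℝ V]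
  {G : Type*} [TopologicalSpace G] [ChartedSpace V G] [Group G]
  {E : Type*} [NormedAddCommGroup E] [NormedSpace ℂ E]
  {Gc : Type*} [TopologicalSpace Gc] [ChartedSpace E Gc] [Group Gc]

/-- The differential at the identity `T_eG → T_eG^c` of a homomorphism `ι : G → G^c`. -/
def dOne (ι : G →* Gc) : GroupLieAlgebra 𝓘(ℝ, V) G →L[ℝ] GroupLieAlgebra 𝓘(ℝ, E) Gc :=
  (mfderiv 𝓘(ℝ, V) 𝓘(ℝ, E) ι (1 : G) : V →L[ℝ] E)

/-- `ι : G → G^c` presents the complex Lie group `G^c` as a complexification of `G`: it embeds the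
real Lie group `G` as a closed subgroup, and `T_eG^c = T_eG ⊕ J T_eG`, i.e. the complex-linear
extension `𝔤 ⊗ ℂ → Lie(G^c)` of the homomorphism of Lie algebras `dι` is an isomorphism. -/
structure IsComplexification (ι : G →* Gc) : Prop where
  contMDiff : ContMDiff 𝓘(ℝ, V) 𝓘(ℝ, E) ∞ ι
  isClosedEmbedding : Topology.IsClosedEmbedding ι
  bijective : Function.Bijective
    (fun p : GroupLieAlgebra 𝓘(ℝ, V) G × GroupLieAlgebra 𝓘(ℝ, V) G =>
      dOne (E := E) ι p.1 + cplxJ (1 : Gc) (dOne (E := E) ι p.2))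

/-- The differential at the identity of the orbit map `h ↦ g · ι h` of the right action of `G` on
`G^c`. Its value at `X ∈ 𝔤` is the fundamental vector field of `X` at `g`. -/
def fundField (ι : G →* Gc) (g : Gc) :
    GroupLieAlgebra 𝓘(ℝ, V) G →L[ℝ] TangentSpace 𝓘(ℝ, E) g :=
  (mfderiv 𝓘(ℝ, V) 𝓘(ℝ, E) (fun h : G => g * ι h) (1 : G) : V →L[ℝ] E)

/-- The differential at `g` of right translation by `k`. -/
def dRight (k g : Gc) : TangentSpace 𝓘(ℝ, E) g →L[ℝ] TangentSpace 𝓘(ℝ, E) (g * k) :=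
  mfderiv 𝓘(ℝ, E) 𝓘(ℝ, E) (fun g' : Gc => g' * k) g

/-- The adjoint action of `G` on its Lie algebra. -/
def adj (h : G) : GroupLieAlgebra 𝓘(ℝ, V) G →L[ℝ] GroupLieAlgebra 𝓘(ℝ, V) G :=
  (mfderiv 𝓘(ℝ, V) 𝓘(ℝ, V) (fun k : G => h * k * h⁻¹) (1 : G) : V →L[ℝ] V)

/-- `γ` is a curve in `G^c` with `γ' = J (L_γ)_* X`, where `X ∈ T_eG`. The geodesics of `G^c/G` are
the projections of these curves. -/
def IsGeodesicLift (ι : G →* Gc) (X : GroupLieAlgebra 𝓘(ℝ, V) G) (γ : ℝ → Gc) : Prop :=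
  IsMIntegralCurve (I := 𝓘(ℝ, E)) γ
    (fun g => cplxJ g (mulInvariantVectorField (I := 𝓘(ℝ, E)) (dOne ι X) g))

variable (V E) in
/-- `f : G^c/G → ℝ` is strictly convex along every nonconstant geodesic. -/
def IsStrictlyConvex (ι : G →* Gc) (f : Gc ⧸ ι.range → ℝ) : Prop :=
  ∀ (X : GroupLieAlgebra 𝓘(ℝ, V) G) (γ : ℝ → Gc), X ≠ 0 → IsGeodesicLift (E := E) ι X γ →
    StrictConvexOn ℝ Set.univ (fun t : ℝ => f (γ t : Gc ⧸ ι.range))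

/-- The lift `F = f ∘ π : G^c → ℝ`. -/
def lift (ι : G →* Gc) (f : Gc ⧸ ι.range → ℝ) : Gc → ℝ :=
  fun g => f (g : Gc ⧸ ι.range)

variable (V E) in
/-- The map `½ dF ∘ J : G^c → 𝔤^*`, i.e. `X ↦ ½ dF(J X̃)` with `X̃` the fundamental field. -/
def momentMap (ι : G →* Gc) (F : Gc → ℝ) (g : Gc) : GroupLieAlgebra 𝓘(ℝ, V) G →L[ℝ] ℝ :=
  (1 / 2 : ℝ) • (dReal (E := E) F g ∘L cplxJ g ∘L fundField ι g)

/-- The right action of `G` on `G^c` is Hamiltonian for the closed 2-form `Ω`, with moment map `μ`: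
`Ω` is smooth, closed and preserved by the action, `μ` is smooth, `d⟨μ, X⟩ = i_X̃ Ω` for all
`X ∈ 𝔤`, and `μ` is equivariant for the coadjoint action. -/
structure IsHamiltonian (ι : G →* Gc) (Ω : DiffForm E Gc 2)
    (μ : Gc → (GroupLieAlgebra 𝓘(ℝ, V) G →L[ℝ] ℝ)) : Prop where
  smooth : IsSmoothForm Ω
  closed : ∀ g : Gc, extD Ω g = 0
  invariant : ∀ (h : G) (g : Gc), (Ω (g * ι h)).compContinuousLinearMap (dRight (ι h) g) = Ω g
  contMDiff : ∀ X, ContMDiff 𝓘(ℝ, E) 𝓘(ℝ, ℝ) ∞ (fun g => μ g X)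
  moment : ∀ X (g : Gc) (v : TangentSpace 𝓘(ℝ, E) g),
    dReal (fun g' => μ g' X) g v = Ω g ![fundField ι g X, v]
  equivariant : ∀ (h : G) (g : Gc) X, μ (g * ι h) X = μ g (adj h X)

/-- The critical set of a real function on a real manifold modelled on `B`. -/
def critSet (B : Type*) [NormedAddCommGroup B] [NormedSpace ℝ B] {N : Type*} [TopologicalSpace N]
    [ChartedSpace B N] (f : N → ℝ) : Set N :=
  {p | mfderiv 𝓘(ℝ, B) 𝓘(ℝ, ℝ) f p = 0}

end Groups

end CplxLie

end

/-! Write `E = W ⊕ iW` for the Lie algebra of `G^c`, where `W` is the image of the Lie algebra of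
`G`, and let `dLeft F g X` be the derivative of `F` at `g` in the left-invariant direction `X`.

Statements 1 and 2 are local. Since `F` is right `G`-invariant, `dLeft F g` kills `W`, and
`μ_f(g)(X)` is half of `dLeft F g (iX)`. Left-invariant fields `ξ` are holomorphic, so
differentiating `dF(ξ) = 0` for `ξ` coming from `W` gives `d(dF(Jξ)) = ddᶜF(ξ, ·)`
(`fderiv_fderiv_apply_I_smul`). Naturality of `ddᶜ` under holomorphic maps gives invariance,
smoothness and closedness (`ddbar_comp`, `chartRep_ddbar`). Because `dF` already vanishes on `W`,
the equation `μ_f(g) = 0` means `dF_g = 0`, that is `df = 0` at `π(g)`, as `π` is a submersion.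

For statement 3 let `p` be a critical point of `F` and `K` the image of `G`. The set `S` of all `p
exp(iX) k`, with `X ∈ W` and `k ∈ K`, is `K`-saturated, open and closed, hence everything when the
quotient is connected. A second critical point `p exp(iX) k` with `X ≠ 0` would give a strictly
convex function of one variable with two critical points (`IsRealFormSubgroup.inv_mul_mem`).

Closedness of `S`: convexity makes `F(p exp(iX))` grow at least linearly in `X`, uniformly over
directions (`IsConvexPotential.exists_norm_le`).

Openness of `S`: by the formula for the differential of the exponential, `E = W + (∫₀¹ exp(s·i·ad X)
ds)(iW)` is needed. The `iW`-component of this integral is `sin(A)/A` with `A = ad X`, so only a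
nonzero real eigenvalue of `A` can obstruct it (`IsRealForm.exists_add_integral`). Convexity forbids
such eigenvalues (`IsConvexPotential.eq_zero_of_ad_eq_self`): if `ad X Y = Y ≠ 0`, the geodesics
from `1` in the directions `X + cY` all reach the same value of `F` at time `π`. Hence `F` at time
`π/2` is bounded independently of `c`. Yet as `c` varies these midpoints trace, modulo `exp(ℝY)`, a
geodesic of direction `Y`, on which a strictly convex function is unbounded. -/

noncomputable section

namespace CplxLie

/-! ### The real manifold underlying a complex manifold -/

section Scalars

variable {E : Type*} [NormedAddCommGroup E] [NormedSpace ℂ E]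
  {E' : Type*} [NormedAddCommGroup E'] [NormedSpace ℂ E']
  {E'' : Type*} [NormedAddCommGroup E''] [NormedSpace ℂ E'']
  {M : Type*} [TopologicalSpace M] [ChartedSpace E M]
  {M' : Type*} [TopologicalSpace M'] [ChartedSpace E' M']
  {M'' : Type*} [TopologicalSpace M''] [ChartedSpace E'' M'']

theorem contMDiffAt_real_of_complex {n : ℕ∞ω} {f : M → M'} {x : M}
    (h : ContMDiffAt 𝓘(ℂ, E) 𝓘(ℂ, E') n f x) : ContMDiffAt 𝓘(ℝ, E) 𝓘(ℝ, E') n f x :=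
  ⟨h.1, ContDiffWithinAt.restrict_scalars ℝ h.2⟩

theorem contMDiff_real_of_complex {n : ℕ∞ω} {f : M → M'}
    (h : ContMDiff 𝓘(ℂ, E) 𝓘(ℂ, E') n f) : ContMDiff 𝓘(ℝ, E) 𝓘(ℝ, E') n f :=
  fun x => contMDiffAt_real_of_complex (h x)

theorem contMDiff_prod_real_of_complex {n : ℕ∞ω} {f : M × M' → M''}
    (h : ContMDiff (𝓘(ℂ, E).prod 𝓘(ℂ, E')) 𝓘(ℂ, E'') n f) :
    ContMDiff (𝓘(ℝ, E).prod 𝓘(ℝ, E')) 𝓘(ℝ, E'') n f :=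
  fun x => ⟨(h x).1, ContDiffWithinAt.restrict_scalars ℝ (h x).2⟩

/-- The derivative of a holomorphic map, as a real linear map. -/
theorem HasMFDerivAt.real_of_complex {f : M → M'} {x : M} {f' : E →L[ℂ] E'}
    (h : HasMFDerivAt 𝓘(ℂ, E) 𝓘(ℂ, E') f x f') :
    HasMFDerivAt 𝓘(ℝ, E) 𝓘(ℝ, E') f x (f'.restrictScalars ℝ) :=
  ⟨h.1, HasFDerivWithinAt.restrictScalars ℝ h.2⟩

theorem MDifferentiableAt.real_of_complex {f : M → M'} {x : M}
    (h : MDifferentiableAt 𝓘(ℂ, E) 𝓘(ℂ, E') f x) : MDifferentiableAt 𝓘(ℝ, E) 𝓘(ℝ, E') f x :=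
  (HasMFDerivAt.real_of_complex h.hasMFDerivAt).mdifferentiableAt

theorem isManifold_real_of_complex {n : ℕ∞ω} [h : IsManifold 𝓘(ℂ, E) n M] :
    IsManifold 𝓘(ℝ, E) n M := by
  refine isManifold_of_contDiffOn _ _ _ fun e e' he he' => ?_
  exact ((contDiffGroupoid n 𝓘(ℂ, E)).compatible he he').1.restrict_scalars ℝ

theorem lieGroup_real_of_complex {n : ℕ∞ω} [Group M] [LieGroup 𝓘(ℂ, E) n M] :
    LieGroup 𝓘(ℝ, E) n M :=
  { isManifold_real_of_complex (E := E) (M := M) (n := n) with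
    contMDiff_mul := contMDiff_prod_real_of_complex (contMDiff_mul 𝓘(ℂ, E) n)
    contMDiff_inv := contMDiff_real_of_complex (contMDiff_inv 𝓘(ℂ, E) n) }

end Scalars

/-- A topological group with charts in a Hausdorff space is Hausdorff. -/
theorem t2Space_of_chartedSpace (E : Type*) [TopologicalSpace E] [T2Space E] {H : Type*}
    [TopologicalSpace H] [Group H] [IsTopologicalGroup H] [ChartedSpace E H] : T2Space H := by
  have : T1Space H := by
    -- A point specializing to `y` lies in every open set around `y`, so in the chart domain; the
    -- chart carries the specialization to one in a Hausdorff space, hence to an equality. For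
    -- topological groups, which are regular, T1 then gives T2.
    refine t1Space_iff_specializes_imp_eq.2 fun x y hxy => ?_
    have hy := (chartAt E y).open_source
    have hx : x ∈ (chartAt E y).source := hxy.mem_open hy (mem_chart_source E y)
    have h := (specializes_iff_pure.1 hxy)
    refine (chartAt E y).injOn hx (mem_chart_source E y) ?_
    have hc := ((chartAt E y).continuousAt (mem_chart_source E y)).tendsto.mono_left h
    rw [Filter.tendsto_pure_left] at hc
    exact (specializes_iff_pure.2 fun s hs => hc s hs).eq
  infer_instance

end CplxLie

end

noncomputable section

namespace CplxLie

/-! ### The form `ddᶜu` on a complex vector space -/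

section Flat

variable {E : Type*} [NormedAddCommGroup E] [NormedSpace ℂ E]
  {E' : Type*} [NormedAddCommGroup E'] [NormedSpace ℂ E']

variable (E) in
/-- Multiplication by `i`, as a real linear map. -/
def mulI : E →L[ℝ] E := Complex.I • ContinuousLinearMap.id ℝ E

@[simp] theorem mulI_apply (v : E) : mulI E v = Complex.I • v := rfl

variable (E) in
/-- The linear map sending `du` to the 1-form `dᶜu = -du ∘ J`. -/
def dcMap : (E →L[ℝ] ℝ) →L[ℝ] E [⋀^Fin 1]→L[ℝ] ℝ :=
  -((ContinuousAlternatingMap.ofSubsingletonLIE (𝕜 := ℝ) (E := E) (F := ℝ) (0 : Fin 1)).toContinuousLinearEquiv :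
      (E →L[ℝ] ℝ) →L[ℝ] E [⋀^Fin 1]→L[ℝ] ℝ) ∘L
    ((ContinuousLinearMap.compL ℝ E E ℝ).flip (mulI E))

theorem dcMap_apply (l : E →L[ℝ] ℝ) (v : Fin 1 → E) :
    dcMap E l v = -l (Complex.I • v 0) := rfl

/-- The 1-form `dᶜu` of a function on a complex vector space. -/
def dcFlat (u : E → ℝ) (y : E) : E [⋀^Fin 1]→L[ℝ] ℝ := dcMap E (fderiv ℝ u y)

/-- The 2-form `ddᶜu` of a function on a complex vector space. -/
def ddcFlat (u : E → ℝ) (y : E) : E [⋀^Fin 2]→L[ℝ] ℝ := extDeriv (dcFlat u) y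

/-- The derivative of a holomorphic map is complex linear, so it commutes with the `i` inside `dᶜ`.
-/
theorem dcFlat_comp {u : E' → ℝ} {h : E → E'} {y : E} (hu : DifferentiableAt ℝ u (h y))
    (hh : DifferentiableAt ℂ h y) :
    dcFlat (fun z => u (h z)) y = (dcFlat u (h y)).compContinuousLinearMap (fderiv ℝ h y) := by
  ext v
  rw [dcFlat, dcMap_apply, ContinuousAlternatingMap.compContinuousLinearMap_apply, dcFlat,
    dcMap_apply, hh.fderiv_restrictScalars ℝ]
  have := (hu.hasFDerivAt.comp y (hh.hasFDerivAt.restrictScalars ℝ)).fderiv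
  erw [this]
  simp

theorem _root_.Filter.EventuallyEq.ddcFlat_eq {u u' : E → ℝ} {y : E} (h : u =ᶠ[𝓝 y] u') :
    ddcFlat u y = ddcFlat u' y := by
  refine Filter.EventuallyEq.extDeriv_eq ?_
  filter_upwards [h.fderiv (𝕜 := ℝ)] with z hz
  rw [dcFlat, dcFlat, hz]

theorem contDiffAt_dcFlat {u : E → ℝ} {y : E} (hu : ContDiffAt ℝ ∞ u y) :
    ContDiffAt ℝ ∞ (dcFlat u) y :=
  (dcMap E).contDiff.contDiffAt.comp y (hu.fderiv_right (by simp))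

theorem contDiffAt_ddcFlat {u : E → ℝ} {y : E} (hu : ContDiffAt ℝ ∞ u y) :
    ContDiffAt ℝ ∞ (ddcFlat u) y :=
  ContDiffAt.comp y (g := ContinuousAlternatingMap.alternatizeUncurryFinCLM ℝ E ℝ (n := 1))
    (ContinuousLinearMap.contDiff _).contDiffAt ((contDiffAt_dcFlat hu).fderiv_right (by simp))

theorem ddcFlat_comp {u : E' → ℝ} {h : E → E'} {y : E} (hu : ContDiffAt ℝ ∞ u (h y))
    (hh : ContDiffAt ℂ ∞ h y) :
    ddcFlat (fun z => u (h z)) y = (ddcFlat u (h y)).compContinuousLinearMap (fderiv ℝ h y) := by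
  have h1 : dcFlat (fun z => u (h z)) =ᶠ[𝓝 y]
      fun z => (dcFlat u (h z)).compContinuousLinearMap (fderiv ℝ h z) := by
    have e1 : ∀ᶠ z in 𝓝 y, ContDiffAt ℝ 1 u (h z) :=
      hh.continuousAt.eventually ((hu.of_le (by norm_cast)).eventually (by simp) : ∀ᶠ z in 𝓝 (h y), ContDiffAt ℝ 1 u z)
    filter_upwards [e1, (hh.of_le (m := 1) (by norm_cast)).eventually (by simp)] with z hz hz'
    exact dcFlat_comp (hz.differentiableAt (by simp)) (hz'.differentiableAt (by simp))
  rw [ddcFlat, h1.extDeriv_eq, extDeriv_pullback (r := ∞)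
    ((contDiffAt_dcFlat hu).differentiableAt (by simp)) (hh.restrict_scalars ℝ)
    (by simpa using ENat.LEInfty.out), ddcFlat]

theorem ddcFlat_apply {u : E → ℝ} {y : E} (hu : ContDiffAt ℝ ∞ u y) (v w : E) :
    ddcFlat u y ![v, w] = fderiv ℝ (fderiv ℝ u) y w (Complex.I • v) -
      fderiv ℝ (fderiv ℝ u) y v (Complex.I • w) := by
  have h2 : DifferentiableAt ℝ (fderiv ℝ u) y :=
    (hu.fderiv_right (m := ∞) (by simp)).differentiableAt (by simp)
  have h1 : fderiv ℝ (dcFlat u) y = dcMap E ∘L fderiv ℝ (fderiv ℝ u) y :=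
    ((dcMap E).hasFDerivAt.comp y h2.hasFDerivAt).fderiv
  rw [ddcFlat, extDeriv, ContinuousAlternatingMap.alternatizeUncurryFin_apply, h1,
    Fin.sum_univ_two]
  simp [dcMap_apply, Fin.removeNth]
  ring

/-- In the Hessian formula `i² = -1` exchanges the two terms, up to the symmetry of the second
derivative. -/
theorem ddcFlat_I_smul {u : E → ℝ} {y : E} (hu : ContDiffAt ℝ ∞ u y) (v w : E) :
    ddcFlat u y ![Complex.I • v, Complex.I • w] = ddcFlat u y ![v, w] := by
  have hs : IsSymmSndFDerivAt ℝ u y := hu.isSymmSndFDerivAt (by simpa using ENat.LEInfty.out)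
  rw [ddcFlat_apply hu, ddcFlat_apply hu, smul_smul, smul_smul, Complex.I_mul_I]
  simp only [neg_smul, one_smul, map_neg]
  rw [hs.eq, hs.eq (Complex.I • v)]
  ring

end Flat

end CplxLie

end

noncomputable section

namespace CplxLie

/-! ### The form `ddᶜF` on a complex manifold -/

section FormsOnManifolds

variable {E : Type*} [NormedAddCommGroup E] [NormedSpace ℂ E]
  {M : Type*} [TopologicalSpace M] [ChartedSpace E M]
  {E' : Type*} [NormedAddCommGroup E'] [NormedSpace ℂ E']
  {M' : Type*} [TopologicalSpace M'] [ChartedSpace E' M']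

/-- The extended charts for real and complex scalars are definitionally the same map, so the real
chart used in the definitions of forms is holomorphic. -/
theorem mdifferentiableAt_extChartAt_symm_complex [IsManifold 𝓘(ℂ, E) ∞ M] (x : M) {y : E}
    (hy : y ∈ (extChartAt 𝓘(ℝ, E) x).target) :
    ContMDiffAt 𝓘(ℂ, E) 𝓘(ℂ, E) ∞ (extChartAt 𝓘(ℝ, E) x).symm y :=
  (contMDiffOn_extChartAt_symm (I := 𝓘(ℂ, E)) x).contMDiffAt
    ((isOpen_extChartAt_target (I := 𝓘(ℂ, E)) x).mem_nhds hy)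

theorem contMDiffAt_extChartAt_complex [IsManifold 𝓘(ℂ, E) ∞ M] (x : M) {z : M}
    (hz : z ∈ (extChartAt 𝓘(ℝ, E) x).source) :
    ContMDiffAt 𝓘(ℂ, E) 𝓘(ℂ, E) ∞ (extChartAt 𝓘(ℝ, E) x) z :=
  (contMDiffOn_extChartAt (I := 𝓘(ℂ, E)) (x := x)).contMDiffAt
    ((chartAt E x).open_source.mem_nhds (by simpa using hz))

theorem contDiffAt_comp_extChartAt_symm [IsManifold 𝓘(ℂ, E) ∞ M] {F : M → ℝ}
    (hF : ContMDiff 𝓘(ℝ, E) 𝓘(ℝ, ℝ) ∞ F) (x : M) {y : E}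
    (hy : y ∈ (extChartAt 𝓘(ℝ, E) x).target) :
    ContDiffAt ℝ ∞ (fun z => F ((extChartAt 𝓘(ℝ, E) x).symm z)) y :=
  (hF.contMDiffAt.comp y (contMDiffAt_real_of_complex
    (mdifferentiableAt_extChartAt_symm_complex x hy))).contDiffAt

/-- Packages the real and the complex derivative as one map between model spaces, so that later
computations need not mention tangent spaces. -/
theorem exists_hasMFDerivAt_complex {f : M → M'} {x : M}
    (h : MDifferentiableAt 𝓘(ℂ, E) 𝓘(ℂ, E') f x) :
    ∃ L : E →L[ℂ] E', HasMFDerivAt 𝓘(ℂ, E) 𝓘(ℂ, E') f x L ∧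
      HasMFDerivAt 𝓘(ℝ, E) 𝓘(ℝ, E') f x (L.restrictScalars ℝ) :=
  ⟨mfderiv 𝓘(ℂ, E) 𝓘(ℂ, E') f x, h.hasMFDerivAt, HasMFDerivAt.real_of_complex h.hasMFDerivAt⟩

theorem exists_hasMFDerivAt_dReal {F : M → ℝ} {x : M}
    (h : MDifferentiableAt 𝓘(ℝ, E) 𝓘(ℝ, ℝ) F x) :
    ∃ l : E →L[ℝ] ℝ, HasMFDerivAt 𝓘(ℝ, E) 𝓘(ℝ, ℝ) F x l ∧ dReal (E := E) F x = l :=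
  ⟨mfderiv 𝓘(ℝ, E) 𝓘(ℝ, ℝ) F x, h.hasMFDerivAt, rfl⟩

/-- The inverse chart is holomorphic, so its differential intertwines multiplication by `i` with
`J`. -/
theorem chartRep_dC [IsManifold 𝓘(ℂ, E) ∞ M] {F : M → ℝ} (hF : ContMDiff 𝓘(ℝ, E) 𝓘(ℝ, ℝ) ∞ F)
    (x : M) {y : E} (hy : y ∈ (extChartAt 𝓘(ℝ, E) x).target) :
    chartRep (dC (E := E) F) x y = dcFlat (fun z => F ((extChartAt 𝓘(ℝ, E) x).symm z)) y := by
  obtain ⟨L, -, h2⟩ := exists_hasMFDerivAt_complex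
    ((mdifferentiableAt_extChartAt_symm_complex x hy).mdifferentiableAt (by simp))
  obtain ⟨l, h3, h4⟩ := exists_hasMFDerivAt_dReal
    ((hF ((extChartAt 𝓘(ℝ, E) x).symm y)).mdifferentiableAt (by simp))
  have h5 : HasFDerivAt (fun z => F ((extChartAt 𝓘(ℝ, E) x).symm z))
    (l ∘L L.restrictScalars ℝ) y := (h3.comp y h2).hasFDerivAt
  ext v
  rw [chartRep, h2.mfderiv, dcFlat, dcMap_apply, h5.fderiv]
  have h6 : (dC (E := E) F ((extChartAt 𝓘(ℝ, E) x).symm y)) (fun i => L (v i)) =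
      -l (Complex.I • L (v 0)) := by rw [← h4]; rfl
  exact h6.trans (by simp)

theorem chartRep_dC_eventuallyEq [IsManifold 𝓘(ℂ, E) ∞ M] {F : M → ℝ}
    (hF : ContMDiff 𝓘(ℝ, E) 𝓘(ℝ, ℝ) ∞ F) (x : M) {y : E}
    (hy : y ∈ (extChartAt 𝓘(ℝ, E) x).target) :
    chartRep (dC (E := E) F) x =ᶠ[𝓝 y] dcFlat (fun z => F ((extChartAt 𝓘(ℝ, E) x).symm z)) := by
  filter_upwards [(isOpen_extChartAt_target (I := 𝓘(ℝ, E)) x).mem_nhds hy] with z hz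
  exact chartRep_dC hF x hz

theorem ddbar_eq [IsManifold 𝓘(ℂ, E) ∞ M] {F : M → ℝ} (hF : ContMDiff 𝓘(ℝ, E) 𝓘(ℝ, ℝ) ∞ F)
    (x : M) : ddbar (E := E) F x = (1 / 2 : ℝ) •
      (ddcFlat (fun z => F ((extChartAt 𝓘(ℝ, E) x).symm z))
        (extChartAt 𝓘(ℝ, E) x x)).compContinuousLinearMap
        (mfderiv 𝓘(ℝ, E) 𝓘(ℝ, E) (extChartAt 𝓘(ℝ, E) x) x : E →L[ℝ] E) := by
  rw [ddbar, extD, (chartRep_dC_eventuallyEq hF x (mem_extChartAt_target x)).extDeriv_eq]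
  rfl

/-- `ddᶜ` is natural under holomorphic maps. -/
theorem ddbar_comp [IsManifold 𝓘(ℂ, E) ∞ M] [IsManifold 𝓘(ℂ, E') ∞ M'] {F : M' → ℝ}
    {F' : M → ℝ} {ρ : M → M'} {x : M} (hF : ContMDiff 𝓘(ℝ, E') 𝓘(ℝ, ℝ) ∞ F)
    (hF' : ContMDiff 𝓘(ℝ, E) 𝓘(ℝ, ℝ) ∞ F') (h : F' =ᶠ[𝓝 x] fun z => F (ρ z))
    (hρ : ContMDiffAt 𝓘(ℂ, E) 𝓘(ℂ, E') ∞ ρ x) {L : E →L[ℝ] E'}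
    (hL : HasMFDerivAt 𝓘(ℝ, E) 𝓘(ℝ, E') ρ x L) :
    ddbar (E := E) F' x = ContinuousAlternatingMap.compContinuousLinearMap
      (show E' [⋀^Fin 2]→L[ℝ] ℝ from ddbar (E := E') F (ρ x)) L := by
  have : IsManifold 𝓘(ℝ, E) ∞ M := isManifold_real_of_complex
  have : IsManifold 𝓘(ℝ, E') ∞ M' := isManifold_real_of_complex
  set φ := extChartAt 𝓘(ℝ, E) x with hφ
  set φ' := extChartAt 𝓘(ℝ, E') (ρ x) with hφ'
  have hx : φ.symm (φ x) = x := extChartAt_to_inv x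
  have hmem : φ x ∈ φ.target := mem_extChartAt_target x
  have hmem' : φ' (ρ x) ∈ φ'.target := mem_extChartAt_target (ρ x)
  let k : E → E' := fun y => φ' (ρ (φ.symm y))
  have hφs := mdifferentiableAt_extChartAt_symm_complex x hmem
  have hφ'c := contMDiffAt_extChartAt_complex (ρ x) (mem_extChartAt_source (I := 𝓘(ℝ, E')) (ρ x))
  have hk : ContDiffAt ℂ ∞ k (φ x) := by
    refine ContMDiffAt.contDiffAt ?_
    refine ContMDiffAt.comp (φ x) (I' := 𝓘(ℂ, E')) (g := φ') ?_ (ContMDiffAt.comp (φ x)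
      (I' := 𝓘(ℂ, E)) (g := ρ) ?_ hφs)
    · rw [hx]; exact hφ'c
    · rw [hx]; exact hρ
  have hkx : k (φ x) = φ' (ρ x) := by simp only [k, hx]
  obtain ⟨A, hA⟩ : ∃ A : E →L[ℝ] E, HasMFDerivAt 𝓘(ℝ, E) 𝓘(ℝ, E) φ x A :=
    ⟨_, (mdifferentiableAt_extChartAt (mem_chart_source E x)).hasMFDerivAt⟩
  obtain ⟨A', hA'⟩ : ∃ A' : E' →L[ℝ] E', HasMFDerivAt 𝓘(ℝ, E') 𝓘(ℝ, E') φ' (ρ x) A' :=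
    ⟨_, (mdifferentiableAt_extChartAt (mem_chart_source E' (ρ x))).hasMFDerivAt⟩
  have hkd : HasFDerivAt k (fderiv ℝ k (φ x)) (φ x) :=
    ((hk.restrict_scalars ℝ).differentiableAt (by simp)).hasFDerivAt
  -- `k` is `ρ` read in the two preferred charts; both sides differentiate the same germ `φ' ∘ ρ = k
  -- ∘ φ`. The result then reduces to `ddcFlat_comp` for the holomorphic map `k`.
  have hchain : A' ∘L L = fderiv ℝ k (φ x) ∘L A := by
    have e1 : HasMFDerivAt 𝓘(ℝ, E) 𝓘(ℝ, E') (φ' ∘ ρ) x (A' ∘L L) := hA'.comp x hL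
    have e2 : HasMFDerivAt 𝓘(ℝ, E) 𝓘(ℝ, E') (k ∘ φ) x (fderiv ℝ k (φ x) ∘L A) :=
      hkd.hasMFDerivAt.comp x hA
    have e3 : (φ' ∘ ρ) =ᶠ[𝓝 x] (k ∘ φ) := by
      filter_upwards [extChartAt_source_mem_nhds (I := 𝓘(ℝ, E)) x] with z hz
      simp only [k, Function.comp, hφ, (extChartAt 𝓘(ℝ, E) x).left_inv hz]
    exact hasMFDerivAt_unique e1 (e2.congr_of_eventuallyEq e3)
  have hcongr : (fun z => F' (φ.symm z)) =ᶠ[𝓝 (φ x)] fun z => F (φ'.symm (k z)) := by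
    have c1 : Filter.Tendsto φ.symm (𝓝 (φ x)) (𝓝 x) := by
      have := hφs.continuousAt
      rwa [ContinuousAt, hx] at this
    have c2 : ∀ᶠ z in 𝓝 x, ρ z ∈ φ'.source :=
      hρ.continuousAt.eventually (extChartAt_source_mem_nhds (I := 𝓘(ℝ, E')) (ρ x))
    filter_upwards [c1.eventually h, c1.eventually c2] with z hz hz'
    rw [hz]
    simp only [k, φ'.left_inv hz']
  rw [ddbar_eq hF', ddbar_eq hF, hcongr.ddcFlat_eq, ddcFlat_comp (u := fun z => F (φ'.symm z))
    (by rw [hkx]; exact contDiffAt_comp_extChartAt_symm hF (ρ x) hmem') hk, hA.mfderiv, hA'.mfderiv,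
    hkx]
  ext v
  have := congrArg (fun T : E →L[ℝ] E' => fun i => T (v i)) hchain
  exact congrArg (fun w => (1 / 2 : ℝ) * ddcFlat (fun z => F (φ'.symm z)) (φ' (ρ x)) w) this.symm

/-- `extD` uses a different chart at every point `z`. The transition map from the chart at `x` to
the one at `z` is holomorphic, so naturality removes this dependence. Smoothness and closedness can
then be read off in a single chart. -/
theorem chartRep_ddbar [IsManifold 𝓘(ℂ, E) ∞ M] {F : M → ℝ}
    (hF : ContMDiff 𝓘(ℝ, E) 𝓘(ℝ, ℝ) ∞ F) (x : M) {y : E}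
    (hy : y ∈ (extChartAt 𝓘(ℝ, E) x).target) :
    chartRep (ddbar (E := E) F) x y =
      (1 / 2 : ℝ) • ddcFlat (fun z => F ((extChartAt 𝓘(ℝ, E) x).symm z)) y := by
  have : IsManifold 𝓘(ℝ, E) ∞ M := isManifold_real_of_complex
  set φ := extChartAt 𝓘(ℝ, E) x
  have hz : φ.symm y ∈ φ.source := φ.map_target hy
  have hzy : φ (φ.symm y) = y := φ.right_inv hy
  set z := φ.symm y
  set ψ := extChartAt 𝓘(ℝ, E) z
  have hmem : ψ z ∈ ψ.target := mem_extChartAt_target z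
  let k : E → E := fun w => ψ (φ.symm w)
  have hφs := mdifferentiableAt_extChartAt_symm_complex x hy
  have hψ := contMDiffAt_extChartAt_complex z (mem_extChartAt_source (I := 𝓘(ℝ, E)) z)
  have hk : ContDiffAt ℂ ∞ k y :=
    (ContMDiffAt.comp y (I' := 𝓘(ℂ, E)) (g := ψ) (f := φ.symm) hψ hφs).contDiffAt
  obtain ⟨A, hA⟩ : ∃ A : E →L[ℝ] E, HasMFDerivAt 𝓘(ℝ, E) 𝓘(ℝ, E) ψ z A :=
    ⟨_, (mdifferentiableAt_extChartAt (mem_chart_source E z)).hasMFDerivAt⟩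
  obtain ⟨L, -, hL⟩ := exists_hasMFDerivAt_complex (E' := E) (hφs.mdifferentiableAt (by simp))
  have hkm : HasMFDerivAt 𝓘(ℝ, E) 𝓘(ℝ, E) k y (A ∘L L.restrictScalars ℝ) := HasMFDerivAt.comp (I' := 𝓘(ℝ, E)) y (g := ψ) (f := φ.symm) hA hL
  have hkd' : HasFDerivAt k (A ∘L L.restrictScalars ℝ) y := hkm.hasFDerivAt
  have hkd : fderiv ℝ k y = A ∘L L.restrictScalars ℝ := hkd'.fderiv
  have hcongr : (fun w => F (φ.symm w)) =ᶠ[𝓝 y] fun w => F (ψ.symm (k w)) := by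
    filter_upwards [hφs.continuousAt.eventually
      (extChartAt_source_mem_nhds (I := 𝓘(ℝ, E)) z)] with w hw
    exact congrArg F (ψ.left_inv hw).symm
  rw [chartRep, ddbar_eq hF, hcongr.ddcFlat_eq, ddcFlat_comp (h := k) (u := fun w => F (ψ.symm w))
    (contDiffAt_comp_extChartAt_symm hF z hmem) hk, hkd, hA.mfderiv, hL.mfderiv]
  rfl

theorem isSmoothForm_ddbar [IsManifold 𝓘(ℂ, E) ∞ M] {F : M → ℝ}
    (hF : ContMDiff 𝓘(ℝ, E) 𝓘(ℝ, ℝ) ∞ F) : IsSmoothForm (ddbar (E := E) F) := by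
  intro x
  refine ContDiffOn.congr (f := fun y => (1 / 2 : ℝ) •
    ddcFlat (fun z => F ((extChartAt 𝓘(ℝ, E) x).symm z)) y) ?_ fun y hy => chartRep_ddbar hF x hy
  exact fun y hy => ((contDiffAt_ddcFlat
    (contDiffAt_comp_extChartAt_symm hF x hy)).const_smul _).contDiffWithinAt

theorem extD_ddbar [IsManifold 𝓘(ℂ, E) ∞ M] {F : M → ℝ}
    (hF : ContMDiff 𝓘(ℝ, E) 𝓘(ℝ, ℝ) ∞ F) (x : M) : extD (ddbar (E := E) F) x = 0 := by
  have hmem : extChartAt 𝓘(ℝ, E) x x ∈ (extChartAt 𝓘(ℝ, E) x).target := mem_extChartAt_target x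
  have h1 : chartRep (ddbar (E := E) F) x =ᶠ[𝓝 (extChartAt 𝓘(ℝ, E) x x)]
      fun y => (1 / 2 : ℝ) • ddcFlat (fun z => F ((extChartAt 𝓘(ℝ, E) x).symm z)) y := by
    filter_upwards [(isOpen_extChartAt_target (I := 𝓘(ℝ, E)) x).mem_nhds hmem] with z hz
    exact chartRep_ddbar hF x hz
  have h2 : extDeriv (ddcFlat fun z => F ((extChartAt 𝓘(ℝ, E) x).symm z))
      (extChartAt 𝓘(ℝ, E) x x) = 0 :=
    extDeriv_extDeriv_apply (r := ∞) (contDiffAt_dcFlat (contDiffAt_comp_extChartAt_symm hF x hmem))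
      (by simpa using ENat.LEInfty.out)
  have h3 : extDeriv (chartRep (ddbar (E := E) F) x) (extChartAt 𝓘(ℝ, E) x x) = 0 := by
    rw [h1.extDeriv_eq]
    refine (extDeriv_smul (1 / 2 : ℝ) _).trans ?_
    rw [h2, smul_zero]
  rw [extD, h3]
  rfl

/-- The form `i∂∂̄F` is of type `(1,1)`. -/
theorem ddbar_cplxJ [IsManifold 𝓘(ℂ, E) ∞ M] {F : M → ℝ}
    (hF : ContMDiff 𝓘(ℝ, E) 𝓘(ℝ, ℝ) ∞ F) (x : M) (u v : TangentSpace 𝓘(ℝ, E) x) :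
    ddbar F x ![cplxJ x u, cplxJ x v] = ddbar F x ![u, v] := by
  obtain ⟨A, -, hA⟩ := exists_hasMFDerivAt_complex
    ((contMDiffAt_extChartAt_complex x (mem_extChartAt_source (I := 𝓘(ℝ, E)) x)).mdifferentiableAt (by simp))
  rw [ddbar_eq hF, hA.mfderiv]
  have key : ∀ a b : E, ddcFlat (fun z => F ((extChartAt 𝓘(ℝ, E) x).symm z))
      (extChartAt 𝓘(ℝ, E) x x) (fun i => A (![a, b] i)) =
      ddcFlat (fun z => F ((extChartAt 𝓘(ℝ, E) x).symm z))
      (extChartAt 𝓘(ℝ, E) x x) ![A a, A b] := by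
    intro a b
    congr 1
    ext i; fin_cases i <;> rfl
  have key' : ∀ a b : E, ddcFlat (fun z => F ((extChartAt 𝓘(ℝ, E) x).symm z))
      (extChartAt 𝓘(ℝ, E) x x) (fun i => A (![Complex.I • a, Complex.I • b] i)) =
      ddcFlat (fun z => F ((extChartAt 𝓘(ℝ, E) x).symm z))
      (extChartAt 𝓘(ℝ, E) x x) (fun i => A (![a, b] i)) := by
    intro a b
    rw [key, key, map_smul, map_smul, ddcFlat_I_smul (contDiffAt_comp_extChartAt_symm hF x
      (mem_extChartAt_target x))]
  exact congrArg (fun r : ℝ => (1 / 2 : ℝ) * r) (key' u v)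

end FormsOnManifolds

end CplxLie

end

noncomputable section

namespace CplxLie

/-! ### Coordinates centred at the identity of a complex Lie group -/

section Coordinates

variable (E : Type*) [NormedAddCommGroup E] [NormedSpace ℂ E]
  {H : Type*} [TopologicalSpace H] [ChartedSpace E H] [Group H]

/-- The preferred chart at the identity, translated so as to send the identity to `0`. -/
def coord (h : H) : E := extChartAt 𝓘(ℂ, E) (1 : H) h - extChartAt 𝓘(ℂ, E) (1 : H) 1

variable {E} in
/-- The inverse of the chart `coord`. -/
def coordInv (x : E) : H := (extChartAt 𝓘(ℂ, E) (1 : H)).symm (x + extChartAt 𝓘(ℂ, E) (1 : H) 1)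

variable (H) in
/-- The domain of the chart `coord`. -/
def coordSource : Set H := (extChartAt 𝓘(ℂ, E) (1 : H)).source

variable (H) in
/-- The image of the chart `coord`. -/
def coordTarget : Set E := (fun x => x + extChartAt 𝓘(ℂ, E) (1 : H) 1) ⁻¹'
  (extChartAt 𝓘(ℂ, E) (1 : H)).target

@[simp] theorem coord_one : coord E (1 : H) = 0 := sub_self _

@[simp] theorem coordInv_zero : coordInv (0 : E) = (1 : H) := by
  simp [coordInv]

theorem isOpen_coordSource : IsOpen (coordSource E H) := isOpen_extChartAt_source (I := 𝓘(ℂ, E)) 1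

theorem one_mem_coordSource : (1 : H) ∈ coordSource E H := mem_extChartAt_source (I := 𝓘(ℂ, E)) 1

theorem coordSource_mem_nhds : coordSource E H ∈ 𝓝 (1 : H) :=
  (isOpen_coordSource E).mem_nhds (one_mem_coordSource E)

theorem isOpen_coordTarget : IsOpen (coordTarget E H) :=
  (isOpen_extChartAt_target (I := 𝓘(ℂ, E)) 1).preimage (by fun_prop)

variable (H) in
theorem zero_mem_coordTarget : (0 : E) ∈ coordTarget E H := by
  simp [coordTarget]

variable (H) in
theorem coordTarget_mem_nhds : coordTarget E H ∈ 𝓝 (0 : E) :=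
  (isOpen_coordTarget E).mem_nhds (zero_mem_coordTarget E H)

variable {E}

theorem coordInv_coord {h : H} (hh : h ∈ coordSource E H) : coordInv (coord E h) = h := by
  simpa [coordInv, coord] using (extChartAt 𝓘(ℂ, E) (1 : H)).left_inv hh

theorem coord_coordInv {x : E} (hx : x ∈ coordTarget E H) : coord E (coordInv x : H) = x := by
  have := (extChartAt 𝓘(ℂ, E) (1 : H)).right_inv hx
  rw [coordInv, coord, this, add_sub_cancel_right]

theorem coordInv_mem_coordSource {x : E} (hx : x ∈ coordTarget E H) :
    (coordInv x : H) ∈ coordSource E H :=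
  (extChartAt 𝓘(ℂ, E) (1 : H)).map_target hx

theorem coord_mem_coordTarget {h : H} (hh : h ∈ coordSource E H) :
    coord E h ∈ coordTarget E H := by
  simpa [coordTarget, coord] using (extChartAt 𝓘(ℂ, E) (1 : H)).map_source hh

theorem eventually_coord_coordInv : ∀ᶠ x in 𝓝 (0 : E), coord E (coordInv x : H) = x := by
  filter_upwards [coordTarget_mem_nhds E H] with x hx using coord_coordInv hx

section Manifold

variable [IsManifold 𝓘(ℂ, E) ∞ H]

theorem contMDiffAt_coord {h : H} (hh : h ∈ coordSource E H) :
    ContMDiffAt 𝓘(ℂ, E) 𝓘(ℂ, E) ∞ (coord E) h :=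
  ContMDiffAt.sub (contMDiffAt_extChartAt_complex 1 hh) contMDiffAt_const

theorem contMDiffAt_coordInv {x : E} (hx : x ∈ coordTarget E H) :
    ContMDiffAt 𝓘(ℂ, E) 𝓘(ℂ, E) ∞ (coordInv : E → H) x :=
  ContMDiffAt.comp x (g := (extChartAt 𝓘(ℝ, E) (1 : H)).symm)
    (mdifferentiableAt_extChartAt_symm_complex 1 hx)
    ((contDiff_id.add contDiff_const).contMDiff.contMDiffAt)

theorem continuousAt_coord {h : H} (hh : h ∈ coordSource E H) : ContinuousAt (coord E) h :=
  (contMDiffAt_coord hh).continuousAt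

theorem continuousAt_coord_one : ContinuousAt (coord E) (1 : H) :=
  continuousAt_coord (one_mem_coordSource E)

theorem continuousAt_coordInv {x : E} (hx : x ∈ coordTarget E H) :
    ContinuousAt (coordInv : E → H) x :=
  (contMDiffAt_coordInv hx).continuousAt

theorem tendsto_coordInv : Filter.Tendsto (coordInv : E → H) (𝓝 0) (𝓝 1) := by
  have := continuousAt_coordInv (zero_mem_coordTarget E H)
  rwa [ContinuousAt, coordInv_zero] at this

theorem tendsto_coord : Filter.Tendsto (coord E) (𝓝 (1 : H)) (𝓝 0) := by
  have := continuousAt_coord_one (E := E) (H := H)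
  rwa [ContinuousAt, coord_one] at this

theorem ContMDiffAt.contDiffAt_coord {E₀ : Type*} [NormedAddCommGroup E₀] [NormedSpace ℂ E₀]
    {a : E₀ → H} {x : E₀} (ha : ContMDiffAt 𝓘(ℂ, E₀) 𝓘(ℂ, E) ∞ a x)
    (hx : a x ∈ coordSource E H) : ContDiffAt ℂ ∞ (fun z => coord E (a z)) x :=
  ((contMDiffAt_coord hx).comp x ha).contDiffAt

end Manifold

variable [LieGroup 𝓘(ℂ, E) ∞ H]

variable (H) in
/-- Multiplication, in coordinates. -/
def mulCoord (p : E × E) : E := coord E (coordInv p.1 * coordInv p.2 : H)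

theorem contDiffAt_mulCoord {x y : E} (hx : x ∈ coordTarget E H) (hy : y ∈ coordTarget E H)
    (hxy : (coordInv x * coordInv y : H) ∈ coordSource E H) :
    ContDiffAt ℂ ∞ (mulCoord H : E × E → E) (x, y) := by
  refine ContMDiffAt.contDiffAt_coord (ContMDiffAt.mul ?_ ?_) hxy
  · exact ContMDiffAt.comp (x, y) (I' := 𝓘(ℂ, E)) (f := Prod.fst) (g := coordInv)
      (contMDiffAt_coordInv hx) contDiff_fst.contMDiff.contMDiffAt
  · exact ContMDiffAt.comp (x, y) (I' := 𝓘(ℂ, E)) (f := Prod.snd) (g := coordInv)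
      (contMDiffAt_coordInv hy) contDiff_snd.contMDiff.contMDiffAt

variable (E H) in
theorem contDiffAt_mulCoord_zero : ContDiffAt ℂ ∞ (mulCoord H : E × E → E) 0 :=
  contDiffAt_mulCoord (zero_mem_coordTarget E H) (zero_mem_coordTarget E H)
    (by simpa using one_mem_coordSource E)

theorem eventually_mulCoord_zero_right : ∀ᶠ x in 𝓝 (0 : E), mulCoord H (x, 0) = x := by
  filter_upwards [eventually_coord_coordInv (E := E) (H := H)] with x hx
  simpa [mulCoord] using hx

theorem eventually_mulCoord_zero_left : ∀ᶠ x in 𝓝 (0 : E), mulCoord H (0, x) = x := by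
  filter_upwards [eventually_coord_coordInv (E := E) (H := H)] with x hx
  simpa [mulCoord] using hx

variable (E H) in
-- On each coordinate axis multiplication is the identity, which determines the derivative at the
-- origin.
theorem hasStrictFDerivAt_mulCoord : HasStrictFDerivAt (mulCoord H : E × E → E)
    (ContinuousLinearMap.fst ℂ E E + ContinuousLinearMap.snd ℂ E E) 0 := by
  have h := (contDiffAt_mulCoord_zero E H).hasStrictFDerivAt (by simp)
  set D := fderiv ℂ (mulCoord H : E × E → E) 0
  have h1 : D ∘L ContinuousLinearMap.inl ℂ E E = ContinuousLinearMap.id ℂ E := by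
    have key : HasFDerivAt (mulCoord H) D (ContinuousLinearMap.inl ℂ E E 0) := by
      rw [map_zero]; exact h.hasFDerivAt
    exact (key.comp (0 : E) (ContinuousLinearMap.inl ℂ E E).hasFDerivAt).unique
      ((hasFDerivAt_id 0).congr_of_eventuallyEq eventually_mulCoord_zero_right)
  have h2 : D ∘L ContinuousLinearMap.inr ℂ E E = ContinuousLinearMap.id ℂ E := by
    have key : HasFDerivAt (mulCoord H) D (ContinuousLinearMap.inr ℂ E E 0) := by
      rw [map_zero]; exact h.hasFDerivAt
    exact (key.comp (0 : E) (ContinuousLinearMap.inr ℂ E E).hasFDerivAt).unique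
      ((hasFDerivAt_id 0).congr_of_eventuallyEq eventually_mulCoord_zero_left)
  have h3 : D = ContinuousLinearMap.fst ℂ E E + ContinuousLinearMap.snd ℂ E E := by
    ext p
    · simpa using DFunLike.congr_fun h1 p
    · simpa using DFunLike.congr_fun h2 p
  rwa [h3] at h

/-- Conjugation by `g`, in coordinates. -/
theorem contDiffAt_conj_coord (g : H) :
    ContDiffAt ℂ ∞ (fun x : E => coord E (g * coordInv x * g⁻¹ : H)) 0 :=
  ContMDiffAt.contDiffAt_coord
    ((contMDiffAt_const.mul (contMDiffAt_coordInv (zero_mem_coordTarget E H))).mul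
      contMDiffAt_const) (by simpa using one_mem_coordSource E)

variable (H) in
/-- Inversion, in coordinates. -/
def invCoord (x : E) : E := coord E (coordInv x : H)⁻¹

variable (E H) in
-- Differentiate `x x⁻¹ = 1` in coordinates, using the derivative of multiplication.
theorem hasFDerivAt_invCoord :
    HasFDerivAt (invCoord H : E → E) (-ContinuousLinearMap.id ℂ E) 0 := by
  have : IsTopologicalGroup H := topologicalGroup_of_lieGroup 𝓘(ℂ, E) ∞
  have h0 : invCoord H (0 : E) = 0 := by simp [invCoord]
  have h1 : ContDiffAt ℂ ∞ (invCoord H : E → E) 0 :=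
    ContMDiffAt.contDiffAt_coord (contMDiffAt_coordInv (zero_mem_coordTarget E H)).inv
      (by simpa using one_mem_coordSource E)
  have h2 := (h1.differentiableAt (by simp)).hasFDerivAt
  set D := fderiv ℂ (invCoord H : E → E) 0
  have h3 : HasFDerivAt (fun x : E => (x, invCoord H x)) ((ContinuousLinearMap.id ℂ E).prod D) 0 :=
    (hasFDerivAt_id 0).prodMk h2
  have h4 : HasFDerivAt (mulCoord H : E × E → E)
      (ContinuousLinearMap.fst ℂ E E + ContinuousLinearMap.snd ℂ E E) (0, invCoord H (0 : E)) := by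
    rw [h0]; exact (hasStrictFDerivAt_mulCoord E H).hasFDerivAt
  have h5 : (fun _ : E => (0 : E)) =ᶠ[𝓝 0] fun x : E => mulCoord H (x, invCoord H x) := by
    have : Filter.Tendsto (fun x : E => (coordInv x : H)⁻¹) (𝓝 0) (𝓝 1) := by
      simpa using (tendsto_coordInv (E := E) (H := H)).inv
    filter_upwards [this.eventually (coordSource_mem_nhds E)] with x hx
    rw [mulCoord, invCoord, coordInv_coord hx]
    simp
  have h6 := ((h4.comp (0 : E) h3).congr_of_eventuallyEq h5).unique
    (hasFDerivAt_const (0 : E) (0 : E))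
  have h7 : D = -ContinuousLinearMap.id ℂ E := by
    ext x
    have := DFunLike.congr_fun h6 x
    simp only [ContinuousLinearMap.comp_apply, ContinuousLinearMap.add_apply,
      ContinuousLinearMap.prod_apply, ContinuousLinearMap.coe_fst', ContinuousLinearMap.coe_snd',
      ContinuousLinearMap.id_apply, ContinuousLinearMap.zero_apply] at this
    simpa using (neg_eq_of_add_eq_zero_right this).symm
  rwa [h7] at h2

end Coordinates

end CplxLie

end

noncomputable section

namespace CplxLie

/-! ### The adjoint representation and logarithmic derivatives of curves -/

section LogDerivatives

variable {E : Type*} [NormedAddCommGroup E] [NormedSpace ℂ E]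
  {H : Type*} [TopologicalSpace H] [ChartedSpace E H] [Group H]

/-- The adjoint representation of a complex Lie group. -/
def Ad (g : H) : E →L[ℂ] E := fderiv ℂ (fun x : E => coord E (g * coordInv x * g⁻¹ : H)) 0

variable (E H) in
/-- The differential of the adjoint representation. -/
def ad : E →L[ℂ] E →L[ℂ] E := fderiv ℂ (fun x : E => (Ad (coordInv x : H) : E →L[ℂ] E)) 0

/-- `a` is a curve through the identity at time `t`, with velocity `X` there. -/
structure HasTangentAt (a : ℝ → H) (X : E) (t : ℝ) : Prop where
  eq_one : a t = 1
  continuousAt : ContinuousAt a t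
  hasDerivAt : HasDerivAt (fun s => coord E (a s)) X t

/-- `X` is the left logarithmic derivative of the curve `c` at time `t`, i.e. `c' = (L_c)_* X`. -/
def HasLogDerivAt (c : ℝ → H) (X : E) (t : ℝ) : Prop :=
  HasTangentAt (fun s => (c t)⁻¹ * c s) X t

variable [LieGroup 𝓘(ℂ, E) ∞ H]

theorem hasFDerivAt_conj_coord (g : H) :
    HasFDerivAt (fun x : E => coord E (g * coordInv x * g⁻¹ : H)) (Ad g) 0 :=
  ((contDiffAt_conj_coord g).differentiableAt (by simp)).hasFDerivAt

theorem HasTangentAt.tendsto {a : ℝ → H} {X : E} {t : ℝ} (h : HasTangentAt a X t) :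
    Filter.Tendsto a (𝓝 t) (𝓝 1) := by
  have := h.continuousAt.tendsto
  rwa [h.eq_one] at this

theorem HasTangentAt.eventually_coordInv {a : ℝ → H} {X : E} {t : ℝ} (h : HasTangentAt a X t) :
    ∀ᶠ s in 𝓝 t, coordInv (coord E (a s)) = a s := by
  filter_upwards [h.tendsto.eventually (coordSource_mem_nhds E)] with s hs using coordInv_coord hs

theorem HasTangentAt.unique {a : ℝ → H} {X Y : E} {t : ℝ} (h : HasTangentAt a X t)
    (h' : HasTangentAt a Y t) : X = Y :=
  h.hasDerivAt.unique h'.hasDerivAt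

theorem HasTangentAt.congr {a b : ℝ → H} {X : E} {t : ℝ} (h : HasTangentAt a X t)
    (hab : b =ᶠ[𝓝 t] a) : HasTangentAt b X t :=
  ⟨hab.eq_of_nhds.trans h.eq_one, h.continuousAt.congr hab.symm,
    h.hasDerivAt.congr_of_eventuallyEq (hab.fun_comp (coord E))⟩

theorem HasTangentAt.mul {a b : ℝ → H} {X Y : E} {t : ℝ} (ha : HasTangentAt a X t)
    (hb : HasTangentAt b Y t) : HasTangentAt (fun s => a s * b s) (X + Y) t := by
  have : IsTopologicalGroup H := topologicalGroup_of_lieGroup 𝓘(ℂ, E) ∞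
  refine ⟨by simp [ha.eq_one, hb.eq_one], ha.continuousAt.mul hb.continuousAt, ?_⟩
  have h0 : (coord E (a t), coord E (b t)) = 0 := by simp [ha.eq_one, hb.eq_one]
  have h1 : HasFDerivAt (mulCoord H : E × E → E)
      ((ContinuousLinearMap.fst ℂ E E + ContinuousLinearMap.snd ℂ E E).restrictScalars ℝ)
      (coord E (a t), coord E (b t)) := by
    rw [h0]; exact (hasStrictFDerivAt_mulCoord E H).hasFDerivAt.restrictScalars ℝ
  have h2 := h1.comp_hasDerivAt t (ha.hasDerivAt.prodMk hb.hasDerivAt)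
  refine HasDerivAt.congr_of_eventuallyEq (by simpa using h2) ?_
  filter_upwards [ha.eventually_coordInv, hb.eventually_coordInv] with s hs hs'
  simp [mulCoord, hs, hs']

theorem HasTangentAt.inv {a : ℝ → H} {X : E} {t : ℝ} (ha : HasTangentAt a X t) :
    HasTangentAt (fun s => (a s)⁻¹) (-X) t := by
  have : IsTopologicalGroup H := topologicalGroup_of_lieGroup 𝓘(ℂ, E) ∞
  refine ⟨by simp [ha.eq_one], ha.continuousAt.inv, ?_⟩
  have h1 : HasFDerivAt (invCoord H : E → E) ((-ContinuousLinearMap.id ℂ E).restrictScalars ℝ)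
      (coord E (a t)) := by
    rw [ha.eq_one, coord_one]; exact (hasFDerivAt_invCoord E H).restrictScalars ℝ
  have h2 := h1.comp_hasDerivAt t ha.hasDerivAt
  refine HasDerivAt.congr_of_eventuallyEq (by simpa using h2) ?_
  filter_upwards [ha.eventually_coordInv] with s hs
  simp [invCoord, hs]

theorem HasTangentAt.conj {a : ℝ → H} {X : E} {t : ℝ} (ha : HasTangentAt a X t) (g : H) :
    HasTangentAt (fun s => g * a s * g⁻¹) (Ad g X) t := by
  have : IsTopologicalGroup H := topologicalGroup_of_lieGroup 𝓘(ℂ, E) ∞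
  refine ⟨by simp [ha.eq_one], (continuousAt_const.mul ha.continuousAt).mul continuousAt_const, ?_⟩
  have h1 : HasFDerivAt (fun x : E => coord E (g * coordInv x * g⁻¹ : H))
      ((Ad g).restrictScalars ℝ) (coord E (a t)) := by
    rw [ha.eq_one, coord_one]; exact (hasFDerivAt_conj_coord g).restrictScalars ℝ
  have h2 := h1.comp_hasDerivAt t ha.hasDerivAt
  refine HasDerivAt.congr_of_eventuallyEq h2 ?_
  filter_upwards [ha.eventually_coordInv] with s hs
  simp [hs]

theorem Ad_mul (g h : H) : (Ad (g * h) : E →L[ℂ] E) = Ad g ∘L Ad h := by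
  have : IsTopologicalGroup H := topologicalGroup_of_lieGroup 𝓘(ℂ, E) ∞
  have h1 : HasFDerivAt (fun x : E => coord E (g * coordInv x * g⁻¹ : H)) (Ad g)
      (coord E (h * coordInv (0 : E) * h⁻¹ : H)) := by
    simpa using hasFDerivAt_conj_coord g
  refine (hasFDerivAt_conj_coord (g * h)).unique
    ((h1.comp (0 : E) (hasFDerivAt_conj_coord h)).congr_of_eventuallyEq ?_)
  have : Filter.Tendsto (fun x : E => (h * coordInv x * h⁻¹ : H)) (𝓝 0) (𝓝 1) := by
    simpa using ((tendsto_coordInv (E := E) (H := H)).const_mul h).mul_const h⁻¹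
  filter_upwards [this.eventually (coordSource_mem_nhds E)] with x hx
  simp only [Function.comp, coordInv_coord hx]
  congr 1
  group

@[simp] theorem Ad_one : (Ad (1 : H) : E →L[ℂ] E) = ContinuousLinearMap.id ℂ E := by
  refine (hasFDerivAt_conj_coord (1 : H)).unique ((hasFDerivAt_id 0).congr_of_eventuallyEq ?_)
  filter_upwards [eventually_coord_coordInv (E := E) (H := H)] with x hx
  simpa using hx

theorem Ad_mul_apply (g h : H) (X : E) : Ad (g * h) X = Ad g (Ad h X) := by
  rw [Ad_mul]; rfl

@[simp] theorem Ad_inv_Ad (g : H) (X : E) : Ad g⁻¹ (Ad g X) = X := by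
  rw [← Ad_mul_apply]; simp

variable (E H) in
-- Conjugation is smooth jointly in both arguments, so its partial derivative in the second one is
-- still differentiable in the first.
theorem hasFDerivAt_Ad_coordInv :
    HasFDerivAt (fun x : E => (Ad (coordInv x : H) : E →L[ℂ] E)) (ad E H) 0 := by
  have h : ContDiffAt ℂ ∞ (fun p : E × E =>
      coord E (coordInv p.1 * coordInv p.2 * (coordInv p.1)⁻¹ : H)) (0, 0) := by
    have h1 : ContMDiffAt 𝓘(ℂ, E × E) 𝓘(ℂ, E) ∞ (fun p : E × E => (coordInv p.1 : H)) (0, 0) :=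
      ContMDiffAt.comp _ (I' := 𝓘(ℂ, E)) (f := Prod.fst) (g := coordInv)
        (contMDiffAt_coordInv (zero_mem_coordTarget E H)) contDiff_fst.contMDiff.contMDiffAt
    have h2 : ContMDiffAt 𝓘(ℂ, E × E) 𝓘(ℂ, E) ∞ (fun p : E × E => (coordInv p.2 : H)) (0, 0) :=
      ContMDiffAt.comp _ (I' := 𝓘(ℂ, E)) (f := Prod.snd) (g := coordInv)
        (contMDiffAt_coordInv (zero_mem_coordTarget E H)) contDiff_snd.contMDiff.contMDiffAt
    exact ContMDiffAt.contDiffAt_coord ((h1.mul h2).mul h1.inv)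
      (by simpa using one_mem_coordSource E)
  have h3 : ContDiffAt ℂ 1 (fun x : E => (Ad (coordInv x : H) : E →L[ℂ] E)) 0 :=
    ContDiffAt.fderiv (f := fun x z : E => coord E (coordInv x * coordInv z * (coordInv x)⁻¹ : H))
      (g := fun _ => 0) (n := ∞) h contDiffAt_const (by norm_cast)
  exact (h3.differentiableAt (by simp)).hasFDerivAt

theorem HasLogDerivAt.tangent {c : ℝ → H} {X : E} {t : ℝ} (h : HasLogDerivAt c X t) :
    HasTangentAt (fun s => (c t)⁻¹ * c s) X t := h

theorem HasLogDerivAt.continuousAt {c : ℝ → H} {X : E} {t : ℝ} (h : HasLogDerivAt c X t) :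
    ContinuousAt c t := by
  have : IsTopologicalGroup H := topologicalGroup_of_lieGroup 𝓘(ℂ, E) ∞
  simpa using (h.tangent.continuousAt.const_mul (c t))

theorem HasLogDerivAt.unique {c : ℝ → H} {X Y : E} {t : ℝ} (h : HasLogDerivAt c X t)
    (h' : HasLogDerivAt c Y t) : X = Y :=
  h.tangent.unique h'

theorem hasLogDerivAt_const (g : H) (t : ℝ) : HasLogDerivAt (fun _ => g) (0 : E) t :=
  ⟨by simp, by simpa using continuousAt_const, by simpa using hasDerivAt_const t (0 : E)⟩

/-- Split `(c d)(t)⁻¹ (c d)(s)` as `d(t)⁻¹ [c(t)⁻¹ c(s)] d(t)` times `d(t)⁻¹ d(s)`: the first factor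
is a conjugate, and velocities at `1` add. -/
theorem HasLogDerivAt.mul {c d : ℝ → H} {X Y : E} {t : ℝ} (hc : HasLogDerivAt c X t)
    (hd : HasLogDerivAt d Y t) : HasLogDerivAt (fun s => c s * d s) (Ad (d t)⁻¹ X + Y) t := by
  refine ((hc.tangent.conj (d t)⁻¹).mul hd.tangent).congr (Filter.Eventually.of_forall fun s => ?_)
  simp only
  group

theorem HasLogDerivAt.inv {c : ℝ → H} {X : E} {t : ℝ} (hc : HasLogDerivAt c X t) :
    HasLogDerivAt (fun s => (c s)⁻¹) (-Ad (c t) X) t := by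
  rw [← map_neg]
  refine (hc.tangent.inv.conj (c t)).congr (Filter.Eventually.of_forall fun s => ?_)
  simp only
  group

theorem HasLogDerivAt.const_mul {c : ℝ → H} {X : E} {t : ℝ} (hc : HasLogDerivAt c X t) (g : H) :
    HasLogDerivAt (fun s => g * c s) X t :=
  hc.tangent.congr (Filter.Eventually.of_forall fun s => by simp only; group)

theorem HasLogDerivAt.mul_const {c : ℝ → H} {X : E} {t : ℝ} (hc : HasLogDerivAt c X t) (g : H) :
    HasLogDerivAt (fun s => c s * g) (Ad g⁻¹ X) t := by
  simpa using hc.mul (hasLogDerivAt_const (E := E) g t)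

theorem HasLogDerivAt.comp {c : ℝ → H} {X : E} {τ : ℝ → ℝ} {r t : ℝ}
    (hc : HasLogDerivAt c X (τ t)) (hτ : HasDerivAt τ r t) :
    HasLogDerivAt (fun s => c (τ s)) (r • X) t :=
  ⟨by simp, hc.tangent.continuousAt.comp (f := τ) hτ.continuousAt,
    hc.tangent.hasDerivAt.scomp t hτ⟩

/-- The adjoint representation along a curve. -/
theorem HasLogDerivAt.hasDerivAt_Ad {c : ℝ → H} {X : E} {t : ℝ} (hc : HasLogDerivAt c X t) :
    HasDerivAt (fun s => (Ad (c s) : E →L[ℂ] E)) (Ad (c t) ∘L ad E H X) t := by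
  have h1 : HasFDerivAt (fun x : E => (Ad (coordInv x : H) : E →L[ℂ] E))
      ((ad E H).restrictScalars ℝ) (coord E ((c t)⁻¹ * c t)) := by
    simpa using (hasFDerivAt_Ad_coordInv E H).restrictScalars ℝ
  have h2 := h1.comp_hasDerivAt t hc.tangent.hasDerivAt
  let Λ : (E →L[ℂ] E) →L[ℝ] E →L[ℂ] E :=
    (ContinuousLinearMap.compL ℂ E E E (Ad (c t))).restrictScalars ℝ
  refine (Λ.hasFDerivAt.comp_hasDerivAt t h2).congr_of_eventuallyEq ?_
  filter_upwards [hc.tangent.eventually_coordInv] with s hs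
  simp only [Function.comp, hs]
  change Ad (c s) = Ad (c t) ∘L Ad ((c t)⁻¹ * c s)
  rw [← Ad_mul]
  simp

theorem HasLogDerivAt.hasDerivAt_Ad_apply {c : ℝ → H} {X : E} {t : ℝ} (hc : HasLogDerivAt c X t)
    (Y : E) : HasDerivAt (fun s => Ad (c s) Y) (Ad (c t) (ad E H X Y)) t := by
  let Λ : (E →L[ℂ] E) →L[ℝ] E := (ContinuousLinearMap.apply ℂ E Y).restrictScalars ℝ
  exact Λ.hasFDerivAt.comp_hasDerivAt t hc.hasDerivAt_Ad

end LogDerivatives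

end CplxLie

end

noncomputable section

namespace CplxLie

/-! ### Curves with prescribed logarithmic derivative -/

section Curves

variable {E : Type*} [NormedAddCommGroup E] [NormedSpace ℂ E]
  {H : Type*} [TopologicalSpace H] [ChartedSpace E H] [Group H] [LieGroup 𝓘(ℂ, E) ∞ H]

variable (H) in
/-- The differential at the identity of left translation by the point of coordinates `x`. -/
def velCoord (x : E) : E →L[ℂ] E := fderiv ℂ (fun y : E => mulCoord H (x, y)) 0

theorem hasFDerivAt_velCoord {x : E} (hx : x ∈ coordTarget E H) :
    HasFDerivAt (fun y : E => mulCoord H (x, y)) (velCoord H x) 0 := by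
  have h : ContDiffAt ℂ ∞ (mulCoord H : E × E → E) (x, 0) :=
    contDiffAt_mulCoord hx (zero_mem_coordTarget E H) (by simpa using coordInv_mem_coordSource hx)
  have h2 : ContDiffAt ℂ ∞ (fun y : E => mulCoord H (x, y)) 0 :=
    ContDiffAt.comp (0 : E) (g := mulCoord H) (f := fun y => (x, y)) h (contDiffAt_const.prodMk contDiffAt_id)
  exact (h2.differentiableAt (by simp)).hasFDerivAt

@[simp] theorem velCoord_zero : velCoord H (0 : E) = ContinuousLinearMap.id ℂ E :=
  (hasFDerivAt_velCoord (zero_mem_coordTarget E H)).unique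
    ((hasFDerivAt_id 0).congr_of_eventuallyEq eventually_mulCoord_zero_left)

theorem continuousAt_velCoord : ContinuousAt (velCoord H : E → E →L[ℂ] E) 0 := by
  have h : ContDiffAt ℂ 1 (velCoord H : E → E →L[ℂ] E) 0 :=
    ContDiffAt.fderiv (f := fun x z : E => mulCoord H (x, z)) (g := fun _ => 0) (n := ∞)
      (contDiffAt_mulCoord_zero E H) contDiffAt_const (by norm_cast)
  exact h.continuousAt

/-- The velocity in coordinates of a curve with given logarithmic derivative. -/
theorem HasLogDerivAt.hasDerivAt_coord {c : ℝ → H} {X : E} {t : ℝ} (hc : HasLogDerivAt c X t)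
    {g : H} (hg : g * c t ∈ coordSource E H) :
    HasDerivAt (fun s => coord E (g * c s)) (velCoord H (coord E (g * c t)) X) t := by
  have h1 : HasFDerivAt (fun y : E => mulCoord H (coord E (g * c t), y))
      ((velCoord H (coord E (g * c t))).restrictScalars ℝ) (coord E ((c t)⁻¹ * c t)) := by
    simpa using (hasFDerivAt_velCoord (coord_mem_coordTarget hg)).restrictScalars ℝ
  refine (h1.comp_hasDerivAt t hc.tangent.hasDerivAt).congr_of_eventuallyEq ?_
  filter_upwards [hc.tangent.eventually_coordInv] with s hs
  simp only [Function.comp, mulCoord, hs, coordInv_coord hg]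
  congr 1
  group

/-- In coordinates around any `c r` the velocity vanishes, so `c` is locally constant; the set where
it takes a given value is clopen in `ℝ`. -/
theorem eq_of_hasLogDerivAt_zero {c : ℝ → H} (hc : ∀ t, HasLogDerivAt c (0 : E) t) (s t : ℝ) :
    c s = c t := by
  have : IsTopologicalGroup H := topologicalGroup_of_lieGroup 𝓘(ℂ, E) ∞
  have : T2Space H := t2Space_of_chartedSpace E
  have hcont : Continuous c := continuous_iff_continuousAt.2 fun t => (hc t).continuousAt
  suffices h : {s | c s = c t} = Set.univ from Set.eq_univ_iff_forall.1 h s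
  refine IsClopen.eq_univ ⟨isClosed_eq hcont continuous_const, isOpen_iff_mem_nhds.2 fun r hr => ?_⟩
    ⟨t, rfl⟩
  have h1 : ∀ᶠ s in 𝓝 r, (c r)⁻¹ * c s ∈ coordSource E H :=
    (hc r).tangent.tendsto.eventually (coordSource_mem_nhds E)
  obtain ⟨ε, hε, h2⟩ := Metric.eventually_nhds_iff_ball.1 h1
  filter_upwards [Metric.ball_mem_nhds r hε] with s hs
  have h3 : ∀ x ∈ Metric.ball r ε, HasDerivWithinAt (fun s => coord E ((c r)⁻¹ * c s)) 0
      (Metric.ball r ε) x := fun x hx => by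
    simpa using ((hc x).hasDerivAt_coord (h2 x hx)).hasDerivWithinAt
  have h4 := (convex_ball r ε).is_const_of_fderivWithin_eq_zero (𝕜 := ℝ)
    (f := fun s => coord E ((c r)⁻¹ * c s))
    (fun x hx => (h3 x hx).differentiableWithinAt)
    (fun x hx => by
      have := ((h3 x hx).hasFDerivWithinAt).fderivWithin (Metric.isOpen_ball.uniqueDiffWithinAt hx)
      simpa using this) hs (Metric.mem_ball_self hε)
  have h5 : (c r)⁻¹ * c s = (c r)⁻¹ * c r := by
    rw [← coordInv_coord (h2 s hs), ← coordInv_coord (h2 r (Metric.mem_ball_self hε))]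
    exact congrArg coordInv h4
  exact (mul_left_cancel h5).trans hr

/-- The logarithmic derivative of `c d⁻¹` is `Ad(d) X - Ad(d) X = 0`. -/
theorem HasLogDerivAt.eq_of_eq {c d : ℝ → H} {X : ℝ → E} (hc : ∀ t, HasLogDerivAt c (X t) t)
    (hd : ∀ t, HasLogDerivAt d (X t) t) {t : ℝ} (h : c t = d t) (s : ℝ) : c s = d s := by
  have h1 : ∀ r, HasLogDerivAt (fun s => c s * (d s)⁻¹) (0 : E) r := fun r => by
    simpa using (hc r).mul (hd r).inv
  have h2 := eq_of_hasLogDerivAt_zero h1 s t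
  simp only [h, mul_inv_cancel] at h2
  exact mul_inv_eq_one.1 h2

/-! ### Integral curves of left-invariant vector fields -/

theorem hasMFDerivAt_curve {a : ℝ → H} {X : E} {t : ℝ} {e : H} (he : a t = e)
    (hc : ContinuousAt a t) (h : HasDerivAt (fun s => extChartAt 𝓘(ℝ, E) e (a s)) X t) :
    HasMFDerivAt 𝓘(ℝ, ℝ) 𝓘(ℝ, E) a t
      (ContinuousLinearMap.smulRight (1 : ℝ →L[ℝ] ℝ) X : ℝ →L[ℝ] E) := by
  subst he
  refine ⟨hc, ?_⟩
  change HasFDerivWithinAt (fun s => extChartAt 𝓘(ℝ, E) (a t) (a s))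
    (ContinuousLinearMap.smulRight (1 : ℝ →L[ℝ] ℝ) X) (Set.range id) t
  have e : ContinuousLinearMap.smulRight (1 : ℝ →L[ℝ] ℝ) X =
      ContinuousLinearMap.toSpanSingleton ℝ X := by ext; simp
  rw [e]
  exact h.hasFDerivAt.hasFDerivWithinAt

theorem hasDerivAt_of_hasMFDerivAt_curve {a : ℝ → H} {X : E} {t : ℝ} {e : H} (he : a t = e)
    (h : HasMFDerivAt 𝓘(ℝ, ℝ) 𝓘(ℝ, E) a t
      (ContinuousLinearMap.smulRight (1 : ℝ →L[ℝ] ℝ) X : ℝ →L[ℝ] E)) :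
    HasDerivAt (fun s => extChartAt 𝓘(ℝ, E) e (a s)) X t := by
  subst he
  have h2 : HasFDerivWithinAt (fun s => extChartAt 𝓘(ℝ, E) (a t) (a s))
    (ContinuousLinearMap.smulRight (1 : ℝ →L[ℝ] ℝ) X) (Set.range id) t := h.2
  rw [Set.range_id, hasFDerivWithinAt_univ] at h2
  simpa using h2.hasDerivAt

theorem hasTangentAt_iff {a : ℝ → H} {X : E} {t : ℝ} (he : a t = 1) :
    HasTangentAt a X t ↔ HasMFDerivAt 𝓘(ℝ, ℝ) 𝓘(ℝ, E) a t
      (ContinuousLinearMap.smulRight (1 : ℝ →L[ℝ] ℝ) X : ℝ →L[ℝ] E) := by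
  refine ⟨fun h => hasMFDerivAt_curve he h.continuousAt ?_, fun h => ⟨he, h.continuousAt, ?_⟩⟩
  · exact (hasDerivAt_sub_const_iff _).1 h.hasDerivAt
  · exact (hasDerivAt_sub_const_iff _).2 (hasDerivAt_of_hasMFDerivAt_curve he h)

theorem exists_hasMFDerivAt_mul_left (g k : H) : ∃ L : E →L[ℂ] E,
    HasMFDerivAt 𝓘(ℂ, E) 𝓘(ℂ, E) (fun h : H => g * h) k L ∧
      HasMFDerivAt 𝓘(ℝ, E) 𝓘(ℝ, E) (fun h : H => g * h) k (L.restrictScalars ℝ) :=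
  exists_hasMFDerivAt_complex
    ((contMDiff_mul_left (I := 𝓘(ℂ, E)) (n := ∞)).mdifferentiableAt (by simp))

/-- Bridge between logarithmic derivatives and integral curves of left-invariant fields: the
differentials of left translation by `c t` and by its inverse cancel. -/
theorem hasLogDerivAt_iff {c : ℝ → H} {X : E} {t : ℝ} :
    HasLogDerivAt c X t ↔ HasMFDerivAt 𝓘(ℝ, ℝ) 𝓘(ℝ, E) c t
      (ContinuousLinearMap.smulRight (1 : ℝ →L[ℝ] ℝ)
        (mulInvariantVectorField (I := 𝓘(ℝ, E)) X (c t) : E) : ℝ →L[ℝ] E) := by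
  obtain ⟨L, -, hL⟩ := exists_hasMFDerivAt_mul_left (E := E) (c t) 1
  obtain ⟨L', -, hL'⟩ := exists_hasMFDerivAt_mul_left (E := E) (c t)⁻¹ (c t * 1)
  have hX : (mulInvariantVectorField (I := 𝓘(ℝ, E)) X (c t) : E) = L X := by
    change (mfderiv 𝓘(ℝ, E) 𝓘(ℝ, E) (fun h : H => c t * h) 1 : E →L[ℝ] E) X = L X
    rw [hL.mfderiv]; rfl
  have hLL : L' (L X) = X := by
    have h1 : HasMFDerivAt 𝓘(ℝ, E) 𝓘(ℝ, E) ((fun h : H => (c t)⁻¹ * h) ∘ fun h => c t * h) 1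
        (L'.restrictScalars ℝ ∘L L.restrictScalars ℝ) := hL'.comp 1 hL
    have h2 := hasMFDerivAt_unique (h1.congr_of_eventuallyEq (f₁ := id)
      (Filter.Eventually.of_forall fun h => by simp)) (hasMFDerivAt_id (I := 𝓘(ℝ, E)) (1 : H))
    exact DFunLike.congr_fun h2 X
  rw [HasLogDerivAt, hasTangentAt_iff (by simp), hX]
  constructor
  · intro h
    have h1 : ∀ e : H, (c t)⁻¹ * c t = e → HasMFDerivAt 𝓘(ℝ, E) 𝓘(ℝ, E) (fun h : H => c t * h) e
        (L.restrictScalars ℝ) → HasMFDerivAt 𝓘(ℝ, ℝ) 𝓘(ℝ, E)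
        ((fun h : H => c t * h) ∘ fun s => (c t)⁻¹ * c s) t (L.restrictScalars ℝ ∘L
          (ContinuousLinearMap.smulRight (1 : ℝ →L[ℝ] ℝ) X : ℝ →L[ℝ] E)) := by
      rintro e rfl he
      exact he.comp t h
    have h2 : (L.restrictScalars ℝ ∘L (ContinuousLinearMap.smulRight (1 : ℝ →L[ℝ] ℝ) X) :
        ℝ →L[ℝ] E) = ContinuousLinearMap.smulRight (1 : ℝ →L[ℝ] ℝ) (L X) := by ext; simp
    have h3 := h1 1 (by simp) hL
    rw [← h2]
    exact h3.congr_of_eventuallyEq (f₁ := c) (Filter.Eventually.of_forall fun s => by simp)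
  · intro h
    have h1 : HasMFDerivAt 𝓘(ℝ, E) 𝓘(ℝ, E) (fun h : H => (c t)⁻¹ * h) (c t)
      (L'.restrictScalars ℝ) := by rwa [mul_one] at hL'
    have h2 : (L'.restrictScalars ℝ ∘L (ContinuousLinearMap.smulRight (1 : ℝ →L[ℝ] ℝ) (L X)) :
        ℝ →L[ℝ] E) = ContinuousLinearMap.smulRight (1 : ℝ →L[ℝ] ℝ) X := by ext; simp [hLL]
    have h3 := h1.comp t h
    rw [← h2]
    exact h3

/-- Left-invariant vector fields are complete. -/
theorem exists_hasLogDerivAt [CompleteSpace E] (X : E) :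
    ∃ c : ℝ → H, c 0 = 1 ∧ ∀ t, HasLogDerivAt c X t := by
  have : LieGroup 𝓘(ℝ, E) ∞ H := lieGroup_real_of_complex
  have : LieGroup 𝓘(ℝ, E) (minSmoothness ℝ 3) H := LieGroup.of_le (n := ∞)
    (by simpa using ENat.LEInfty.out)
  have : IsTopologicalGroup H := topologicalGroup_of_lieGroup 𝓘(ℂ, E) ∞
  have : T2Space H := t2Space_of_chartedSpace E
  have hv : ContMDiff 𝓘(ℝ, E) 𝓘(ℝ, E).tangent 1 (fun g : H =>
      (⟨g, mulInvariantVectorField (I := 𝓘(ℝ, E)) X g⟩ : TangentBundle 𝓘(ℝ, E) H)) :=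
    (contMDiff_mulInvariantVectorField (I := 𝓘(ℝ, E)) (G := H) X).of_le (by simp)
  obtain ⟨γ, hγ0, hγ⟩ := exists_isMIntegralCurveAt_of_contMDiffAt_boundaryless 0
    (hv.contMDiffAt (x := (1 : H)))
  obtain ⟨ε, hε, hball⟩ := Metric.eventually_nhds_iff_ball.1 hγ
  -- Left translates of the local curve through `1` give integral curves through every point on one
  -- common time interval, which is enough for a global solution.
  obtain ⟨c, hc0, hc⟩ := exists_isMIntegralCurve_of_isMIntegralCurveOn hv hε (fun x =>
    ⟨fun t => x * γ t, by simp [hγ0], fun t ht =>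
      (hasLogDerivAt_iff.1 ((hasLogDerivAt_iff.2 (hball t
        (by simpa [Real.ball_eq_Ioo] using ht))).const_mul x)).hasMFDerivWithinAt⟩) (1 : H)
  exact ⟨c, hc0, fun t => hasLogDerivAt_iff.2 (hc t)⟩

/-- The one-parameter subgroup generated by `X`. -/
def oneParam (H : Type*) [TopologicalSpace H] [ChartedSpace E H] [Group H]
    [LieGroup 𝓘(ℂ, E) ∞ H] [CompleteSpace E] (X : E) : ℝ → H :=
  (exists_hasLogDerivAt X).choose

variable [CompleteSpace E]

@[simp] theorem oneParam_zero (X : E) : oneParam H X 0 = 1 :=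
  (exists_hasLogDerivAt (H := H) X).choose_spec.1

theorem hasLogDerivAt_oneParam (X : E) (t : ℝ) : HasLogDerivAt (oneParam H X) X t :=
  (exists_hasLogDerivAt (H := H) X).choose_spec.2 t

theorem oneParam_smul (r : ℝ) (X : E) (t : ℝ) : oneParam H (r • X) t = oneParam H X (r * t) := by
  refine HasLogDerivAt.eq_of_eq (X := fun _ => r • X) (d := fun t => oneParam H X (r * t))
    (hasLogDerivAt_oneParam (r • X)) (fun s => ?_) (t := 0) (by simp) t
  exact HasLogDerivAt.comp (τ := fun s => r * s) (hasLogDerivAt_oneParam X (r * s))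
    (by simpa using (hasDerivAt_id s).const_mul r)

@[simp] theorem oneParam_zero_left (t : ℝ) : oneParam H (0 : E) t = 1 := by
  have := oneParam_smul (H := H) 0 (0 : E) t
  rwa [zero_smul, zero_mul, oneParam_zero] at this

end Curves

end CplxLie

end

noncomputable section

namespace CplxLie

/-! ### Differentiability of the exponential map -/

section Exponential

variable {E : Type*} [NormedAddCommGroup E] [NormedSpace ℂ E] [FiniteDimensional ℂ E]
  {H : Type*} [TopologicalSpace H] [ChartedSpace E H] [Group H] [LieGroup 𝓘(ℂ, E) ∞ H]

variable (E H) in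
/-- A curve with small logarithmic derivative `W` is, in coordinates, close to `∫ W`. -/
theorem exists_norm_coord_sub_le {η : ℝ} (hη : 0 < η) : ∃ δ > 0, ∀ (c : ℝ → H) (W w : ℝ → E) (ε : ℝ),
    c 0 = 1 → (∀ t, HasLogDerivAt c (W t) t) → (∀ t, HasDerivAt w (W t) t) → w 0 = 0 → ε ≤ δ →
    (∀ t ∈ Set.Icc (0 : ℝ) 1, ‖W t‖ ≤ ε) →
    c 1 ∈ coordSource E H ∧ ‖coord E (c 1) - w 1‖ ≤ η * ε := by
  have : IsTopologicalGroup H := topologicalGroup_of_lieGroup 𝓘(ℂ, E) ∞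
  have : T2Space H := t2Space_of_chartedSpace E
  have : ProperSpace E := FiniteDimensional.proper ℂ E
  -- The bound by `1` limits the coordinate speed to `2ε`; the bound by `η` gives the final
  -- estimate.
  have hV : ∀ᶠ x in 𝓝 (0 : E), ‖velCoord H x - ContinuousLinearMap.id ℂ E‖ < min η 1 := by
    have h := continuousAt_velCoord (E := E) (H := H)
    rw [ContinuousAt, velCoord_zero] at h
    simpa [dist_eq_norm] using h.eventually (Metric.ball_mem_nhds _ (lt_min hη one_pos))
  obtain ⟨r, hr, hball⟩ := Metric.eventually_nhds_iff_ball.1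
    (hV.and (coordTarget_mem_nhds E H))
  -- At speed at most `2ε ≤ r / 2`, the curve stays within radius `r / 2` during unit time, well
  -- inside the ball of radius `r`.
  refine ⟨r / 4, by positivity, fun c W w ε hc0 hc hw hw0 hε hW => ?_⟩
  have hε0 : 0 ≤ ε := (norm_nonneg _).trans (hW 0 (by simp))
  have hcont : Continuous c := continuous_iff_continuousAt.2 fun t => (hc t).continuousAt
  set O : Set H := coordSource E H ∩ coord E ⁻¹' Metric.ball 0 r
  have hO : IsOpen O := ContinuousOn.isOpen_inter_preimage
    (fun h hh => (continuousAt_coord hh).continuousWithinAt) (isOpen_coordSource E)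
    Metric.isOpen_ball
  have hder : ∀ t, c t ∈ O → HasDerivAt (fun s => coord E (c s))
      (velCoord H (coord E (c t)) (W t)) t := fun t ht => by
    simpa using (hc t).hasDerivAt_coord (g := 1) (by simpa using ht.1)
  have hvel : ∀ t ∈ Set.Icc (0 : ℝ) 1, c t ∈ O →
      ‖velCoord H (coord E (c t)) (W t) - W t‖ ≤ min η 1 * ε := fun t ht htO => by
    have h1 := ((velCoord H (coord E (c t)) - ContinuousLinearMap.id ℂ E).le_opNorm (W t)).trans
      (mul_le_mul (hball _ htO.2).1.le (hW t ht) (norm_nonneg _) (by positivity))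
    simpa using h1
  have hvel' : ∀ t ∈ Set.Icc (0 : ℝ) 1, c t ∈ O → ‖velCoord H (coord E (c t)) (W t)‖ ≤ 2 * ε :=
    fun t ht htO => by
    have h1 : min η 1 * ε ≤ 1 * ε := mul_le_mul_of_nonneg_right (min_le_right _ _) hε0
    have h2 := norm_add_le (velCoord H (coord E (c t)) (W t) - W t) (W t)
    rw [sub_add_cancel] at h2
    linarith [hvel t ht htO, hW t ht]
  have hstay : ∀ t ∈ Set.Icc (0 : ℝ) 1, c t ∈ O := by
    by_contra hne
    push Not at hne
    obtain ⟨t₁, ht₁, ht₁O⟩ := hne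
    have hcomp : IsCompact (Set.Icc (0 : ℝ) 1 ∩ c ⁻¹' Oᶜ) :=
      isCompact_Icc.inter_right (hO.isClosed_compl.preimage hcont)
    obtain ⟨t₀, ⟨ht₀, ht₀O⟩, hmin⟩ := hcomp.exists_isLeast ⟨t₁, ht₁, ht₁O⟩
    have hlt : ∀ t ∈ Set.Ico 0 t₀, c t ∈ O := fun t ht => by
      by_contra h
      exact absurd (hmin ⟨⟨ht.1, ht.2.le.trans ht₀.2⟩, h⟩) (not_le.2 ht.2)
    have hpos : 0 < t₀ := by
      refine lt_of_le_of_ne ht₀.1 fun h => ht₀O ?_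
      rw [← h, hc0]
      exact ⟨one_mem_coordSource E, by simpa using hr⟩
    -- `K` is compact, hence closed, and contained in `O`. Before the first exit time `t₀` the speed
    -- bound keeps the curve in `K`, so `c t₀` is in `K` too, contradicting the exit from `O`.
    set K : Set H := coordInv '' Metric.closedBall (0 : E) (r / 2)
    have hsub : Metric.closedBall (0 : E) (r / 2) ⊆ Metric.ball 0 r :=
      Metric.closedBall_subset_ball (by linarith)
    have hK : IsClosed K := ((isCompact_closedBall (0 : E) (r / 2)).image_of_continuousOn
      fun x hx => (continuousAt_coordInv (hball x (hsub hx)).2).continuousWithinAt).isClosed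
    have hIn : Set.Ico 0 t₀ ⊆ c ⁻¹' K := fun t ht => by
      have hmem : ∀ s ∈ Set.Icc 0 t, s ∈ Set.Icc (0 : ℝ) 1 ∧ c s ∈ O := fun s hs =>
        ⟨⟨hs.1, hs.2.trans (ht.2.le.trans ht₀.2)⟩, hlt s ⟨hs.1, hs.2.trans_lt ht.2⟩⟩
      have h1 := norm_image_sub_le_of_norm_deriv_le_segment' (f := fun s => coord E (c s))
        (f' := fun s => velCoord H (coord E (c s)) (W s)) (C := 2 * ε) (a := 0) (b := t)
        (fun s hs => (hder s (hmem s hs).2).hasDerivWithinAt)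
        (fun s hs => hvel' s (hmem s (Set.Ico_subset_Icc_self hs)).1
          (hmem s (Set.Ico_subset_Icc_self hs)).2) t ⟨ht.1, le_rfl⟩
      simp only [hc0, coord_one, sub_zero] at h1
      refine ⟨coord E (c t), ?_, coordInv_coord (hlt t ht).1⟩
      rw [mem_closedBall_zero_iff]
      have : t ≤ 1 := ht.2.le.trans ht₀.2
      nlinarith [mul_le_mul_of_nonneg_left this hε0]
    have ht₀K : c t₀ ∈ K := by
      have h1 := closure_minimal hIn (hK.preimage hcont)
      rw [closure_Ico hpos.ne] at h1
      exact h1 ⟨hpos.le, le_rfl⟩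
    obtain ⟨x, hx, hxc⟩ := ht₀K
    refine ht₀O ?_
    rw [← hxc]
    have hxT := (hball x (hsub hx)).2
    exact ⟨coordInv_mem_coordSource hxT, by
      rw [Set.mem_preimage, coord_coordInv hxT]; exact hsub hx⟩
  refine ⟨(hstay 1 (by simp)).1, ?_⟩
  have h1 := norm_image_sub_le_of_norm_deriv_le_segment' (f := fun s => coord E (c s) - w s)
    (f' := fun s => velCoord H (coord E (c s)) (W s) - W s) (C := min η 1 * ε) (a := 0) (b := 1)
    (fun s hs => ((hder s (hstay s hs)).sub (hw s)).hasDerivWithinAt)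
    (fun s hs => hvel s (Set.Ico_subset_Icc_self hs) (hstay s (Set.Ico_subset_Icc_self hs))) 1
    (by simp)
  simp only [hc0, hw0, coord_one, sub_zero, mul_one] at h1
  exact h1.trans (mul_le_mul_of_nonneg_right (min_le_left _ _) hε0)

end Exponential

end CplxLie

end

/-! ### The differential of the exponential as an integral of `exp(s ad X)` -/

noncomputable section

namespace CplxLie

section Exponential

variable {E : Type*} [NormedAddCommGroup E] [NormedSpace ℂ E] [FiniteDimensional ℂ E]
  {H : Type*} [TopologicalSpace H] [ChartedSpace E H] [Group H] [LieGroup 𝓘(ℂ, E) ∞ H]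

instance completeSpace_of_finiteDimensional_complex : CompleteSpace E :=
  FiniteDimensional.complete ℂ E

/-- The product of `Ad(exp(tX))` with `exp(-t ad X)` has zero derivative in `t`. -/
theorem Ad_oneParam (X : E) (t : ℝ) :
    Ad (oneParam H X t) = NormedSpace.exp (t • ad E H X) := by
  have h1 : ∀ s : ℝ, HasDerivAt (fun s => (Ad (oneParam H X s) : E →L[ℂ] E) *
      NormedSpace.exp (s • -ad E H X)) 0 s := fun s => by
    have h2 : HasDerivAt (fun s => (Ad (oneParam H X s) : E →L[ℂ] E))
      (Ad (oneParam H X s) * ad E H X) s := (hasLogDerivAt_oneParam X s).hasDerivAt_Ad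
    have h3 := hasDerivAt_exp_smul_const' (𝕂 := ℝ) (-ad E H X) s
    refine (h2.mul h3).congr_deriv ?_
    simp [mul_assoc]
  have h4 := is_const_of_deriv_eq_zero (fun s => (h1 s).differentiableAt)
    (fun s => (h1 s).deriv) t 0
  simp only [oneParam_zero, Ad_one, zero_smul, NormedSpace.exp_zero, mul_one] at h4
  let _ : NormedAlgebra ℚ (E →L[ℂ] E) := NormedAlgebra.restrictScalars ℚ ℂ _
  have h5 : NormedSpace.exp (t • -ad E H X) * NormedSpace.exp (t • ad E H X) = 1 := by
    rw [← NormedSpace.exp_add_of_commute]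
    · simp
    · simp
  calc (Ad (oneParam H X t) : E →L[ℂ] E) = Ad (oneParam H X t) *
      (NormedSpace.exp (t • -ad E H X) * NormedSpace.exp (t • ad E H X)) := by rw [h5, mul_one]
    _ = _ := by rw [← mul_assoc, h4]; exact one_mul _

variable (H) in
theorem continuous_exp_smul_ad : Continuous fun p : E × ℝ => NormedSpace.exp (p.2 • ad E H p.1) := by
  let _ : NormedAlgebra ℚ (E →L[ℂ] E) := NormedAlgebra.restrictScalars ℚ ℂ _
  exact NormedSpace.exp_continuous.comp (by fun_prop)

variable (H) in
/-- The differential of the exponential map at `X`, trivialised by right translations. -/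
def dexp (X : E) : E →L[ℂ] E := ∫ s in (0 : ℝ)..1, NormedSpace.exp (s • ad E H X)

theorem continuous_dexp : Continuous (dexp H : E → E →L[ℂ] E) :=
  intervalIntegral.continuous_parametric_intervalIntegral_of_continuous'
    (f := fun (X : E) (s : ℝ) => NormedSpace.exp (s • ad E H X)) (continuous_exp_smul_ad H) 0 1

/-- The product rule gives `Ad(exp(tX))(X + Y) - Ad(exp(tX)) X`. This curve compares two
exponentials and has a small logarithmic derivative when `Y` is small. -/
theorem hasLogDerivAt_oneParam_mul_inv (X Y : E) (t : ℝ) :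
    HasLogDerivAt (fun t => oneParam H (X + Y) t * (oneParam H X t)⁻¹)
      (NormedSpace.exp (t • ad E H X) Y) t := by
  rw [← Ad_oneParam]
  simpa using (hasLogDerivAt_oneParam (H := H) (X + Y) t).mul (hasLogDerivAt_oneParam X t).inv

variable (H) in
-- Apply `exists_norm_coord_sub_le` to the comparison curve between `p.2` and `p.1`: the integral of
-- its logarithmic derivative over unit time is `dexp H p.2 (p.1 - p.2)`. Compactness bounds `exp(t
-- ad p.2)` uniformly near `X₀`.
theorem exists_norm_coord_oneParam_sub_le (X₀ : E) {η : ℝ} (hη : 0 < η) :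
    ∀ᶠ p in 𝓝 (X₀, X₀), oneParam H p.1 1 * (oneParam H p.2 1)⁻¹ ∈ coordSource E H ∧
      ‖coord E (oneParam H p.1 1 * (oneParam H p.2 1)⁻¹) - dexp H p.2 (p.1 - p.2)‖ ≤
        η * ‖p.1 - p.2‖ := by
  have : ProperSpace E := FiniteDimensional.proper ℂ E
  obtain ⟨C, hC⟩ := ((isCompact_closedBall X₀ 1).prod
    (isCompact_Icc (a := (0 : ℝ)) (b := 1))).exists_bound_of_continuousOn
    (continuous_exp_smul_ad H).continuousOn
  have hC' : 0 < max C 1 := lt_of_lt_of_le one_pos (le_max_right _ _)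
  obtain ⟨δ, hδ, h⟩ := exists_norm_coord_sub_le E H (div_pos hη hC')
  have h1 : ∀ᶠ p in 𝓝 (X₀, X₀), p.2 ∈ Metric.closedBall X₀ 1 :=
    continuousAt_snd.eventually (Metric.closedBall_mem_nhds X₀ one_pos)
  have h2 : ∀ᶠ p : E × E in 𝓝 (X₀, X₀), max C 1 * ‖p.1 - p.2‖ < δ := by
    have : Continuous fun p : E × E => max C 1 * ‖p.1 - p.2‖ := by fun_prop
    exact this.continuousAt.eventually_lt continuousAt_const (by simpa using hδ)
  filter_upwards [h1, h2] with p hp1 hp2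
  have hW : ∀ t ∈ Set.Icc (0 : ℝ) 1,
      ‖NormedSpace.exp (t • ad E H p.2) (p.1 - p.2)‖ ≤ max C 1 * ‖p.1 - p.2‖ := fun t ht =>
    (ContinuousLinearMap.le_opNorm _ _).trans
      (mul_le_mul_of_nonneg_right ((hC (p.2, t) ⟨hp1, ht⟩).trans (le_max_left _ _)) (norm_nonneg _))
  have hcont : Continuous fun s : ℝ => NormedSpace.exp (s • ad E H p.2) :=
    (continuous_exp_smul_ad H).comp (by fun_prop : Continuous fun s : ℝ => (p.2, s))
  have hw : ∀ t : ℝ, HasDerivAt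
      (fun t : ℝ => (∫ s in (0 : ℝ)..t, NormedSpace.exp (s • ad E H p.2)) (p.1 - p.2))
      (NormedSpace.exp (t • ad E H p.2) (p.1 - p.2)) t := fun t => by
    let Λ : (E →L[ℂ] E) →L[ℝ] E := (ContinuousLinearMap.apply ℂ E (p.1 - p.2)).restrictScalars ℝ
    exact Λ.hasFDerivAt.comp_hasDerivAt t (hcont.integral_hasStrictDerivAt 0 t).hasDerivAt
  have key := h (fun t => oneParam H p.1 t * (oneParam H p.2 t)⁻¹) _ _ _ (by simp)
    (fun t => by simpa using hasLogDerivAt_oneParam_mul_inv p.2 (p.1 - p.2) t) hw (by simp)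
    hp2.le hW
  refine ⟨key.1, key.2.trans (le_of_eq ?_)⟩
  field_simp

end Exponential

end CplxLie

end

/-! ### Strict differentiability and continuity of the exponential -/

noncomputable section

namespace CplxLie

section Exponential

variable {E : Type*} [NormedAddCommGroup E] [NormedSpace ℂ E] [FiniteDimensional ℂ E]
  {H : Type*} [TopologicalSpace H] [ChartedSpace E H] [Group H] [LieGroup 𝓘(ℂ, E) ∞ H]

variable (H) in
/-- The quotient of two exponentials, in coordinates. -/
def expQuot (p : E × E) : E := coord E (oneParam H p.1 1 * (oneParam H p.2 1)⁻¹)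

variable (H) in
theorem isLittleO_expQuot (X₀ : E) :
    (fun p : E × E => expQuot H p - dexp H X₀ (p.1 - p.2))
      =o[𝓝 (X₀, X₀)] fun p => p.1 - p.2 := by
  rw [Asymptotics.isLittleO_iff]
  intro η hη
  have h1 : ∀ᶠ p : E × E in 𝓝 (X₀, X₀), ‖dexp H p.2 - dexp H X₀‖ < η / 2 := by
    have : Continuous fun p : E × E => ‖dexp H p.2 - dexp H X₀‖ := by
      have := continuous_dexp (E := E) (H := H)
      fun_prop
    exact this.continuousAt.eventually_lt continuousAt_const (by simpa using hη)
  filter_upwards [h1, exists_norm_coord_oneParam_sub_le H X₀ (half_pos hη)] with p hp hp'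
  rw [expQuot]
  have h2 := ((dexp H p.2 - dexp H X₀).le_opNorm (p.1 - p.2)).trans
    (mul_le_mul_of_nonneg_right hp.le (norm_nonneg _))
  have h3 := norm_add_le (coord E (oneParam H p.1 1 * (oneParam H p.2 1)⁻¹) -
    dexp H p.2 (p.1 - p.2)) ((dexp H p.2 - dexp H X₀) (p.1 - p.2))
  have h4 : coord E (oneParam H p.1 1 * (oneParam H p.2 1)⁻¹) - dexp H p.2 (p.1 - p.2) +
      (dexp H p.2 - dexp H X₀) (p.1 - p.2) =
      coord E (oneParam H p.1 1 * (oneParam H p.2 1)⁻¹) - dexp H X₀ (p.1 - p.2) := by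
    simp
  rw [h4] at h3
  linarith [hp'.2]

/-- The exponential map is strictly differentiable, with derivative given by `dexp`. -/
theorem hasStrictFDerivAt_expQuot (X₀ : E) :
    HasStrictFDerivAt (fun X : E => expQuot H (X, X₀)) (dexp H X₀) X₀ := by
  set κ : E × E → E := expQuot H
  set a : E → E := fun X : E => κ (X, X₀)
  have hκ : (fun p => κ p - dexp H X₀ (p.1 - p.2)) =o[𝓝 (X₀, X₀)] fun p => p.1 - p.2 :=
    isLittleO_expQuot H X₀
  have hκO : κ =O[𝓝 (X₀, X₀)] fun p => p.1 - p.2 := by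
    have := hκ.isBigO.add ((dexp H X₀).isBigO_comp (fun p : E × E => p.1 - p.2) (𝓝 (X₀, X₀)))
    simpa using this
  have hsub : Filter.Tendsto (fun p : E × E => p.1 - p.2) (𝓝 (X₀, X₀)) (𝓝 0) := by
    have : Continuous fun p : E × E => p.1 - p.2 := by fun_prop
    simpa using this.tendsto (X₀, X₀)
  have hκ0 : Filter.Tendsto κ (𝓝 (X₀, X₀)) (𝓝 0) := hκO.trans_tendsto hsub
  have hpair : Filter.Tendsto (fun X : E => (X, X₀)) (𝓝 X₀) (𝓝 (X₀, X₀)) :=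
    (by fun_prop : Continuous fun X : E => (X, X₀)).tendsto X₀
  have ha0 : Filter.Tendsto a (𝓝 X₀) (𝓝 0) := hκ0.comp hpair
  have hmem := (exists_norm_coord_oneParam_sub_le H X₀ one_pos).mono fun p hp => hp.1
  have hmem' : ∀ᶠ X in 𝓝 X₀, oneParam H X 1 * (oneParam H X₀ 1)⁻¹ ∈ coordSource E H :=
    hpair.eventually hmem
  have hsnd : Filter.Tendsto (fun p : E × E => p.2) (𝓝 (X₀, X₀)) (𝓝 X₀) := continuousAt_snd
  have hstrict := hasStrictFDerivAt_iff_isLittleO.1 (hasStrictFDerivAt_mulCoord E H)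
  have htend : Filter.Tendsto (fun p : E × E => ((κ p, a p.2), ((0 : E), a p.2)))
      (𝓝 (X₀, X₀)) (𝓝 ((0 : E × E), (0 : E × E))) := by
    rw [← Prod.mk_zero_zero]
    have hp := ha0.comp hsnd
    exact (hκ0.prodMk_nhds hp).prodMk_nhds ((tendsto_const_nhds (x := (0 : E))).prodMk_nhds hp)
  have h1 := hstrict.comp_tendsto htend
  -- In the group, `a p.1` is the product of `κ p` and `a p.2`. Strict differentiability of
  -- multiplication at the origin, applied to the pairs `(κ p, a p.2)` and `(0, a p.2)`, gives an
  -- error `o(κ p)`.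
  have h2 : (fun p : E × E => a p.1 - a p.2 - κ p) =o[𝓝 (X₀, X₀)] fun p => p.1 - p.2 := by
    have h3 : ((fun p : (E × E) × E × E => p.1 - p.2) ∘
        fun p : E × E => ((κ p, a p.2), ((0 : E), a p.2))) =O[𝓝 (X₀, X₀)] fun p => p.1 - p.2 := by
      refine Asymptotics.IsBigO.trans (g := κ) (Asymptotics.IsBigO.of_bound 1 ?_) hκO
      filter_upwards with p
      simp [Prod.norm_def]
    refine Asymptotics.IsLittleO.congr' (h1.trans_isBigO h3) ?_ Filter.EventuallyEq.rfl
    filter_upwards [hmem, hsnd.eventually hmem'] with p hp hp'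
    have e1 : mulCoord H (κ p, a p.2) = a p.1 := by
      simp only [mulCoord, κ, a, expQuot, coordInv_coord hp, coordInv_coord hp']
      congr 1
      group
    have e2 : mulCoord H (0, a p.2) = a p.2 := by
      simp only [mulCoord, κ, a, expQuot, coordInv_coord hp', coordInv_zero, one_mul]
    simp [e1, e2]
  have h4 : (fun p : E × E => a p.1 - a p.2 - dexp H X₀ (p.1 - p.2)) =o[𝓝 (X₀, X₀)]
      fun p => p.1 - p.2 := by
    have h5 := h2.add hκ
    simpa only [sub_add_sub_cancel] using h5
  exact hasStrictFDerivAt_iff_isLittleO.2 h4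

theorem continuous_oneParam_one : Continuous fun X : E => oneParam H X 1 := by
  have : IsTopologicalGroup H := topologicalGroup_of_lieGroup 𝓘(ℂ, E) ∞
  refine continuous_iff_continuousAt.2 fun X₀ => ?_
  have h1 := (hasStrictFDerivAt_expQuot (H := H) X₀).hasFDerivAt.continuousAt
  have h2 : ContinuousAt (fun X : E => coordInv (expQuot H (X, X₀)) *
      oneParam H X₀ 1) X₀ := by
    refine ContinuousAt.mul (ContinuousAt.comp (g := coordInv) ?_ h1) continuousAt_const
    rw [expQuot, mul_inv_cancel, coord_one]
    exact continuousAt_coordInv (zero_mem_coordTarget E H)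
  refine h2.congr ?_
  have hpair : Filter.Tendsto (fun X : E => (X, X₀)) (𝓝 X₀) (𝓝 (X₀, X₀)) :=
    (by fun_prop : Continuous fun X : E => (X, X₀)).tendsto X₀
  filter_upwards [hpair.eventually (exists_norm_coord_oneParam_sub_le H X₀ one_pos)] with X hX
  rw [expQuot, coordInv_coord hX.1]
  group

end Exponential

end CplxLie

end

noncomputable section

namespace CplxLie

/-! ### Exponentials of operators and real forms -/

section RealForm

variable {E : Type*} [NormedAddCommGroup E] [NormedSpace ℂ E]

/-- `E = W ⊕ iW`. -/
structure IsRealForm (W : Submodule ℝ E) : Prop where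
  exists_add : ∀ v : E, ∃ a ∈ W, ∃ b ∈ W, v = a + Complex.I • b
  eq_zero : ∀ a ∈ W, ∀ b ∈ W, a + Complex.I • b = 0 → a = 0 ∧ b = 0

theorem IsRealForm.eq_and_eq {W : Submodule ℝ E} (hW : IsRealForm W) {a b a' b' : E} (ha : a ∈ W)
    (hb : b ∈ W) (ha' : a' ∈ W) (hb' : b' ∈ W) (h : a + Complex.I • b = a' + Complex.I • b') :
    a = a' ∧ b = b' := by
  have := hW.eq_zero (a - a') (W.sub_mem ha ha') (b - b') (W.sub_mem hb hb') (by
    rw [smul_sub, sub_add_sub_comm, h, sub_self])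
  exact ⟨sub_eq_zero.1 this.1, sub_eq_zero.1 this.2⟩

/-- A linear projection with kernel `W` commutes with the integral. -/
theorem intervalIntegral_mem_submodule [FiniteDimensional ℂ E] {W : Submodule ℝ E} {g : ℝ → E}
    (hg : Continuous g) (h : ∀ s, g s ∈ W) (a b : ℝ) : ∫ s in a..b, g s ∈ W := by
  have : FiniteDimensional ℝ E := FiniteDimensional.complexToReal E
  obtain ⟨q, hq⟩ := W.exists_isCompl
  let L : E →L[ℝ] E := LinearMap.toContinuousLinearMap (q.projection W hq.symm)
  have hL : ∀ v, L v = 0 ↔ v ∈ W := fun v => by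
    conv_rhs => rw [← Submodule.ker_projection hq.symm]
    exact Iff.rfl
  rw [← hL, ← ContinuousLinearMap.intervalIntegral_comp_comm L (hg.intervalIntegrable a b)]
  simp [(hL _).2 (h _)]

variable [CompleteSpace E]

theorem hasSum_exp_apply (B : E →L[ℂ] E) (v : E) :
    HasSum (fun n : ℕ => (n.factorial : ℂ)⁻¹ • (B ^ n) v) (NormedSpace.exp B v) :=
  (NormedSpace.exp_series_hasSum_exp' (𝕂 := ℂ) B).mapL (ContinuousLinearMap.apply ℂ E v)

theorem pow_apply_eigenvector {B : E →L[ℂ] E} {v : E} {μ : ℂ} (h : B v = μ • v) (n : ℕ) :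
    (B ^ n) v = μ ^ n • v := by
  induction n with
  | zero => simp
  | succ n ih => rw [pow_succ', mul_apply_eq_comp, ih, map_smul, h, smul_smul, pow_succ]

theorem exp_apply_eigenvector {B : E →L[ℂ] E} {v : E} {μ : ℂ} (h : B v = μ • v) :
    NormedSpace.exp B v = Complex.exp μ • v := by
  refine (hasSum_exp_apply B v).unique ?_
  have h1 := (NormedSpace.exp_series_hasSum_exp' (𝕂 := ℂ) μ).smul_const v
  rw [← Complex.exp_eq_exp_ℂ] at h1
  refine h1.congr_fun fun n => ?_
  rw [pow_apply_eigenvector h, smul_smul, smul_eq_mul]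

theorem pow_I_smul_apply (A : E →L[ℂ] E) (s : ℝ) (n : ℕ) (v : E) :
    ((s • Complex.I • A) ^ n) v = (s * Complex.I) ^ n • (A ^ n) v := by
  have : s • Complex.I • A = (s * Complex.I) • A := by
    rw [mul_smul, Complex.coe_smul]
  rw [this, smul_pow]
  rfl

theorem pow_apply_mem {W : Submodule ℝ E} {A : E →L[ℂ] E} (hA : ∀ Y ∈ W, A Y ∈ W) {Y : E}
    (hY : Y ∈ W) (n : ℕ) : (A ^ n) Y ∈ W := by
  induction n with
  | zero => simpa using hY
  | succ n ih => rw [pow_succ', mul_apply_eq_comp]; exact hA _ ih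

/-- The sum is `2 cos(sA) Y`: adding conjugate coefficients leaves real multiples of `Aⁿ Y ∈ W` in
every term of the series. -/
theorem exp_add_exp_mem {W : Submodule ℝ E} (hWc : IsClosed (W : Set E)) {A : E →L[ℂ] E}
    (hA : ∀ Y ∈ W, A Y ∈ W) {Y : E} (hY : Y ∈ W) (s : ℝ) :
    NormedSpace.exp (s • Complex.I • A) Y + NormedSpace.exp ((-s) • Complex.I • A) Y ∈ W := by
  refine hWc.mem_of_tendsto ((hasSum_exp_apply (s • Complex.I • A) Y).add
    (hasSum_exp_apply ((-s) • Complex.I • A) Y)) (Filter.Eventually.of_forall fun t => ?_)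
  refine W.sum_mem fun n _ => ?_
  have h1 : (n.factorial : ℂ)⁻¹ • ((s • Complex.I • A) ^ n) Y +
      (n.factorial : ℂ)⁻¹ • (((-s) • Complex.I • A) ^ n) Y =
      ((n.factorial : ℝ)⁻¹ * (2 * ((s * Complex.I) ^ n).re)) • (A ^ n) Y := by
    have h2 : ((-s : ℝ) * Complex.I) = (starRingEnd ℂ) (s * Complex.I) := by simp
    rw [pow_I_smul_apply, pow_I_smul_apply, h2, ← map_pow, ← smul_add, ← add_smul,
      Complex.add_conj, smul_smul, ← Complex.coe_smul]
    push_cast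
    rfl
  rw [h1]
  exact W.smul_mem _ (pow_apply_mem hA hY n)

/-- The vector is `-2 sin(sA) Y`, again a series with real coefficients. -/
theorem I_smul_exp_sub_exp_mem {W : Submodule ℝ E} (hWc : IsClosed (W : Set E)) {A : E →L[ℂ] E}
    (hA : ∀ Y ∈ W, A Y ∈ W) {Y : E} (hY : Y ∈ W) (s : ℝ) :
    Complex.I • (NormedSpace.exp (s • Complex.I • A) Y -
      NormedSpace.exp ((-s) • Complex.I • A) Y) ∈ W := by
  refine hWc.mem_of_tendsto (((hasSum_exp_apply (s • Complex.I • A) Y).sub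
    (hasSum_exp_apply ((-s) • Complex.I • A) Y)).const_smul Complex.I)
    (Filter.Eventually.of_forall fun t => ?_)
  refine W.sum_mem fun n _ => ?_
  have h1 : Complex.I • ((n.factorial : ℂ)⁻¹ • ((s • Complex.I • A) ^ n) Y -
      (n.factorial : ℂ)⁻¹ • (((-s) • Complex.I • A) ^ n) Y) =
      (-((n.factorial : ℝ)⁻¹ * (2 * ((s * Complex.I) ^ n).im))) • (A ^ n) Y := by
    have h2 : ((-s : ℝ) * Complex.I) = (starRingEnd ℂ) (s * Complex.I) := by simp
    rw [pow_I_smul_apply, pow_I_smul_apply, h2, ← map_pow, ← smul_sub, ← sub_smul,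
      Complex.sub_conj, smul_smul, smul_smul, ← Complex.coe_smul]
    congr 1
    push_cast
    linear_combination (n.factorial : ℂ)⁻¹ * (2 * ((s * Complex.I) ^ n).im) * Complex.I_mul_I
  rw [h1]
  exact W.smul_mem _ (pow_apply_mem hA hY n)

end RealForm

end CplxLie

end

/-! ### The transversality `E = W + (∫ exp(isA))(iW)` -/

noncomputable section

namespace CplxLie

section RealForm

variable {E : Type*} [NormedAddCommGroup E] [NormedSpace ℂ E] [FiniteDimensional ℂ E]

theorem continuous_exp_smul_const (r : ℝ) (B : E →L[ℂ] E) :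
    Continuous fun s : ℝ => NormedSpace.exp ((r * s) • B) := by
  let _ : NormedAlgebra ℚ (E →L[ℂ] E) := NormedAlgebra.restrictScalars ℚ ℂ _
  exact NormedSpace.exp_continuous.comp (by fun_prop)

/-- If `cos`-type averages of `exp(isA)` kill a vector, then `A` has a nonzero real eigenvalue. -/
theorem integral_exp_eq_zero {lam : ℂ}
    (h : ∫ s in (0 : ℝ)..1, (Complex.exp (s * (Complex.I * lam)) +
      Complex.exp (-s * (Complex.I * lam))) = 0) : ∃ r : ℝ, r ≠ 0 ∧ lam = r := by
  rcases eq_or_ne lam 0 with rfl | hl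
  · norm_num at h
  have hc : Complex.I * lam ≠ 0 := mul_ne_zero Complex.I_ne_zero hl
  have hint : ∀ c : ℂ, IntervalIntegrable (fun s : ℝ => Complex.exp (c * s))
      MeasureTheory.volume 0 1 := fun c => (by fun_prop : Continuous _).intervalIntegrable _ _
  have h1 : ∫ s in (0 : ℝ)..1, (Complex.exp (s * (Complex.I * lam)) +
      Complex.exp (-s * (Complex.I * lam))) =
      (Complex.exp (Complex.I * lam) - 1) / (Complex.I * lam) +
      (Complex.exp (-(Complex.I * lam)) - 1) / (-(Complex.I * lam)) := by
    have e1 := integral_exp_mul_complex (a := 0) (b := 1) hc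
    have e2 := integral_exp_mul_complex (a := 0) (b := 1) (neg_ne_zero.2 hc)
    simp only [Complex.ofReal_one, mul_one, Complex.ofReal_zero, mul_zero, Complex.exp_zero]
      at e1 e2
    rw [← e1, ← e2, ← intervalIntegral.integral_add (hint _) (hint _)]
    congr 1
    ext s
    ring_nf
  rw [h1] at h
  -- The two quotients add up to `2 sin(lam) / lam`, so `lam` is a nonzero multiple of `π`.
  have h2 : Complex.exp (Complex.I * lam) = Complex.exp (-(Complex.I * lam)) := by
    field_simp at h
    linear_combination h
  have h3 : Complex.exp (2 * (Complex.I * lam)) = 1 := by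
    rw [two_mul, Complex.exp_add]
    nth_rewrite 1 [h2]
    rw [← Complex.exp_add, neg_add_cancel, Complex.exp_zero]
  obtain ⟨n, hn⟩ := Complex.exp_eq_one_iff.1 h3
  have h4 : lam = ((n * Real.pi : ℝ) : ℂ) := by
    have : Complex.I * lam = Complex.I * (n * Real.pi) := by linear_combination hn / 2
    push_cast
    exact mul_left_cancel₀ Complex.I_ne_zero this
  refine ⟨n * Real.pi, fun h0 => hl ?_, h4⟩
  rw [h4, h0, Complex.ofReal_zero]

/-- With `T` the integral of `exp(isA)` and `T'` that of `exp(-isA)`, the `iW`-component of `T(iY)`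
is `i` times `(T + T')Y / 2`, where `(T + T') / 2` is `sin(A)/A`. This operator is injective when
`A` has no nonzero real eigenvalue on `W`, and a dimension count then gives surjectivity of `(Z, Y)
↦ Z + T(iY)`. -/
theorem IsRealForm.exists_add_integral {W : Submodule ℝ E} (hW : IsRealForm W) {A : E →L[ℂ] E}
    (hA : ∀ Y ∈ W, A Y ∈ W) (hno : ∀ r : ℝ, r ≠ 0 → ∀ Y ∈ W, A Y = r • Y → Y = 0) (v : E) :
    ∃ Z ∈ W, ∃ Y ∈ W,
      v = Z + (∫ s in (0 : ℝ)..1, NormedSpace.exp (s • Complex.I • A)) (Complex.I • Y) := by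
  have : FiniteDimensional ℝ E := FiniteDimensional.complexToReal E
  have hWc : IsClosed (W : Set E) := W.closed_of_finiteDimensional
  have hc1 : Continuous fun s : ℝ => NormedSpace.exp (s • Complex.I • A) := by
    simpa using continuous_exp_smul_const 1 (Complex.I • A)
  have hc2 : Continuous fun s : ℝ => NormedSpace.exp ((-s) • Complex.I • A) := by
    simpa using continuous_exp_smul_const (-1) (Complex.I • A)
  set T : E →L[ℂ] E := ∫ s in (0 : ℝ)..1, NormedSpace.exp (s • Complex.I • A)
  set T' : E →L[ℂ] E := ∫ s in (0 : ℝ)..1, NormedSpace.exp ((-s) • Complex.I • A)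
  have hc1v : ∀ w, Continuous fun s : ℝ => NormedSpace.exp (s • Complex.I • A) w := fun w => by
    fun_prop
  have hc2v : ∀ w, Continuous fun s : ℝ => NormedSpace.exp ((-s) • Complex.I • A) w := fun w => by
    fun_prop
  have hT : ∀ w, T w = ∫ s in (0 : ℝ)..1, NormedSpace.exp (s • Complex.I • A) w := fun w =>
    ContinuousLinearMap.intervalIntegral_apply (hc1.intervalIntegrable _ _) w
  have hT' : ∀ w, T' w = ∫ s in (0 : ℝ)..1, NormedSpace.exp ((-s) • Complex.I • A) w := fun w =>
    ContinuousLinearMap.intervalIntegral_apply (hc2.intervalIntegrable _ _) w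
  have hadd : ∀ w, (T + T') w = ∫ s in (0 : ℝ)..1,
      (NormedSpace.exp (s • Complex.I • A) w + NormedSpace.exp ((-s) • Complex.I • A) w) :=
    fun w => by
      rw [intervalIntegral.integral_add ((hc1v w).intervalIntegrable _ _)
        ((hc2v w).intervalIntegrable _ _), ← hT, ← hT']
      rfl
  have hre : ∀ Y ∈ W, (T + T') Y ∈ W := fun Y hY => by
    rw [hadd]
    exact intervalIntegral_mem_submodule ((hc1v Y).add (hc2v Y))
      (fun s => exp_add_exp_mem hWc hA hY s) 0 1
  have him : ∀ Y ∈ W, Complex.I • (T Y - T' Y) ∈ W := fun Y hY => by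
    rw [hT, hT', ← intervalIntegral.integral_sub ((hc1v Y).intervalIntegrable _ _)
        ((hc2v Y).intervalIntegrable _ _), ← intervalIntegral.integral_smul]
    exact intervalIntegral_mem_submodule (((hc1v Y).sub (hc2v Y)).const_smul Complex.I)
      (fun s => I_smul_exp_sub_exp_mem hWc hA hY s) 0 1
  -- the kernel of `T + T'` has no eigenvector of `A`, hence is trivial
  have hker : ∀ Y, (T + T') Y = 0 → Y = 0 := by
    by_contra! hne
    obtain ⟨Y₀, hY₀, hY₀'⟩ := hne
    have hcomm : ∀ w, (T + T') (A w) = A ((T + T') w) := fun w => by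
      rw [hadd, hadd]
      refine Eq.trans ?_ (ContinuousLinearMap.intervalIntegral_comp_comm A
        (((hc1v w).add (hc2v w)).intervalIntegrable _ _))
      congr 1
      ext s
      have e : ∀ r : ℝ, NormedSpace.exp (r • Complex.I • A) (A w) =
          A (NormedSpace.exp (r • Complex.I • A) w) := fun r => by
        have : Commute A (r • Complex.I • A) := ((Commute.refl A).smul_right _).smul_right _
        exact (DFunLike.congr_fun this.exp_right.eq w).symm
      rw [e, e, map_add]
    let N : Submodule ℂ E := LinearMap.ker (T + T' : E →L[ℂ] E).toLinearMap
    have hAN : ∀ w ∈ N, A.toLinearMap w ∈ N := fun w hw => by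
      have hw' : (T + T') w = 0 := hw
      change (T + T') (A w) = 0
      rw [hcomm, hw', map_zero]
    have : Nontrivial N := ⟨⟨⟨Y₀, hY₀⟩, 0, fun h => hY₀' (congrArg Subtype.val h)⟩⟩
    obtain ⟨lam, hlam⟩ := Module.End.exists_eigenvalue (A.toLinearMap.restrict hAN)
    obtain ⟨⟨w, hwN⟩, hw, hw0⟩ := hlam.exists_hasEigenvector
    have hAw : A w = lam • w := congrArg Subtype.val (Module.End.mem_eigenspace_iff.1 hw)
    have hw0' : w ≠ 0 := fun h => hw0 (Subtype.ext h)
    have hI : ∀ r : ℝ, (r • Complex.I • A) w = (r * (Complex.I * lam)) • w := fun r => by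
      simp only [smul_apply, hAw, mul_smul, Complex.coe_smul]
    have hzero : (T + T') w = 0 := hwN
    rw [hadd] at hzero
    have hsmul : ∀ s : ℝ, NormedSpace.exp (s • Complex.I • A) w +
        NormedSpace.exp ((-s) • Complex.I • A) w =
        (Complex.exp (s * (Complex.I * lam)) + Complex.exp (-s * (Complex.I * lam))) • w :=
      fun s => by
        rw [exp_apply_eigenvector (hI s), exp_apply_eigenvector (hI (-s)), ← add_smul]
        push_cast
        rfl
    simp only [hsmul] at hzero
    rw [intervalIntegral.integral_smul_const] at hzero
    obtain ⟨r, hr, rfl⟩ := integral_exp_eq_zero ((smul_eq_zero.1 hzero).resolve_right hw0')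
    -- As the eigenvalue is real, both components of `w` satisfy the eigenvalue equation inside `W`,
    -- so `hno` kills them.
    obtain ⟨a, ha, b, hb, rfl⟩ := hW.exists_add w
    rw [map_add, map_smul, Complex.coe_smul, smul_add, smul_comm r] at hAw
    obtain ⟨h1, h2⟩ := hW.eq_and_eq (hA a ha) (hA b hb) (W.smul_mem r ha) (W.smul_mem r hb) hAw
    exact hw0' (by rw [hno r hr a ha h1, hno r hr b hb h2]; simp)
  -- `Ψ` serves only to show that `W × W` and `E` have the same real dimension, so that injectivity
  -- of `Φ` suffices.
  let Ψ : (W × W) →ₗ[ℝ] E := W.subtype.coprod ((mulI E).toLinearMap ∘ₗ W.subtype)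
  have hΨ : Function.Bijective Ψ := by
    refine ⟨LinearMap.ker_eq_bot.1 (LinearMap.ker_eq_bot'.2 fun p hp => ?_), fun v => ?_⟩
    · obtain ⟨h1, h2⟩ := hW.eq_zero p.1 p.1.2 p.2 p.2.2 hp
      exact Prod.ext (Subtype.ext h1) (Subtype.ext h2)
    · obtain ⟨a, ha, b, hb, rfl⟩ := hW.exists_add v
      exact ⟨(⟨a, ha⟩, ⟨b, hb⟩), rfl⟩
  let Φ : (W × W) →ₗ[ℝ] E :=
    W.subtype.coprod ((T.restrictScalars ℝ ∘L mulI E).toLinearMap ∘ₗ W.subtype)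
  have hΦ : Function.Injective Φ := by
    refine LinearMap.ker_eq_bot.1 (LinearMap.ker_eq_bot'.2 fun p hp => ?_)
    have hp' : (p.1 : E) + T (Complex.I • (p.2 : E)) = 0 := hp
    -- Splitting `T` into its halves `(T - T') / 2` and `(T + T') / 2` separates the `W`- and
    -- `iW`-components.
    have h1 : ((p.1 : E) + (1 / 2 : ℝ) • Complex.I • (T p.2 - T' p.2)) +
        Complex.I • ((1 / 2 : ℝ) • (T + T') p.2) = 0 := by
      rw [← hp', map_smul, smul_comm Complex.I, add_assoc, ← smul_add, ← smul_add,
        add_apply, sub_add_add_cancel, ← two_smul ℝ, smul_comm Complex.I,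
        smul_smul]
      norm_num
    obtain ⟨h2, h3⟩ := hW.eq_zero _ (W.add_mem p.1.2 (W.smul_mem _ (him _ p.2.2))) _
      (W.smul_mem _ (hre _ p.2.2)) h1
    have h4 : (p.2 : E) = 0 := hker _ ((smul_eq_zero.1 h3).resolve_left (by norm_num))
    have h5 : (p.1 : E) = 0 := by simpa [h4] using hp'
    exact Prod.ext (Subtype.ext h5) (Subtype.ext h4)
  obtain ⟨p, hp⟩ := (LinearMap.injective_iff_surjective_of_finrank_eq_finrank
    (LinearEquiv.ofBijective Ψ hΨ).finrank_eq).1 hΦ v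
  exact ⟨p.1, p.1.2, p.2, p.2.2, hp.symm⟩

end RealForm

end CplxLie

end

noncomputable section

namespace CplxLie

/-! ### Strictly convex functions exclude real eigenvalues of `ad X` -/

/-- If `f e > f 0`, convexity forces linear growth along the multiples `N e`, against the bound. So
`0` is a global maximum, contradicting strictness at the midpoint of `-1` and `1`. -/
theorem StrictConvexOn.not_bddAbove {f : ℝ → ℝ} (hf : StrictConvexOn ℝ Set.univ f) (M : ℝ)
    (hM : ∀ x, f x ≤ M) : False := by
  have key : ∀ e : ℝ, f e ≤ f 0 := fun e => by
    by_contra! h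
    obtain ⟨N, hN⟩ := exists_nat_gt ((M - f 0) / (f e - f 0))
    have hM0 : 0 ≤ (M - f 0) / (f e - f 0) := div_nonneg (by linarith [hM 0]) (by linarith)
    have hN0 : (0 : ℝ) < N := hM0.trans_lt hN
    have hN1 : (1 : ℝ) ≤ N := by exact_mod_cast Nat.cast_pos.1 hN0
    have hb : (0 : ℝ) ≤ 1 - 1 / N := by rw [sub_nonneg, div_le_one hN0]; exact hN1
    have ha : (0 : ℝ) ≤ 1 / N := by positivity
    have h0 := hf.convexOn.2
    have h1 := h0 (Set.mem_univ (N * e)) (Set.mem_univ 0) ha hb (by ring)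
    have h2 : (1 / (N : ℝ)) • (N * e) + (1 - 1 / (N : ℝ)) • (0 : ℝ) = e := by
      simp only [smul_eq_mul, mul_zero, add_zero]; field_simp
    rw [h2, smul_eq_mul, smul_eq_mul] at h1
    rw [div_lt_iff₀ (by linarith)] at hN
    have h3 : N * f e ≤ f (N * e) + (N - 1) * f 0 := by
      have := mul_le_mul_of_nonneg_left h1 hN0.le
      have e : (N : ℝ) * (1 / N * f (N * e) + (1 - 1 / N) * f 0) = f (N * e) + (N - 1) * f 0 := by
        field_simp
      linarith
    linarith [hM (N * e)]
  have h0 := hf.2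
  have ha : (0 : ℝ) < 1 / 2 := by norm_num
  have h1 := h0 (Set.mem_univ (-1)) (Set.mem_univ 1) (by norm_num) ha ha (by norm_num)
  norm_num at h1
  linarith [key 1, key (-1)]

section NoEigenvalue

variable {E : Type*} [NormedAddCommGroup E] [NormedSpace ℂ E] [FiniteDimensional ℂ E]
  {H : Type*} [TopologicalSpace H] [ChartedSpace E H] [Group H] [LieGroup 𝓘(ℂ, E) ∞ H]

theorem oneParam_add (X : E) (s t : ℝ) :
    oneParam H X (s + t) = oneParam H X s * oneParam H X t := by
  refine HasLogDerivAt.eq_of_eq (X := fun _ => X) (c := fun t => oneParam H X (s + t))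
    (d := fun t => oneParam H X s * oneParam H X t) (fun r => ?_)
    (fun r => (hasLogDerivAt_oneParam X r).const_mul _) (t := 0) (by simp) t
  have h := HasLogDerivAt.comp (τ := fun t => s + t) (hasLogDerivAt_oneParam (H := H) X (s + r))
    ((hasDerivAt_id r).const_add s)
  rwa [one_smul] at h

/-- A one-parameter subgroup is commutative, so conjugating it by one of its elements changes
nothing. -/
theorem Ad_oneParam_self (X : E) (t : ℝ) : Ad (oneParam H X t) X = X := by
  have h1 := (hasLogDerivAt_oneParam (H := H) X 0).mul_const (oneParam H X t)⁻¹
  have h2 := (hasLogDerivAt_oneParam (H := H) X 0).const_mul (oneParam H X t)⁻¹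
  rw [inv_inv] at h1
  refine h1.unique ?_
  have h3 : ∀ s, oneParam H X s * (oneParam H X t)⁻¹ = (oneParam H X t)⁻¹ * oneParam H X s :=
    fun s => by
      have : Commute (oneParam H X s) (oneParam H X t) := by
        rw [Commute, SemiconjBy, ← oneParam_add, ← oneParam_add, add_comm]
      exact this.inv_right.eq
  simpa only [h3] using h2

variable (H) in
theorem ad_self (X : E) : ad E H X X = 0 := by
  have h1 := (hasLogDerivAt_oneParam (H := H) X 0).hasDerivAt_Ad_apply X
  simp only [Ad_oneParam_self, oneParam_zero, Ad_one] at h1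
  exact h1.unique (hasDerivAt_const 0 X)

theorem Ad_oneParam_eigenvector {X Y : E} {z μ : ℂ} (h : ad E H X Y = μ • Y) (t : ℝ) :
    Ad (oneParam H (z • X) t) Y = Complex.exp (t * (z * μ)) • Y := by
  rw [Ad_oneParam]
  refine exp_apply_eigenvector ?_
  rw [smul_apply, map_smul, smul_apply, h, mul_smul, mul_smul, Complex.coe_smul]

theorem Ad_oneParam_smul_self (z : ℂ) (Y : E) (t : ℝ) : Ad (oneParam H (z • Y) t) Y = Y := by
  have := Ad_oneParam_eigenvector (H := H) (X := Y) (Y := Y) (z := z) (μ := 0)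
    (by rw [ad_self, zero_smul]) t
  simpa using this

/-- The derivative at `g` of a function, trivialised by left translations. -/
def dLeft (F : H → ℝ) (g : H) : E →L[ℝ] ℝ := fderiv ℝ (fun x : E => F (g * coordInv x)) 0

theorem HasLogDerivAt.hasDerivAt_comp {F : H → ℝ} (hF : ContMDiff 𝓘(ℝ, E) 𝓘(ℝ, ℝ) ∞ F)
    {c : ℝ → H} {X : E} {t : ℝ} (hc : HasLogDerivAt c X t) :
    HasDerivAt (fun s => F (c s)) (dLeft F (c t) X) t := by
  have h0 : ContMDiffAt 𝓘(ℝ, E) 𝓘(ℝ, E) ∞ (fun x : E => c t * coordInv x) 0 :=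
    contMDiffAt_real_of_complex
      (contMDiffAt_const.mul (contMDiffAt_coordInv (zero_mem_coordTarget E H)))
  have h1 : ContDiffAt ℝ ∞ (fun x : E => F (c t * coordInv x)) 0 :=
    (hF.contMDiffAt.comp (0 : E) h0).contDiffAt
  have h2 : HasFDerivAt (fun x : E => F (c t * coordInv x)) (dLeft F (c t)) 0 :=
    (h1.differentiableAt (by simp)).hasFDerivAt
  have h3 : coord E ((c t)⁻¹ * c t) = 0 := by rw [inv_mul_cancel, coord_one]
  rw [← h3] at h2
  refine (h2.comp_hasDerivAt t hc.tangent.hasDerivAt).congr_of_eventuallyEq ?_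
  filter_upwards [hc.tangent.eventually_coordInv] with s hs
  simp [hs]

/-- A smooth function on `H` that is invariant along `W` and strictly convex along the curves
`c' = (L_c)_* iX`, `0 ≠ X ∈ W`. -/
structure IsConvexPotential (W : Submodule ℝ E) (F : H → ℝ) : Prop where
  contMDiff : ContMDiff 𝓘(ℝ, E) 𝓘(ℝ, ℝ) ∞ F
  dLeft_eq_zero : ∀ g, ∀ X ∈ W, dLeft F g X = 0
  strictConvexOn : ∀ X ∈ W, X ≠ 0 → ∀ c : ℝ → H, (∀ t, HasLogDerivAt c (Complex.I • X) t) →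
    StrictConvexOn ℝ Set.univ fun t => F (c t)

theorem IsConvexPotential.eq_of_hasLogDerivAt {W : Submodule ℝ E} {F : H → ℝ}
    (hF : IsConvexPotential W F) {c : ℝ → H} {X : ℝ → E} (hX : ∀ t, X t ∈ W)
    (hc : ∀ t, HasLogDerivAt c (X t) t) (s t : ℝ) : F (c s) = F (c t) := by
  have h : ∀ t, HasDerivAt (fun s => F (c s)) 0 t := fun t => by
    simpa [hF.dLeft_eq_zero _ _ (hX t)] using (hc t).hasDerivAt_comp hF.contMDiff
  exact is_const_of_deriv_eq_zero (fun t => (h t).differentiableAt) (fun t => (h t).deriv) s t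

/-- The curve `exp(aY) exp(b iY) q` with variable `a`, `b`. -/
theorem hasLogDerivAt_oneParam_mul_oneParam {Y : E} {a b : ℝ → ℝ} {a' b' t : ℝ}
    (ha : HasDerivAt a a' t) (hb : HasDerivAt b b' t) :
    HasLogDerivAt (fun s => oneParam H Y (a s) * oneParam H (Complex.I • Y) (b s))
      ((a' + b' * Complex.I) • Y) t := by
  have h1 := ((hasLogDerivAt_oneParam (H := H) Y (a t)).comp ha).mul
    ((hasLogDerivAt_oneParam (H := H) (Complex.I • Y) (b t)).comp hb)
  have h2 : Ad (oneParam H (Complex.I • Y) (b t))⁻¹ (a' • Y) = a' • Y := by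
    have := Ad_oneParam_smul_self (H := H) Complex.I (a' • Y) (b t)
    rw [smul_comm Complex.I a' Y, oneParam_smul] at this
    have h3 := Ad_inv_Ad (oneParam H (Complex.I • Y) (b t)) Y
    rw [Ad_oneParam_smul_self] at h3
    rw [← Complex.coe_smul, map_smul, h3]
  rw [h2] at h1
  rwa [add_smul, mul_smul, Complex.coe_smul, Complex.coe_smul]

/-- A conjugate-point argument in the complexified affine group spanned by `X` and `Y`: the
geodesics `γ c` share their `F`-values at times `0` and `π`, while the point at time `π / 2` escapes
along a geodesic as `c` varies. Convexity along `γ c` bounds `F` there, and strict convexity in the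
variable `c` forbids such a bound. -/
theorem IsConvexPotential.eq_zero_of_ad_eq_self {W : Submodule ℝ E} {F : H → ℝ}
    (hF : IsConvexPotential W F) {X Y : E} (hX : X ∈ W) (hY : Y ∈ W) (h : ad E H X Y = Y) :
    Y = 0 := by
  by_contra hY0
  -- If `X` were a multiple of `Y`, then `ad X Y` would vanish instead of being `Y`.
  have hne : ∀ c : ℝ, X + c • Y ≠ 0 := fun c hc => hY0 (by
    have : X = (-c : ℂ) • Y := by
      rw [neg_smul, Complex.coe_smul]; exact eq_neg_of_add_eq_zero_left hc
    rw [← h, this, map_smul, smul_apply, ad_self, smul_zero])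
  let q : ℝ → H := oneParam H (Complex.I • X)
  have hq : ∀ t, HasLogDerivAt q (Complex.I • X) t := fun t => hasLogDerivAt_oneParam _ t
  have hAdq : ∀ (t : ℝ) (z : ℂ), Ad (q t)⁻¹ (z • Y) = (z * Complex.exp (-(t * Complex.I))) • Y :=
    fun t z => by
      have h1 : Ad (q t) Y = Complex.exp (t * Complex.I) • Y := by
        simpa using Ad_oneParam_eigenvector (H := H) (z := Complex.I) (μ := 1)
          (by rw [h, one_smul]) t
      have h2 := congrArg (Ad (q t)⁻¹) h1
      rw [Ad_inv_Ad, map_smul] at h2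
      rw [map_smul, mul_smul]
      congr 1
      nth_rewrite 2 [h2]
      rw [smul_smul, ← Complex.exp_add, neg_add_cancel, Complex.exp_zero, one_smul]
  let p : ℝ → ℝ → H := fun a b => oneParam H Y a * oneParam H (Complex.I • Y) b
  -- The complex parameter `c(e^{it} - 1)` has derivative `i c e^{it}`; conjugation past `q t`
  -- multiplies it by `e^{-it}`, leaving the constant direction `i(X + cY)`.
  let γ : ℝ → ℝ → H := fun c t => p (c * (Real.cos t - 1)) (c * Real.sin t) * q t
  have hγ : ∀ c t, HasLogDerivAt (γ c) (Complex.I • (X + c • Y)) t := fun c t => by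
    have h1 := (hasLogDerivAt_oneParam_mul_oneParam (H := H) (Y := Y)
      (((Real.hasDerivAt_cos t).sub_const 1).const_mul c)
      ((Real.hasDerivAt_sin t).const_mul c)).mul (hq t)
    rw [hAdq] at h1
    have h2 : ((c * -Real.sin t : ℝ) + (c * Real.cos t : ℝ) * Complex.I) *
        Complex.exp (-(t * Complex.I)) = Complex.I * c := by
      have h3 : ((c * -Real.sin t : ℝ) + (c * Real.cos t : ℝ) * Complex.I) =
          Complex.I * c * Complex.exp (t * Complex.I) := by
        rw [Complex.exp_mul_I]
        push_cast
        linear_combination -(c * Complex.sin t) * Complex.I_mul_I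
      rw [h3, mul_assoc, ← Complex.exp_add, add_neg_cancel, Complex.exp_zero, mul_one]
    rw [h2, add_comm, mul_smul, Complex.coe_smul, ← smul_add] at h1
    exact h1
  have hconv : ∀ c, StrictConvexOn ℝ Set.univ fun t => F (γ c t) := fun c =>
    hF.strictConvexOn _ (W.add_mem hX (W.smul_mem c hY)) (hne c) _ (hγ c)
  have hγ0 : ∀ c, γ c 0 = 1 := fun c => by simp [γ, p, q]
  -- At time `π` the parameter is `-2c`, and conjugation by `q π` turns the direction `-2Y` into
  -- `2Y`, which lies in `W`, so `F` does not vary with `c`.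
  have hγπ : ∀ c, F (γ c Real.pi) = F (γ 0 Real.pi) := fun c => by
    refine hF.eq_of_hasLogDerivAt (c := fun c => γ c Real.pi) (X := fun _ => (2 : ℝ) • Y)
      (fun _ => W.smul_mem _ hY) (fun c => ?_) c 0
    have h1 := (hasLogDerivAt_oneParam_mul_oneParam (H := H) (Y := Y)
      ((hasDerivAt_id c).mul_const (Real.cos Real.pi - 1))
      ((hasDerivAt_id c).mul_const (Real.sin Real.pi))).mul_const (q Real.pi)
    rw [hAdq] at h1
    have h2 : ((1 * (Real.cos Real.pi - 1) : ℝ) + (1 * Real.sin Real.pi : ℝ) * Complex.I) *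
        Complex.exp (-(Real.pi * Complex.I)) = (2 : ℝ) := by
      rw [Complex.exp_neg, Complex.exp_pi_mul_I]
      norm_num
    rw [h2, Complex.coe_smul] at h1
    exact h1
  let M := (F 1 + F (γ 0 Real.pi)) / 2
  let δ : ℝ → H := fun c => p (-c) c * q (Real.pi / 2)
  have hδ : ∀ c, δ c = γ c (Real.pi / 2) := fun c => by simp [δ, γ]
  have hδM : ∀ c, F (δ c) ≤ M := fun c => by
    have h0 := (hconv c).convexOn.2
    have ha : (0 : ℝ) ≤ 1 / 2 := by norm_num
    have h1 := h0 (Set.mem_univ 0) (Set.mem_univ Real.pi) ha ha (by norm_num)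
    have h2 : (1 / 2 : ℝ) • (0 : ℝ) + (1 / 2 : ℝ) • Real.pi = Real.pi / 2 := by
      simp only [smul_eq_mul]; ring
    rw [h2] at h1
    beta_reduce at h1
    rw [hγ0, hγπ, ← hδ, smul_eq_mul, smul_eq_mul] at h1
    simp only [M]
    linarith
  have hδ' : ∀ c, HasLogDerivAt δ ((Complex.I + 1) • Y) c := fun c => by
    have h1 := (hasLogDerivAt_oneParam_mul_oneParam (H := H) (Y := Y)
      (hasDerivAt_neg c) (hasDerivAt_id c)).mul_const (q (Real.pi / 2))
    rw [hAdq] at h1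
    have h2 : (((-1 : ℝ) : ℂ) + (1 : ℝ) * Complex.I) *
        Complex.exp (-((Real.pi / 2 : ℝ) * Complex.I)) = Complex.I + 1 := by
      rw [Complex.exp_neg]
      push_cast
      rw [Complex.exp_pi_div_two_mul_I, Complex.inv_I]
      linear_combination -Complex.I_mul_I
    rw [h2] at h1
    exact h1
  -- `δ` moves in the direction `(i + 1)Y`; right multiplication by `exp(-cY)` removes the `W`-part
  -- without changing `F`, leaving a genuine geodesic lift.
  let η : ℝ → H := fun c => δ c * (oneParam H Y c)⁻¹
  have hAdY : ∀ c z, Ad (oneParam H Y c) (z • Y) = z • Y := fun c z => by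
    rw [map_smul, Ad_oneParam_self]
  have hη : ∀ c, HasLogDerivAt η (Complex.I • Y) c := fun c => by
    have h1 := (hδ' c).mul (hasLogDerivAt_oneParam Y c).inv
    rw [inv_inv, hAdY, Ad_oneParam_self, add_smul, one_smul, add_neg_cancel_right] at h1
    exact h1
  have hηδ : ∀ c, F (η c) = F (δ c) := fun c => by
    have h1 := hF.eq_of_hasLogDerivAt (c := fun s => δ c * (oneParam H Y s)⁻¹) (X := fun _ => -Y)
      (fun _ => W.neg_mem hY) (fun s => by
        simpa [Ad_oneParam_self] using ((hasLogDerivAt_oneParam (H := H) Y s).inv).const_mul (δ c))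
      c 0
    simpa using h1
  exact StrictConvexOn.not_bddAbove (hF.strictConvexOn Y hY hY0 η hη) M
    fun c => (hηδ c).trans_le (hδM c)

theorem IsConvexPotential.eq_zero_of_ad_eq_smul {W : Submodule ℝ E} {F : H → ℝ}
    (hF : IsConvexPotential W F) {X Y : E} (hX : X ∈ W) (hY : Y ∈ W) {r : ℝ} (hr : r ≠ 0)
    (h : ad E H X Y = r • Y) : Y = 0 := by
  refine hF.eq_zero_of_ad_eq_self (W.smul_mem r⁻¹ hX) hY ?_
  rw [← Complex.coe_smul, map_smul, smul_apply, h, Complex.coe_smul, smul_smul, inv_mul_cancel₀ hr,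
    one_smul]

end NoEigenvalue

end CplxLie

end

noncomputable section

namespace CplxLie

/-! ### Uniqueness of critical points -/

theorem StrictConvexOn.lt_of_hasDerivAt_zero {g : ℝ → ℝ} (hg : StrictConvexOn ℝ Set.univ g)
    {x y : ℝ} (h : HasDerivAt g 0 x) (hxy : x ≠ y) : g x < g y := by
  rcases hxy.lt_or_gt with h1 | h1
  · have := hg.lt_slope_of_hasDerivAt (Set.mem_univ x) (Set.mem_univ y) h1 h
    rw [slope_def_field, lt_div_iff₀ (by linarith)] at this
    linarith
  · have := hg.slope_lt_of_hasDerivAt (Set.mem_univ y) (Set.mem_univ x) h1 h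
    rw [slope_def_field, div_lt_iff₀ (by linarith)] at this
    linarith

theorem ConvexOn.add_mul_le {g : ℝ → ℝ} (hg : ConvexOn ℝ Set.univ g) {t : ℝ} (ht : 1 ≤ t) :
    g 0 + t * (g 1 - g 0) ≤ g t := by
  have ht0 : 0 < t := one_pos.trans_le ht
  have ha : (0 : ℝ) ≤ 1 - 1 / t := by rw [sub_nonneg, div_le_one ht0]; exact ht
  have hb : (0 : ℝ) ≤ 1 / t := by positivity
  have h0 := hg.2
  have h1 := h0 (Set.mem_univ 0) (Set.mem_univ t) ha hb (by ring)
  have h2 : (1 - 1 / t) • (0 : ℝ) + (1 / t) • t = 1 := by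
    simp only [smul_eq_mul, mul_zero, zero_add]; field_simp
  rw [h2, smul_eq_mul, smul_eq_mul] at h1
  have h3 := mul_le_mul_of_nonneg_left h1 ht0.le
  have h4 : t * ((1 - 1 / t) * g 0 + 1 / t * g t) = (t - 1) * g 0 + g t := by field_simp
  linarith

section Critical

variable {E : Type*} [NormedAddCommGroup E] [NormedSpace ℂ E] [FiniteDimensional ℂ E]
  {H : Type*} [TopologicalSpace H] [ChartedSpace E H] [Group H] [LieGroup 𝓘(ℂ, E) ∞ H]

/-- The closed subgroup `K` is a real form of `H` with Lie algebra `W`, parametrised near `1` by a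
vector space `V`. -/
structure IsRealFormSubgroup (V : Type*) [NormedAddCommGroup V] [NormedSpace ℝ V]
    (W : Submodule ℝ E) (K : Subgroup H) : Prop where
  isRealForm : IsRealForm W
  ad_mem : ∀ X ∈ W, ∀ Y ∈ W, ad E H X Y ∈ W
  isClosed : IsClosed (K : Set H)
  exists_param : ∃ (a : V → H) (d : V →L[ℝ] E), a 0 = 1 ∧ (∀ x, a x ∈ K) ∧ ContinuousAt a 0 ∧
    HasStrictFDerivAt (fun x => coord E (a x)) d 0 ∧ ∀ Y ∈ W, ∃ x, d x = Y

variable {V : Type*} [NormedAddCommGroup V] [NormedSpace ℝ V] [FiniteDimensional ℝ V]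
  {W : Submodule ℝ E} {K : Subgroup H} {F : H → ℝ}

theorem oneParam_neg (X : E) (t : ℝ) : oneParam H (-X) t = (oneParam H X t)⁻¹ := by
  have h := oneParam_smul (H := H) (-1) X t
  rw [neg_one_smul] at h
  rw [h, eq_inv_iff_mul_eq_one, ← oneParam_add]
  simp

/-- After right translation by `q⁻¹`, the map `(x, X) ↦ a(x) exp(iX)` has derivative `d` plus `dexp`
on `iW`. This is onto by `exists_add_integral`, whose eigenvalue hypothesis is supplied by
convexity, so the map is open at this point. -/
theorem IsRealFormSubgroup.mul_oneParam_mem_nhds (hK : IsRealFormSubgroup V W K)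
    (hF : IsConvexPotential W F) {X₀ : E} (hX₀ : X₀ ∈ W) :
    {g : H | ∃ k ∈ K, ∃ X ∈ W, g = k * oneParam H (Complex.I • X) 1} ∈
      𝓝 (oneParam H (Complex.I • X₀) 1) := by
  have : IsTopologicalGroup H := topologicalGroup_of_lieGroup 𝓘(ℂ, E) ∞
  have : FiniteDimensional ℝ E := FiniteDimensional.complexToReal E
  have : CompleteSpace V := FiniteDimensional.complete ℝ V
  have : CompleteSpace W := FiniteDimensional.complete ℝ W
  obtain ⟨a, d, ha0, haK, hac, had, hd⟩ := hK.exists_param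
  set S := {g : H | ∃ k ∈ K, ∃ X ∈ W, g = k * oneParam H (Complex.I • X) 1}
  set q := oneParam H (Complex.I • X₀) 1 with hq
  let J : W →L[ℝ] E := (Complex.I • ContinuousLinearMap.id ℝ E : E →L[ℝ] E) ∘L W.subtypeL
  let e : W → E := fun X => expQuot H (J X, J ⟨X₀, hX₀⟩)
  have hJ : ∀ X : W, J X = Complex.I • (X : E) := fun X => rfl
  have he : HasStrictFDerivAt e ((dexp H (Complex.I • X₀)).restrictScalars ℝ ∘L J) ⟨X₀, hX₀⟩ := by
    have h1 : HasStrictFDerivAt (fun X : E => expQuot H (X, J ⟨X₀, hX₀⟩))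
        ((dexp H (Complex.I • X₀)).restrictScalars ℝ) (J ⟨X₀, hX₀⟩) :=
      (hasStrictFDerivAt_expQuot (H := H) (Complex.I • X₀)).restrictScalars ℝ
    exact h1.comp _ J.hasStrictFDerivAt
  have he0 : e ⟨X₀, hX₀⟩ = 0 := by simp [e, expQuot]
  let Φ : V × W → E := fun p => mulCoord H (coord E (a p.1), e p.2)
  have hΦ : HasStrictFDerivAt Φ (d ∘L ContinuousLinearMap.fst ℝ V W +
      ((dexp H (Complex.I • X₀)).restrictScalars ℝ ∘L J) ∘L ContinuousLinearMap.snd ℝ V W)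
      (0, ⟨X₀, hX₀⟩) := by
    have h1 : HasStrictFDerivAt (mulCoord H : E × E → E)
        ((ContinuousLinearMap.fst ℂ E E + ContinuousLinearMap.snd ℂ E E).restrictScalars ℝ)
        (coord E (a 0), e ⟨X₀, hX₀⟩) := by
      rw [ha0, coord_one, he0]
      exact (hasStrictFDerivAt_mulCoord E H).restrictScalars ℝ
    have h2 : HasStrictFDerivAt (fun p : V × W => coord E (a p.1))
        (d ∘L ContinuousLinearMap.fst ℝ V W) (0, ⟨X₀, hX₀⟩) :=
      HasStrictFDerivAt.comp (g := fun x => coord E (a x)) (f := Prod.fst) (0, (⟨X₀, hX₀⟩ : W)) had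
        hasStrictFDerivAt_fst
    have h3 : HasStrictFDerivAt (fun p : V × W => e p.2)
        (((dexp H (Complex.I • X₀)).restrictScalars ℝ ∘L J) ∘L ContinuousLinearMap.snd ℝ V W)
        (0, ⟨X₀, hX₀⟩) :=
      HasStrictFDerivAt.comp (g := e) (f := Prod.snd) ((0 : V), (⟨X₀, hX₀⟩ : W)) he
        hasStrictFDerivAt_snd
    exact HasStrictFDerivAt.comp (g := mulCoord H) ((0 : V), (⟨X₀, hX₀⟩ : W)) h1 (h2.prodMk h3)
  have hsurj : (d ∘L ContinuousLinearMap.fst ℝ V W +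
      ((dexp H (Complex.I • X₀)).restrictScalars ℝ ∘L J) ∘L
        ContinuousLinearMap.snd ℝ V W).range = ⊤ := by
    refine LinearMap.range_eq_top.2 fun v => ?_
    obtain ⟨Z, hZ, Y, hY, hv⟩ := hK.isRealForm.exists_add_integral (A := ad E H X₀)
      (hK.ad_mem X₀ hX₀) (fun r hr Y hY h => hF.eq_zero_of_ad_eq_smul hX₀ hY hr h) v
    obtain ⟨x, hx⟩ := hd Z hZ
    refine ⟨(x, ⟨Y, hY⟩), ?_⟩
    rw [hv, ← hx]
    simp [dexp, hJ]
  have hmap := hΦ.map_nhds_eq_of_surj hsurj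
  have hΦ0 : Φ (0, ⟨X₀, hX₀⟩) = 0 := by simp [Φ, ha0, he0, mulCoord]
  rw [hΦ0] at hmap
  have hac' : Filter.Tendsto a (𝓝 0) (𝓝 1) := by simpa [ContinuousAt, ha0] using hac
  have hexp : Filter.Tendsto (fun X : W => oneParam H (J X) 1 * q⁻¹) (𝓝 ⟨X₀, hX₀⟩) (𝓝 1) := by
    have h1 : Continuous fun X : W => oneParam H (J X) 1 * q⁻¹ :=
      (continuous_oneParam_one.comp J.continuous).mul continuous_const
    have h2 := h1.tendsto ⟨X₀, hX₀⟩
    have h3 : oneParam H (J ⟨X₀, hX₀⟩) 1 * q⁻¹ = 1 := by rw [hJ, hq, mul_inv_cancel]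
    rwa [h3] at h2
  have hprod : Filter.Tendsto (fun p : V × W => a p.1 * (oneParam H (J p.2) 1 * q⁻¹))
      (𝓝 (0, ⟨X₀, hX₀⟩)) (𝓝 1) := by
    have h1 := (hac'.comp (Filter.tendsto_fst (f := 𝓝 (0 : V)) (g := 𝓝 (⟨X₀, hX₀⟩ : W)))).mul
      (hexp.comp (Filter.tendsto_snd (f := 𝓝 (0 : V)) (g := 𝓝 (⟨X₀, hX₀⟩ : W))))
    rw [← nhds_prod_eq, one_mul] at h1
    exact h1
  -- Surjectivity of the strict derivative makes `Φ` send neighbourhoods onto neighbourhoods of `0`;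
  -- what remains is to read this back from coordinates in `H`.
  have key : {y : E | coordInv y * q ∈ S} ∈ 𝓝 (0 : E) := by
    rw [← hmap, Filter.mem_map]
    have e1 : ∀ᶠ p : V × W in 𝓝 (0, ⟨X₀, hX₀⟩), a p.1 ∈ coordSource E H :=
      (continuousAt_fst (p := ((0 : V), (⟨X₀, hX₀⟩ : W)))).eventually
        (hac'.eventually (coordSource_mem_nhds E))
    have e2 : ∀ᶠ p : V × W in 𝓝 (0, ⟨X₀, hX₀⟩), oneParam H (J p.2) 1 * q⁻¹ ∈ coordSource E H :=
      (continuousAt_snd (p := ((0 : V), (⟨X₀, hX₀⟩ : W)))).eventually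
        (hexp.eventually (coordSource_mem_nhds E))
    filter_upwards [e1, e2, hprod.eventually (coordSource_mem_nhds E)] with p h1 h2 h3
    have h4 : Φ p = coord E (a p.1 * (oneParam H (J p.2) 1 * q⁻¹)) := by
      simp only [Φ, mulCoord, e, expQuot]
      rw [coordInv_coord h1, hJ ⟨X₀, hX₀⟩, ← hq, coordInv_coord h2]
    rw [Set.mem_preimage, Set.mem_ofPred_eq, h4, coordInv_coord h3]
    exact ⟨a p.1, haK _, p.2, p.2.2, by rw [hJ]; group⟩
  have ht : Filter.Tendsto (fun g : H => g * q⁻¹) (𝓝 q) (𝓝 1) := by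
    have := (continuous_mul_const (M := H) q⁻¹).tendsto q
    rwa [mul_inv_cancel] at this
  filter_upwards [ht.eventually (coordSource_mem_nhds E),
    (tendsto_coord.comp ht).eventually key] with g h1 h2
  simpa [coordInv_coord h1] using h2

theorem IsRealFormSubgroup.isOpen_mul_oneParam (hK : IsRealFormSubgroup V W K)
    (hF : IsConvexPotential W F) :
    IsOpen {g : H | ∃ k ∈ K, ∃ X ∈ W, g = k * oneParam H (Complex.I • X) 1} := by
  have : IsTopologicalGroup H := topologicalGroup_of_lieGroup 𝓘(ℂ, E) ∞
  rw [isOpen_iff_mem_nhds]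
  rintro _ ⟨k, hk, X, hX, rfl⟩
  have ht : Filter.Tendsto (fun g : H => k⁻¹ * g) (𝓝 (k * oneParam H (Complex.I • X) 1))
      (𝓝 (oneParam H (Complex.I • X) 1)) := by
    have := (continuous_const_mul (M := H) k⁻¹).tendsto (k * oneParam H (Complex.I • X) 1)
    rwa [inv_mul_cancel_left] at this
  filter_upwards [ht (hK.mul_oneParam_mem_nhds hF hX)]
  rintro g ⟨l, hl, Y, hY, h⟩
  exact ⟨k * l, K.mul_mem hk hl, Y, hY, by rw [mul_assoc, ← h, mul_inv_cancel_left]⟩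

theorem IsConvexPotential.strictConvexOn_oneParam (hF : IsConvexPotential W F) (p : H) {X : E}
    (hX : X ∈ W) (hX0 : X ≠ 0) :
    StrictConvexOn ℝ Set.univ fun t => F (p * oneParam H (Complex.I • X) t) :=
  hF.strictConvexOn X hX hX0 _ fun t => (hasLogDerivAt_oneParam (H := H) _ t).const_mul p

theorem IsConvexPotential.continuous (hF : IsConvexPotential W F) : Continuous F :=
  hF.contMDiff.continuous

/-- At a critical point each geodesic satisfies `F > F p` at time `1`. By compactness the increase
has a positive minimum over unit directions, and convexity turns it into uniform linear growth. -/
theorem IsConvexPotential.exists_norm_le (hF : IsConvexPotential W F) {p : H}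
    (hp : dLeft (E := E) F p = 0) (C : ℝ) :
    ∃ R : ℝ, ∀ X ∈ W, F (p * oneParam H (Complex.I • X) 1) ≤ C → ‖X‖ ≤ R := by
  have : IsTopologicalGroup H := topologicalGroup_of_lieGroup 𝓘(ℂ, E) ∞
  have : FiniteDimensional ℝ E := FiniteDimensional.complexToReal E
  have : ProperSpace E := FiniteDimensional.proper ℂ E
  let φ : E → ℝ := fun X => F (p * oneParam H (Complex.I • X) 1)
  have hφ : Continuous φ := hF.continuous.comp
    (continuous_const.mul (continuous_oneParam_one.comp (continuous_const_smul Complex.I)))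
  let s : Set E := Metric.sphere 0 1 ∩ W
  have hs : IsCompact s := (isCompact_sphere 0 1).inter_right W.closed_of_finiteDimensional
  rcases s.eq_empty_or_nonempty with h | h
  -- An empty unit sphere means that `W` is zero.
  · refine ⟨0, fun X hX _ => ?_⟩
    by_contra! hX0
    have : (‖X‖⁻¹ : ℝ) • X ∈ s := by
      refine ⟨?_, W.smul_mem _ hX⟩
      rw [mem_sphere_zero_iff_norm, norm_smul, norm_inv, norm_norm, inv_mul_cancel₀ hX0.ne']
    rw [h] at this
    exact this
  · obtain ⟨Y, hY, hmin⟩ := hs.exists_isMinOn h hφ.continuousOn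
    have hY0 : Y ≠ 0 := by
      rintro rfl
      simpa using hY.1
    have hm : F p < φ Y := by
      have h1 := StrictConvexOn.lt_of_hasDerivAt_zero (hF.strictConvexOn_oneParam p hY.2 hY0)
        (x := 0) (y := 1) (by
          have h2 := ((hasLogDerivAt_oneParam (H := H) (Complex.I • Y) 0).const_mul p).hasDerivAt_comp
            hF.contMDiff
          simpa [hp] using h2) (by norm_num)
      simpa using h1
    refine ⟨max 1 ((C - F p) / (φ Y - F p)), fun X hX hXC => ?_⟩
    by_contra! hlt
    obtain ⟨h1, h2⟩ := max_lt_iff.1 hlt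
    have hn : 0 < ‖X‖ := one_pos.trans h1
    let Z : E := (‖X‖⁻¹ : ℝ) • X
    have hZ : Z ∈ s := by
      refine ⟨?_, W.smul_mem _ hX⟩
      rw [mem_sphere_zero_iff_norm, norm_smul, norm_inv, norm_norm, inv_mul_cancel₀ hn.ne']
    have hZ0 : Z ≠ 0 := by
      intro h0
      have h3 := hZ.1
      rw [h0] at h3
      simp at h3
    have h3 := ConvexOn.add_mul_le (hF.strictConvexOn_oneParam p hZ.2 hZ0).convexOn h1.le
    have h4 : oneParam H (Complex.I • Z) ‖X‖ = oneParam H (Complex.I • X) 1 := by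
      have h5 : X = ‖X‖ • Z := by rw [smul_smul, mul_inv_cancel₀ hn.ne', one_smul]
      conv_rhs => rw [h5, smul_comm, oneParam_smul, mul_one]
    rw [h4, oneParam_zero, mul_one] at h3
    have h5 : φ Y ≤ φ Z := hmin hZ
    rw [div_lt_iff₀ (by linarith)] at h2
    have h6 : ‖X‖ * (φ Y - F p) ≤ ‖X‖ * (φ Z - F p) := by gcongr
    have h7 : φ Z = F (p * oneParam H (Complex.I • Z) 1) := rfl
    rw [← h7] at h3
    linarith

/-- Near a limit point `g` the value of `F` is below `F g + 1`, so only bounded `X` occur. There the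
set is a compact set times the closed subgroup `K`, hence closed. -/
theorem IsRealFormSubgroup.isClosed_mul_oneParam (hK : IsRealFormSubgroup V W K)
    (hF : IsConvexPotential W F) (hFK : ∀ g, ∀ k ∈ K, F (g * k) = F g) {p : H}
    (hp : dLeft (E := E) F p = 0) :
    IsClosed {g : H | ∃ X ∈ W, ∃ k ∈ K, g = p * oneParam H (Complex.I • X) 1 * k} := by
  have : IsTopologicalGroup H := topologicalGroup_of_lieGroup 𝓘(ℂ, E) ∞
  have : FiniteDimensional ℝ E := FiniteDimensional.complexToReal E
  have : ProperSpace E := FiniteDimensional.proper ℂ E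
  set S := {g : H | ∃ X ∈ W, ∃ k ∈ K, g = p * oneParam H (Complex.I • X) 1 * k}
  refine isClosed_of_closure_subset fun g hg => ?_
  obtain ⟨R, hR⟩ := hF.exists_norm_le hp (F g + 1)
  let φ : E → H := fun X => p * oneParam H (Complex.I • X) 1
  have hφ : Continuous φ :=
    continuous_const.mul (continuous_oneParam_one.comp (continuous_const_smul Complex.I))
  let T : Set H := Set.image2 (· * ·) (φ '' (Metric.closedBall 0 R ∩ W)) (K : Set H)
  have hT : IsClosed T := hK.isClosed.mul_left_of_isCompact
    (((isCompact_closedBall 0 R).inter_right W.closed_of_finiteDimensional).image hφ)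
  have hTS : T ⊆ S := by
    rintro _ ⟨_, ⟨X, hX, rfl⟩, k, hk, rfl⟩
    exact ⟨X, hX.2, k, hk, rfl⟩
  refine hTS (hT.closure_subset ?_)
  rw [mem_closure_iff_nhds] at hg ⊢
  intro U hU
  have hU' : {x | F x < F g + 1} ∈ 𝓝 g :=
    (isOpen_lt hF.continuous continuous_const).mem_nhds (by simp)
  obtain ⟨x, ⟨hxU, hxF⟩, X, hX, k, hk, rfl⟩ := hg _ (Filter.inter_mem hU hU')
  refine ⟨_, hxU, _, ⟨X, ⟨?_, hX⟩, rfl⟩, k, hk, rfl⟩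
  rw [Set.mem_ofPred_eq, hFK _ _ hk] at hxF
  simpa using hR X hX hxF.le

theorem IsRealFormSubgroup.inv_mul_mem (hK : IsRealFormSubgroup V W K)
    (hF : IsConvexPotential W F) (hFK : ∀ g, ∀ k ∈ K, F (g * k) = F g)
    (hconn : PreconnectedSpace (H ⧸ K)) {p q : H} (hp : dLeft (E := E) F p = 0)
    (hq : dLeft (E := E) F q = 0) : p⁻¹ * q ∈ K := by
  have : IsTopologicalGroup H := topologicalGroup_of_lieGroup 𝓘(ℂ, E) ∞
  set S := {g : H | ∃ X ∈ W, ∃ k ∈ K, g = p * oneParam H (Complex.I • X) 1 * k}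
  have hopen : IsOpen S := by
    -- Inversion turns `p exp(iX) k` into the form `k exp(iX)` for which openness was proved.
    have h1 : S = (fun g => g⁻¹ * p) ⁻¹'
        {g : H | ∃ k ∈ K, ∃ X ∈ W, g = k * oneParam H (Complex.I • X) 1} := by
      ext g
      constructor
      · rintro ⟨X, hX, k, hk, rfl⟩
        refine ⟨k⁻¹, K.inv_mem hk, -X, W.neg_mem hX, ?_⟩
        rw [smul_neg, oneParam_neg]
        group
      · rintro ⟨k, hk, X, hX, h⟩
        refine ⟨-X, W.neg_mem hX, k⁻¹, K.inv_mem hk, ?_⟩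
        rw [smul_neg, oneParam_neg, mul_assoc, ← mul_inv_rev, ← h]
        group
    rw [h1]
    exact (hK.isOpen_mul_oneParam hF).preimage (by fun_prop)
  have hsat : (QuotientGroup.mk : H → H ⧸ K) ⁻¹' (QuotientGroup.mk '' S) = S := by
    refine Set.Subset.antisymm ?_ (Set.subset_preimage_image _ _)
    rintro g ⟨_, ⟨X, hX, k, hk, rfl⟩, h⟩
    refine ⟨X, hX, k * ((p * oneParam H (Complex.I • X) 1 * k)⁻¹ * g),
      K.mul_mem hk (QuotientGroup.eq.1 h), ?_⟩
    group
  have hclopen : IsClopen ((QuotientGroup.mk : H → H ⧸ K) '' S) := by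
    rw [← (QuotientGroup.isQuotientMap_mk (G := H) (N := K)).isClopen_preimage, hsat]
    exact ⟨hK.isClosed_mul_oneParam hF hFK hp, hopen⟩
  have huniv := hclopen.eq_univ ⟨_, p, ⟨0, W.zero_mem, 1, K.one_mem, by simp⟩, rfl⟩
  have hqS : q ∈ S := by
    rw [← hsat, huniv]
    trivial
  obtain ⟨X, hX, k, hk, rfl⟩ := hqS
  rcases eq_or_ne X 0 with rfl | hX0
  · simpa [mul_assoc] using hk
  exfalso
  -- The times `0` and `1` are both critical on this geodesic, so each value would be strictly less
  -- than the other.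
  have hc := hF.strictConvexOn_oneParam p hX hX0
  have h0 := StrictConvexOn.lt_of_hasDerivAt_zero hc (x := 0) (y := 1) (by
    simpa [hp] using ((hasLogDerivAt_oneParam (H := H) (Complex.I • X) 0).const_mul
      p).hasDerivAt_comp hF.contMDiff) (by norm_num)
  have h1 := StrictConvexOn.lt_of_hasDerivAt_zero hc (x := 1) (y := 0) (by
    have := (((hasLogDerivAt_oneParam (H := H) (Complex.I • X) 1).const_mul p).mul_const
      k).hasDerivAt_comp hF.contMDiff
    rw [hq] at this
    simpa [hFK _ _ hk] using this) (by norm_num)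
  exact lt_asymm h0 h1

end Critical

end CplxLie

end

noncomputable section

namespace CplxLie

/-! ### Complexifications as real form subgroups -/

section Complexification

variable {V : Type*} [NormedAddCommGroup V] [NormedSpace ℝ V]
  {G : Type*} [TopologicalSpace G] [ChartedSpace V G] [Group G] [LieGroup 𝓘(ℝ, V) ∞ G]
  {E : Type*} [NormedAddCommGroup E] [NormedSpace ℂ E]
  {H : Type*} [TopologicalSpace H] [ChartedSpace E H] [Group H] [LieGroup 𝓘(ℂ, E) ∞ H]
  {ι : G →* H}

variable (V G) in
/-- The parametrisation of a Lie group by its Lie algebra given by the preferred chart at `1`. -/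
def param (x : V) : G := (extChartAt 𝓘(ℝ, V) (1 : G)).symm (extChartAt 𝓘(ℝ, V) (1 : G) 1 + x)

@[simp] theorem param_zero : param V G 0 = 1 := by simp [param]

theorem eventually_param_sub {β : Type*} {l : Filter β} {c : β → G}
    (hc : Filter.Tendsto c l (𝓝 1)) :
    ∀ᶠ x in l, param V G (extChartAt 𝓘(ℝ, V) (1 : G) (c x) -
      extChartAt 𝓘(ℝ, V) (1 : G) 1) = c x := by
  filter_upwards [hc.eventually (extChartAt_source_mem_nhds (I := 𝓘(ℝ, V)) (1 : G))] with x hx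
  rw [param, add_sub_cancel]
  exact (extChartAt 𝓘(ℝ, V) (1 : G)).left_inv hx

theorem continuousAt_param : ContinuousAt (param V G) 0 := by
  have h1 : ContinuousAt (extChartAt 𝓘(ℝ, V) (1 : G)).symm
      (extChartAt 𝓘(ℝ, V) (1 : G) 1 + 0) := by
    rw [add_zero]
    exact continuousAt_extChartAt_symm (I := 𝓘(ℝ, V)) (1 : G)
  exact ContinuousAt.comp (f := fun x : V => extChartAt 𝓘(ℝ, V) (1 : G) 1 + x) h1 (by fun_prop)

theorem tendsto_param : Filter.Tendsto (param V G) (𝓝 0) (𝓝 1) := by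
  simpa [ContinuousAt] using continuousAt_param (V := V) (G := G)

/-- `dOne ι` as a map of model spaces. -/
def dModel (ι : G →* H) : V →L[ℝ] E := dOne ι

/-- `adj h` as a map of model spaces. -/
def adjModel (h : G) : V →L[ℝ] V := adj h

/-- The image of the Lie algebra of `G`. -/
def tangentRange (V E : Type*) [NormedAddCommGroup V] [NormedSpace ℝ V] [NormedAddCommGroup E]
    [NormedSpace ℂ E] {G : Type*} [TopologicalSpace G] [ChartedSpace V G] [Group G]
    {H : Type*} [TopologicalSpace H] [ChartedSpace E H] [Group H] (ι : G →* H) :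
    Submodule ℝ E :=
  (dModel ι : V →L[ℝ] E).range

theorem dModel_mem (ι : G →* H) (X : V) : dModel ι X ∈ tangentRange V E ι := ⟨X, rfl⟩

theorem hasStrictFDerivAt_coord_param (hι : ContMDiff 𝓘(ℝ, V) 𝓘(ℝ, E) ∞ ι) :
    HasStrictFDerivAt (fun x : V => coord E (ι (param V G x))) (dModel ι : V →L[ℝ] E) 0 := by
  set y := extChartAt 𝓘(ℝ, V) (1 : G) 1 with hy
  have h1 : HasFDerivAt (fun x : V => extChartAt 𝓘(ℝ, E) (ι 1)
      (ι ((extChartAt 𝓘(ℝ, V) (1 : G)).symm x))) (dModel ι : V →L[ℝ] E) y := by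
    have h := ((hι 1).mdifferentiableAt (by simp)).hasMFDerivAt.2
    have h' : HasFDerivWithinAt (fun x : V => extChartAt 𝓘(ℝ, E) (ι 1)
      (ι ((extChartAt 𝓘(ℝ, V) (1 : G)).symm x))) (dModel ι : V →L[ℝ] E)
        (Set.range 𝓘(ℝ, V)) y := h
    simpa using h'
  have h2 : ContDiffAt ℝ ∞ (fun x : V => extChartAt 𝓘(ℝ, E) (ι 1)
      (ι ((extChartAt 𝓘(ℝ, V) (1 : G)).symm x))) y := by
    have h' : ContDiffWithinAt ℝ ∞ (fun x : V => extChartAt 𝓘(ℝ, E) (ι 1)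
      (ι ((extChartAt 𝓘(ℝ, V) (1 : G)).symm x))) (Set.range 𝓘(ℝ, V)) y := ((contMDiffAt_iff).1 (hι 1)).2
    simpa [contDiffWithinAt_univ] using h'
  have h3 := h2.hasStrictFDerivAt (by simp)
  rw [h1.fderiv] at h3
  have h4 : y = y + (0 : V) := (add_zero y).symm
  rw [h4] at h3
  have h5 : HasStrictFDerivAt (fun x : V => y + x) (ContinuousLinearMap.id ℝ V) 0 :=
    (hasStrictFDerivAt_id 0).const_add y
  have h6 := (h3.comp (0 : V) h5).sub_const (extChartAt 𝓘(ℝ, E) (1 : H) 1)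
  rw [map_one] at h6
  exact h6

theorem tendsto_map_param (hι : ContMDiff 𝓘(ℝ, V) 𝓘(ℝ, E) ∞ ι) :
    Filter.Tendsto (fun x => ι (param V G x)) (𝓝 0) (𝓝 1) := by
  have h := hι.continuous.tendsto 1
  rw [map_one] at h
  exact h.comp tendsto_param

theorem hasTangentAt_map_param (hι : ContMDiff 𝓘(ℝ, V) 𝓘(ℝ, E) ∞ ι) (X : V) :
    HasTangentAt (fun s : ℝ => ι (param V G (s • X))) (dModel ι X : E) 0 := by
  have h0 : HasDerivAt (fun s : ℝ => s • X) X 0 := by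
    simpa using (hasDerivAt_id (0 : ℝ)).smul_const X
  refine ⟨by simp, ?_, ?_⟩
  · have h1 : Filter.Tendsto (fun s : ℝ => s • X) (𝓝 0) (𝓝 0) := by
      simpa using h0.continuousAt.tendsto
    simpa [ContinuousAt, Function.comp_def] using (tendsto_map_param hι).comp h1
  · have h1 := (hasStrictFDerivAt_coord_param (E := E) hι).hasFDerivAt
    rw [← zero_smul ℝ X] at h1
    exact h1.comp_hasDerivAt (0 : ℝ) h0

theorem hasLogDerivAt_mul_map_param (hι : ContMDiff 𝓘(ℝ, V) 𝓘(ℝ, E) ∞ ι) (g : H) (X : V) :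
    HasLogDerivAt (fun s : ℝ => g * ι (param V G (s • X))) (dModel ι X : E) 0 :=
  (hasTangentAt_map_param hι X).congr (Filter.Eventually.of_forall fun s => by simp)

/-- Differentiate `ι(h k h⁻¹) = ι(h) ι(k) ι(h)⁻¹` at `k = 1`. -/
theorem Ad_dModel (hι : ContMDiff 𝓘(ℝ, V) 𝓘(ℝ, E) ∞ ι) (h : G) (X : V) :
    Ad (ι h) (dModel ι X : E) = dModel ι (adjModel h X : V) := by
  have : IsTopologicalGroup G := topologicalGroup_of_lieGroup 𝓘(ℝ, V) ∞
  set y := extChartAt 𝓘(ℝ, V) (1 : G) 1 with hy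
  set A : V →L[ℝ] V := adjModel h with hA
  have hm1 : h * 1 * h⁻¹ = 1 := by simp
  have hm : ContMDiff 𝓘(ℝ, V) 𝓘(ℝ, V) ∞ (fun k : G => h * k * h⁻¹) :=
    (contMDiff_const.mul contMDiff_id).mul contMDiff_const
  have h1 : HasFDerivAt (fun x : V => extChartAt 𝓘(ℝ, V) (h * 1 * h⁻¹)
      (h * (extChartAt 𝓘(ℝ, V) (1 : G)).symm x * h⁻¹)) A y := by
    have h' : HasFDerivWithinAt (fun x : V => extChartAt 𝓘(ℝ, V) (h * 1 * h⁻¹)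
      (h * (extChartAt 𝓘(ℝ, V) (1 : G)).symm x * h⁻¹)) A
        (Set.range 𝓘(ℝ, V)) y := ((hm 1).mdifferentiableAt (by simp)).hasMFDerivAt.2
    simpa using h'
  rw [hm1, ← add_zero y] at h1
  have h2 : HasFDerivAt (fun x : V => extChartAt 𝓘(ℝ, V) (1 : G) (h * param V G x * h⁻¹) - y) A 0 :=
    (h1.comp (0 : V) ((hasFDerivAt_id 0).const_add y)).sub_const y
  have hD := (hasStrictFDerivAt_coord_param (E := E) hι).hasFDerivAt
  have h3 : HasFDerivAt (fun x : V => coord E (ι (param V G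
      (extChartAt 𝓘(ℝ, V) (1 : G) (h * param V G x * h⁻¹) - y)))) ((dModel ι : V →L[ℝ] E) ∘L A) 0 := by
    have h4 : extChartAt 𝓘(ℝ, V) (1 : G) (h * param V G 0 * h⁻¹) - y = 0 := by simp [hy]
    rw [← h4] at hD
    exact hD.comp (0 : V) h2
  have h5 : HasFDerivAt (fun x : V => coord E (ι h * coordInv (coord E (ι (param V G x))) * (ι h)⁻¹))
      ((Ad (ι h)).restrictScalars ℝ ∘L (dModel ι : V →L[ℝ] E)) 0 := by
    have h6 := (hasFDerivAt_conj_coord (E := E) (ι h)).restrictScalars ℝ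
    have h7 : coord E (ι (param V G 0)) = 0 := by simp
    rw [← h7] at h6
    exact h6.comp (0 : V) (hasStrictFDerivAt_coord_param (E := E) hι).hasFDerivAt
  have htend : Filter.Tendsto (fun x : V => h * param V G x * h⁻¹) (𝓝 0) (𝓝 1) := by
    simpa using (tendsto_param.const_mul h).mul_const h⁻¹
  have h8 := h5.unique (h3.congr_of_eventuallyEq (by
    filter_upwards [eventually_param_sub (V := V) htend,
      (tendsto_map_param hι).eventually (coordSource_mem_nhds E)] with x hx1 hx2
    rw [hx1, coordInv_coord hx2, map_mul, map_mul, map_inv]))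
  exact congrArg (fun L : V →L[ℝ] E => L X) h8

/-- `ad` is a limit of difference quotients of `Ad(ι h)`, which preserves the image of the Lie
algebra; that image is closed, being finite-dimensional. -/
theorem ad_dModel_mem [FiniteDimensional ℂ E] (hι : ContMDiff 𝓘(ℝ, V) 𝓘(ℝ, E) ∞ ι) (X Y : V) :
    ad E H (dModel ι X) (dModel ι Y) ∈ tangentRange V E ι := by
  have : FiniteDimensional ℝ E := FiniteDimensional.complexToReal E
  have h1 := (hasLogDerivAt_mul_map_param (E := E) hι 1 X).hasDerivAt_Ad_apply (dModel ι Y)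
  simp only [one_mul, zero_smul, param_zero, map_one, Ad_one, ContinuousLinearMap.id_apply] at h1
  rw [hasDerivAt_iff_tendsto_slope] at h1
  refine (tangentRange V E ι).closed_of_finiteDimensional.mem_of_tendsto h1
    (Filter.Eventually.of_forall fun s => ?_)
  rw [slope_def_module]
  refine Submodule.smul_mem _ _ (Submodule.sub_mem _ ?_ ?_)
  · rw [Ad_dModel hι]; exact dModel_mem _ _
  · rw [Ad_dModel hι]; exact dModel_mem _ _

theorem IsComplexification.isRealForm (hι : IsComplexification (V := V) (E := E) ι) :
    IsRealForm (tangentRange V E ι) := by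
  constructor
  · intro v
    obtain ⟨⟨a, b⟩, hab⟩ : ∃ p : V × V, (dModel ι p.1 + Complex.I • dModel ι p.2 : E) = v :=
      hι.bijective.2 v
    exact ⟨dModel ι a, dModel_mem ι a, dModel ι b, dModel_mem ι b, hab.symm⟩
  · rintro _ ⟨a, rfl⟩ _ ⟨b, rfl⟩ h
    have hinj : Function.Injective
        fun p : V × V => (dModel ι p.1 + Complex.I • dModel ι p.2 : E) := hι.bijective.1
    have h1 : ((a, b) : V × V) = 0 := hinj (h.trans (by simp))
    rw [Prod.mk_eq_zero] at h1
    simp [h1.1, h1.2]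

theorem IsComplexification.isRealFormSubgroup [FiniteDimensional ℂ E]
    (hι : IsComplexification (V := V) (E := E) ι) :
    IsRealFormSubgroup V (tangentRange V E ι) ι.range where
  isRealForm := hι.isRealForm
  ad_mem := by
    rintro _ ⟨X, rfl⟩ _ ⟨Y, rfl⟩
    exact ad_dModel_mem hι.contMDiff X Y
  isClosed := by
    simpa using hι.isClosedEmbedding.isClosed_range
  exists_param := by
    refine ⟨fun x => ι (param V G x), dModel ι, by simp, fun x => ⟨_, rfl⟩, ?_,
      hasStrictFDerivAt_coord_param hι.contMDiff, ?_⟩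
    · simpa [ContinuousAt] using tendsto_map_param hι.contMDiff
    · rintro _ ⟨X, rfl⟩
      exact ⟨X, rfl⟩

/-- Left translations are holomorphic, so `J (L_g)_* X` is the left-invariant field of `iX`. This
identifies geodesic lifts with curves of logarithmic derivative `iX`. -/
theorem mulInvariantVectorField_I_smul (X : E) (g : H) :
    (mulInvariantVectorField (I := 𝓘(ℝ, E)) (Complex.I • X : E) g : E) =
      cplxJ g (mulInvariantVectorField (I := 𝓘(ℝ, E)) (X : E) g) := by
  obtain ⟨L, -, hL⟩ := exists_hasMFDerivAt_mul_left (E := E) g 1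
  have h : ∀ Y : E, (mulInvariantVectorField (I := 𝓘(ℝ, E)) Y g : E) = L Y := fun Y => by
    have h := hL.mfderiv
    exact congrArg (fun L : E →L[ℝ] E => L Y) h
  rw [h]
  refine (map_smul L Complex.I X).trans ?_
  rw [← h X]
  rfl

theorem lift_mul_range {f : H ⧸ ι.range → ℝ} (g : H) {k : H} (hk : k ∈ ι.range) :
    lift ι f (g * k) = lift ι f g :=
  congrArg f (QuotientGroup.mk_mul_of_mem g hk)

theorem dLeft_dModel_eq_zero [FiniteDimensional ℂ E] (hι : ContMDiff 𝓘(ℝ, V) 𝓘(ℝ, E) ∞ ι) {F : H → ℝ}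
    (hF : ContMDiff 𝓘(ℝ, E) 𝓘(ℝ, ℝ) ∞ F) (hFι : ∀ g h, F (g * ι h) = F g) (g : H) (X : V) :
    dLeft F g (dModel ι X : E) = 0 := by
  have h := (hasLogDerivAt_mul_map_param (E := E) hι g X).hasDerivAt_comp hF
  simp only [hFι, zero_smul, param_zero, map_one, mul_one] at h
  exact h.unique (hasDerivAt_const _ _)

theorem IsComplexification.isConvexPotential [FiniteDimensional ℂ E]
    (hι : IsComplexification (V := V) (E := E) ι)
    {f : H ⧸ ι.range → ℝ} (hF : ContMDiff 𝓘(ℝ, E) 𝓘(ℝ, ℝ) ∞ (lift ι f))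
    (hf : IsStrictlyConvex V E ι f) : IsConvexPotential (tangentRange V E ι) (lift ι f) where
  contMDiff := hF
  dLeft_eq_zero := by
    rintro g _ ⟨X, rfl⟩
    exact dLeft_dModel_eq_zero hι.contMDiff hF (fun g h => lift_mul_range g ⟨h, rfl⟩) g X
  strictConvexOn := by
    rintro _ ⟨X, rfl⟩ hX c hc
    refine hf X c (fun h => hX (by rw [h]; exact map_zero _)) fun t => ?_
    have h := hasLogDerivAt_iff.1 (hc t)
    rw [mulInvariantVectorField_I_smul] at h
    exact h

end Complexification

end CplxLie

end

noncomputable section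

namespace CplxLie

/-! ### The moment map -/

section FlatMoment

variable {E : Type*} [NormedAddCommGroup E] [NormedSpace ℂ E]

/-- If `du(ξ) = 0` for a holomorphic vector field `ξ`, then `d(du(iξ)) = i_ξ ddᶜu`. -/
theorem fderiv_fderiv_apply_I_smul {u : E → ℝ} {ξ : E → E} {y : E} (hu : ContDiffAt ℝ ∞ u y)
    (hξ : DifferentiableAt ℂ ξ y) (h : ∀ᶠ z in 𝓝 y, fderiv ℝ u z (ξ z) = 0) (w : E) :
    fderiv ℝ (fun z => fderiv ℝ u z (Complex.I • ξ z)) y w = ddcFlat u y ![ξ y, w] := by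
  have hs : IsSymmSndFDerivAt ℝ u y := hu.isSymmSndFDerivAt (by simpa using ENat.LEInfty.out)
  have h2 : HasFDerivAt (fderiv ℝ u) (fderiv ℝ (fderiv ℝ u) y) y :=
    ((hu.fderiv_right (m := ∞) (by simp)).differentiableAt (by simp)).hasFDerivAt
  have h3 := hξ.hasFDerivAt.restrictScalars ℝ
  have h4 := (mulI E).hasFDerivAt.comp y h3
  have h5 := h2.clm_apply h3
  have h6 := h2.clm_apply h4
  -- Differentiate `du(ξ) = 0` in the direction `iw`; as `ξ` is holomorphic, `Dξ(iw) = i Dξ(w)`, the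
  -- first-order term in the derivative of `du(iξ)`.
  have h7 := congrArg (fun L : E →L[ℝ] ℝ => L (Complex.I • w))
    (h5.unique ((hasFDerivAt_const (0 : ℝ) y).congr_of_eventuallyEq h))
  have h8 : fderiv ℝ u y (fderiv ℂ ξ y (Complex.I • w)) +
      fderiv ℝ (fderiv ℝ u) y (Complex.I • w) (ξ y) = 0 := h7
  have h9 : fderiv ℝ (fun z => fderiv ℝ u z (Complex.I • ξ z)) y w =
      fderiv ℝ u y (Complex.I • fderiv ℂ ξ y w) +
        fderiv ℝ (fderiv ℝ u) y w (Complex.I • ξ y) :=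
    congrArg (fun L : E →L[ℝ] ℝ => L w) h6.fderiv
  rw [map_smul] at h8
  rw [h9, ddcFlat_apply hu, hs.eq (ξ y)]
  linarith

end FlatMoment

section MomentMap

variable {E : Type*} [NormedAddCommGroup E] [NormedSpace ℂ E] [FiniteDimensional ℂ E]
  {H : Type*} [TopologicalSpace H] [ChartedSpace E H] [Group H] [LieGroup 𝓘(ℂ, E) ∞ H]

/-- The differential at `1` of left translation by the point with coordinates `y` in the preferred
chart at `g`. -/
def velChart (g : H) (y : E) : E →L[ℂ] E :=
  fderiv ℂ (fun x : E => extChartAt 𝓘(ℝ, E) g ((extChartAt 𝓘(ℝ, E) g).symm y * coordInv x)) 0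

theorem contDiffAt_mul_coordInv_chart (g : H) {y : E} (hy : y ∈ (extChartAt 𝓘(ℝ, E) g).target) :
    ContDiffAt ℂ ∞ (fun p : E × E => extChartAt 𝓘(ℝ, E) g
      ((extChartAt 𝓘(ℝ, E) g).symm p.1 * coordInv p.2)) (y, 0) := by
  have h1 : ContMDiffAt 𝓘(ℂ, E × E) 𝓘(ℂ, E) ∞
      (fun p : E × E => (extChartAt 𝓘(ℝ, E) g).symm p.1) (y, 0) :=
    ContMDiffAt.comp (y, (0 : E)) (I' := 𝓘(ℂ, E)) (f := Prod.fst)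
      (g := (extChartAt 𝓘(ℝ, E) g).symm) (mdifferentiableAt_extChartAt_symm_complex g hy)
      contDiff_fst.contMDiff.contMDiffAt
  have h2 : ContMDiffAt 𝓘(ℂ, E × E) 𝓘(ℂ, E) ∞ (fun p : E × E => (coordInv p.2 : H)) (y, 0) :=
    ContMDiffAt.comp (y, (0 : E)) (I' := 𝓘(ℂ, E)) (f := Prod.snd) (g := coordInv)
      (contMDiffAt_coordInv (zero_mem_coordTarget E H)) contDiff_snd.contMDiff.contMDiffAt
  refine ContMDiffAt.contDiffAt (ContMDiffAt.comp (y, (0 : E)) (I' := 𝓘(ℂ, E))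
    (g := extChartAt 𝓘(ℝ, E) g) (contMDiffAt_extChartAt_complex g ?_) (h1.mul h2))
  simpa using (extChartAt 𝓘(ℝ, E) g).map_target hy

theorem contDiffAt_velChart (g : H) {y : E} (hy : y ∈ (extChartAt 𝓘(ℝ, E) g).target) :
    ContDiffAt ℂ ∞ (velChart g) y :=
  ContDiffAt.fderiv (f := fun y x : E => extChartAt 𝓘(ℝ, E) g
    ((extChartAt 𝓘(ℝ, E) g).symm y * coordInv x)) (g := fun _ => 0) (n := ∞)
    (contDiffAt_mul_coordInv_chart g hy) contDiffAt_const (by simp)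

theorem HasLogDerivAt.hasDerivAt_extChartAt {c : ℝ → H} {X : E} {t : ℝ}
    (hc : HasLogDerivAt c X t) (g : H) (hg : c t ∈ (extChartAt 𝓘(ℝ, E) g).source) :
    HasDerivAt (fun s => extChartAt 𝓘(ℝ, E) g (c s))
      (velChart g (extChartAt 𝓘(ℝ, E) g (c t)) X) t := by
  set φ := extChartAt 𝓘(ℝ, E) g with hφ
  have h1 : ContDiffAt ℂ ∞ (fun x : E => φ (φ.symm (φ (c t)) * coordInv x)) 0 :=
    ContDiffAt.comp (0 : E) (g := fun p : E × E => φ (φ.symm p.1 * coordInv p.2))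
      (f := fun x => (φ (c t), x)) (contDiffAt_mul_coordInv_chart g (φ.map_source hg))
      (contDiffAt_const.prodMk contDiffAt_id)
  have h2 : HasFDerivAt (fun x : E => φ (φ.symm (φ (c t)) * coordInv x))
      ((velChart g (φ (c t))).restrictScalars ℝ) (coord E ((c t)⁻¹ * c t)) := by
    rw [inv_mul_cancel, coord_one]
    exact (h1.differentiableAt (by simp)).hasFDerivAt.restrictScalars ℝ
  refine (h2.comp_hasDerivAt t hc.tangent.hasDerivAt).congr_of_eventuallyEq ?_
  filter_upwards [hc.tangent.eventually_coordInv] with s hs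
  simp only [Function.comp, hs]
  rw [φ.left_inv hg, mul_inv_cancel_left]

theorem hasLogDerivAt_mul_oneParam (g : H) (X : E) :
    HasLogDerivAt (fun s => g * oneParam H X s) X 0 :=
  (hasLogDerivAt_oneParam X 0).const_mul g

theorem hasDerivAt_comp_curve {E' : Type*} [NormedAddCommGroup E'] [NormedSpace ℝ E'] {f : H → E'}
    {L : E →L[ℝ] E'} {c : ℝ → H} {X : E} {t : ℝ} {g : H} (hg : c t = g)
    (hf : HasMFDerivAt 𝓘(ℝ, E) 𝓘(ℝ, E') f g L) (hc : HasLogDerivAt c X t) :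
    HasDerivAt (fun s => f (c s)) (L (mulInvariantVectorField (I := 𝓘(ℝ, E)) X g)) t := by
  subst hg
  obtain ⟨w, hw⟩ : ∃ w : E, w = mulInvariantVectorField (I := 𝓘(ℝ, E)) X (c t) := ⟨_, rfl⟩
  have h1 : HasMFDerivAt 𝓘(ℝ, ℝ) 𝓘(ℝ, E) c t
      (ContinuousLinearMap.smulRight (1 : ℝ →L[ℝ] ℝ) w : ℝ →L[ℝ] E) := by
    rw [hw]
    exact hasLogDerivAt_iff.1 hc
  have h2 : HasFDerivAt (fun s => f (c s))
      (L ∘L (ContinuousLinearMap.smulRight (1 : ℝ →L[ℝ] ℝ) w : ℝ →L[ℝ] E)) t :=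
    (hf.comp t h1).hasFDerivAt
  rw [← hw]
  simpa using h2.hasDerivAt

theorem dLeft_eq_dReal {F : H → ℝ} (hF : ContMDiff 𝓘(ℝ, E) 𝓘(ℝ, ℝ) ∞ F) (g : H) (X : E) :
    dLeft F g X = dReal (E := E) F g (mulInvariantVectorField (I := 𝓘(ℝ, E)) X g) := by
  have h1 := hasLogDerivAt_mul_oneParam g X
  have h2 := h1.hasDerivAt_comp hF
  have hg : g * oneParam H X 0 = g := by simp
  obtain ⟨l, h4, h5⟩ := exists_hasMFDerivAt_dReal (E := E) ((hF g).mdifferentiableAt (by simp))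
  have h6 := (hasDerivAt_comp_curve hg h4 h1).unique h2
  rw [hg] at h6
  rw [h5, ← h6]
  rfl

theorem mfderiv_extChartAt_mulInvariantVectorField (g : H) (X : E) {A : E →L[ℝ] E}
    (hA : HasMFDerivAt 𝓘(ℝ, E) 𝓘(ℝ, E) (extChartAt 𝓘(ℝ, E) g) g A) :
    A (mulInvariantVectorField (I := 𝓘(ℝ, E)) X g) =
      velChart g (extChartAt 𝓘(ℝ, E) g g) X := by
  have h1 := hasLogDerivAt_mul_oneParam g X
  have hg : g * oneParam H X 0 = g := by simp
  have h2 := h1.hasDerivAt_extChartAt g (by rw [hg]; exact mem_extChartAt_source g)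
  have h6 := (hasDerivAt_comp_curve hg hA h1).unique h2
  rwa [hg] at h6

/-- A formula in one fixed chart, valid for all nearby `k`; it allows the left-trivialised
derivative itself to be differentiated. -/
theorem dLeft_eq_fderiv {F : H → ℝ} (hF : ContMDiff 𝓘(ℝ, E) 𝓘(ℝ, ℝ) ∞ F) (g : H) {k : H}
    (hk : k ∈ (extChartAt 𝓘(ℝ, E) g).source) (X : E) :
    dLeft F k X = fderiv ℝ (fun z => F ((extChartAt 𝓘(ℝ, E) g).symm z))
      (extChartAt 𝓘(ℝ, E) g k) (velChart g (extChartAt 𝓘(ℝ, E) g k) X) := by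
  have : IsTopologicalGroup H := topologicalGroup_of_lieGroup 𝓘(ℂ, E) ∞
  have h1 := hasLogDerivAt_mul_oneParam k X
  have hk' : k * oneParam H X 0 = k := by simp
  have h2 := h1.hasDerivAt_extChartAt g (by rwa [hk'])
  have h3 := h1.hasDerivAt_comp hF
  have h4 := ((contDiffAt_comp_extChartAt_symm hF g
    ((extChartAt 𝓘(ℝ, E) g).map_source hk)).differentiableAt (by simp)).hasFDerivAt
  rw [hk'] at h2 h3
  have h5 : extChartAt 𝓘(ℝ, E) g k = extChartAt 𝓘(ℝ, E) g (k * oneParam H X 0) := by rw [hk']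
  have h6 : HasFDerivAt (fun z => F ((extChartAt 𝓘(ℝ, E) g).symm z))
      (fderiv ℝ (fun z => F ((extChartAt 𝓘(ℝ, E) g).symm z)) (extChartAt 𝓘(ℝ, E) g k))
      (extChartAt 𝓘(ℝ, E) g (k * oneParam H X 0)) := by rwa [← h5]
  refine h3.unique ((h6.comp_hasDerivAt (0 : ℝ) h2).congr_of_eventuallyEq ?_)
  have h7 : ∀ᶠ s in 𝓝 (0 : ℝ), k * oneParam H X s ∈ (extChartAt 𝓘(ℝ, E) g).source := by
    refine h1.continuousAt.eventually ?_
    beta_reduce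
    rw [hk']
    exact (isOpen_extChartAt_source (I := 𝓘(ℝ, E)) g).mem_nhds hk
  filter_upwards [h7] with s hs
  simp only [Function.comp]
  rw [(extChartAt 𝓘(ℝ, E) g).left_inv hs]

theorem contMDiff_dLeft {F : H → ℝ} (hF : ContMDiff 𝓘(ℝ, E) 𝓘(ℝ, ℝ) ∞ F) (X : E) :
    ContMDiff 𝓘(ℝ, E) 𝓘(ℝ, ℝ) ∞ fun g => dLeft F g X := by
  intro g
  have hg := mem_extChartAt_target (I := 𝓘(ℝ, E)) g
  have h1 : ContDiffAt ℝ ∞ (fun y => fderiv ℝ (fun z => F ((extChartAt 𝓘(ℝ, E) g).symm z)) y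
      (velChart g y X)) (extChartAt 𝓘(ℝ, E) g g) :=
    ((contDiffAt_comp_extChartAt_symm hF g hg).fderiv_right (m := ∞) (by simp)).clm_apply
      (((contDiffAt_velChart g hg).clm_apply contDiffAt_const).restrict_scalars ℝ)
  have h2 := h1.contMDiffAt.comp g (contMDiffAt_real_of_complex
    (contMDiffAt_extChartAt_complex (E := E) g (mem_extChartAt_source (I := 𝓘(ℝ, E)) g)))
  refine h2.congr_of_eventuallyEq ?_
  filter_upwards [extChartAt_source_mem_nhds (I := 𝓘(ℝ, E)) g] with k hk
  exact dLeft_eq_fderiv hF g hk X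

theorem dReal_dLeft_I_smul {F : H → ℝ} (hF : ContMDiff 𝓘(ℝ, E) 𝓘(ℝ, ℝ) ∞ F) {X : E}
    (hX : ∀ g, dLeft F g X = 0) (g : H) (v : TangentSpace 𝓘(ℝ, E) g) :
    dReal (fun k => (1 / 2 : ℝ) * dLeft F k (Complex.I • X)) g v =
      ddbar F g ![mulInvariantVectorField (I := 𝓘(ℝ, E)) X g, v] := by
  set φ := extChartAt 𝓘(ℝ, E) g
  set U : E → ℝ := fun z => F (φ.symm z)
  have hg : φ g ∈ φ.target := mem_extChartAt_target (I := 𝓘(ℝ, E)) g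
  have hU : ContDiffAt ℝ ∞ U (φ g) := contDiffAt_comp_extChartAt_symm hF g hg
  have hξ : ContDiffAt ℂ ∞ (fun y => velChart g y X) (φ g) :=
    (contDiffAt_velChart g hg).clm_apply contDiffAt_const
  obtain ⟨A, -, hA⟩ := exists_hasMFDerivAt_complex ((contMDiffAt_extChartAt_complex (E := E) g
    (mem_extChartAt_source (I := 𝓘(ℝ, E)) g)).mdifferentiableAt (by simp))
  have hzero : ∀ᶠ z in 𝓝 (φ g), fderiv ℝ U z (velChart g z X) = 0 := by
    filter_upwards [(isOpen_extChartAt_target (I := 𝓘(ℝ, E)) g).mem_nhds hg] with z hz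
    have h := dLeft_eq_fderiv hF g (φ.map_target hz) X
    rw [hX, φ.right_inv hz] at h
    exact h.symm
  let m : E → ℝ := fun z => fderiv ℝ U z (Complex.I • velChart g z X)
  have hm : ContDiffAt ℝ ∞ m (φ g) :=
    (hU.fderiv_right (m := ∞) (by simp)).clm_apply ((hξ.restrict_scalars ℝ).const_smul Complex.I)
  have hmd : HasFDerivAt (fun z => (1 / 2 : ℝ) * m z) ((1 / 2 : ℝ) • fderiv ℝ m (φ g)) (φ g) :=
    (hm.differentiableAt (by simp)).hasFDerivAt.const_mul _
  have h1 : HasMFDerivAt 𝓘(ℝ, E) 𝓘(ℝ, ℝ) ((fun z => (1 / 2 : ℝ) * m z) ∘ φ) g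
      (((1 / 2 : ℝ) • fderiv ℝ m (φ g)) ∘L A.restrictScalars ℝ) := hmd.hasMFDerivAt.comp g hA
  have h2 : HasMFDerivAt 𝓘(ℝ, E) 𝓘(ℝ, ℝ) (fun k => (1 / 2 : ℝ) * dLeft F k (Complex.I • X)) g
      (((1 / 2 : ℝ) • fderiv ℝ m (φ g)) ∘L A.restrictScalars ℝ) := by
    refine h1.congr_of_eventuallyEq ?_
    filter_upwards [extChartAt_source_mem_nhds (I := 𝓘(ℝ, E)) g] with k hk
    simp only [Function.comp, m]
    rw [dLeft_eq_fderiv hF g hk, map_smul]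
  have h3 : dReal (E := E) (fun k => (1 / 2 : ℝ) * dLeft F k (Complex.I • X)) g v =
      (1 / 2 : ℝ) * fderiv ℝ m (φ g) (A v) := congrArg (fun L : E →L[ℝ] ℝ => L v) h2.mfderiv
  rw [h3, fderiv_fderiv_apply_I_smul hU (hξ.differentiableAt (by simp)) hzero, ddbar_eq hF,
    hA.mfderiv, ← mfderiv_extChartAt_mulInvariantVectorField g X hA]
  have h4 : ∀ a : E, ddcFlat U (φ g) ![A a, A v] = ddcFlat U (φ g) (fun i => A (![a, v] i)) := by
    intro a
    congr 1
    ext i; fin_cases i <;> rfl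
  exact congrArg (fun r : ℝ => (1 / 2 : ℝ) * r) (h4 _)

/-- Along `g exp(s Ad_k X)`, right multiplication by `k` does not change `F`, but the logarithmic
derivative becomes `X`. This is the source of equivariance. -/
theorem dLeft_mul {F : H → ℝ} (hF : ContMDiff 𝓘(ℝ, E) 𝓘(ℝ, ℝ) ∞ F) {k : H}
    (hk : ∀ g, F (g * k) = F g) (g : H) (X : E) : dLeft F (g * k) X = dLeft F g (Ad k X) := by
  have h1 := hasLogDerivAt_mul_oneParam g (Ad k X)
  have h2 := (h1.mul_const k).hasDerivAt_comp hF
  simp only [hk] at h2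
  rw [Ad_inv_Ad] at h2
  have h3 := h2.unique (h1.hasDerivAt_comp hF)
  simpa using h3

theorem ddbar_mul_right {F : H → ℝ} (hF : ContMDiff 𝓘(ℝ, E) 𝓘(ℝ, ℝ) ∞ F) {k : H}
    (hk : ∀ g, F (g * k) = F g) (g : H) :
    (ddbar (E := E) F (g * k)).compContinuousLinearMap (dRight k g) = ddbar F g := by
  have hρ : ContMDiff 𝓘(ℂ, E) 𝓘(ℂ, E) ∞ (fun g' : H => g' * k) := contMDiff_mul_right
  obtain ⟨L, -, hL⟩ := exists_hasMFDerivAt_complex ((hρ g).mdifferentiableAt (by simp))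
  have h := ddbar_comp hF hF (Filter.Eventually.of_forall fun z => (hk z).symm) (hρ g) hL
  rw [h, dRight, hL.mfderiv]
  rfl

theorem dLeft_eq_zero_iff {F : H → ℝ} (hF : ContMDiff 𝓘(ℝ, E) 𝓘(ℝ, ℝ) ∞ F) (g : H) :
    dLeft (E := E) F g = 0 ↔ dReal (E := E) F g = 0 := by
  obtain ⟨L, -, hL⟩ := exists_hasMFDerivAt_mul_left (E := E) g (g⁻¹ * g)
  obtain ⟨L', -, hL'⟩ := exists_hasMFDerivAt_mul_left (E := E) g⁻¹ g
  have hX : ∀ X : E, (mulInvariantVectorField (I := 𝓘(ℝ, E)) X g : E) = L X := fun X => by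
    rw [inv_mul_cancel] at hL
    have h := hL.mfderiv
    exact congrArg (fun L : E →L[ℝ] E => L X) h
  have hLL : ∀ v, L (L' v) = v := fun v => by
    have h1 : HasMFDerivAt 𝓘(ℝ, E) 𝓘(ℝ, E) ((fun h : H => g * h) ∘ fun h => g⁻¹ * h) g
        (L.restrictScalars ℝ ∘L L'.restrictScalars ℝ) := hL.comp g hL'
    have h2 := hasMFDerivAt_unique (h1.congr_of_eventuallyEq (f₁ := id)
      (Filter.Eventually.of_forall fun h => by simp)) (hasMFDerivAt_id (I := 𝓘(ℝ, E)) g)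
    exact DFunLike.congr_fun h2 v
  constructor
  · intro h
    refine ContinuousLinearMap.ext fun v => ?_
    have h1 : ∀ X : E, 0 = dReal (E := E) F g (L X) := fun X => by
      rw [← hX, ← dLeft_eq_dReal hF g X, h]
      rfl
    have h2 := h1 (L' v)
    rw [show L (L' v) = v from hLL v] at h2
    exact h2.symm
  · intro h
    ext X
    rw [dLeft_eq_dReal hF, h]
    rfl

end MomentMap

/-! ### The Hamiltonian action and the zero set of the moment map -/

section Final

variable {V : Type*} [NormedAddCommGroup V] [NormedSpace ℝ V]
  {G : Type*} [TopologicalSpace G] [ChartedSpace V G] [Group G] [LieGroup 𝓘(ℝ, V) ∞ G]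
  {E : Type*} [NormedAddCommGroup E] [NormedSpace ℂ E] [FiniteDimensional ℂ E]
  {H : Type*} [TopologicalSpace H] [ChartedSpace E H] [Group H] [LieGroup 𝓘(ℂ, E) ∞ H]
  {ι : G →* H}

theorem fundField_eq (hι : ContMDiff 𝓘(ℝ, V) 𝓘(ℝ, E) ∞ ι) (g : H) (X : V) :
    (fundField ι g X : E) = mulInvariantVectorField (I := 𝓘(ℝ, E)) (dModel ι X : E) g := by
  obtain ⟨L, -, hL⟩ := exists_hasMFDerivAt_mul_left (E := E) g (ι 1)
  have h1 : HasMFDerivAt 𝓘(ℝ, V) 𝓘(ℝ, E) ι 1 (dModel ι : V →L[ℝ] E) :=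
    ((hι 1).mdifferentiableAt (by simp)).hasMFDerivAt
  have h2 : HasMFDerivAt 𝓘(ℝ, V) 𝓘(ℝ, E) ((fun k : H => g * k) ∘ ι) 1
      (L.restrictScalars ℝ ∘L (dModel ι : V →L[ℝ] E)) := hL.comp (1 : G) h1
  have h3 : (fundField ι g X : E) = L (dModel ι X) :=
    congrArg (fun L : V →L[ℝ] E => L X) h2.mfderiv
  rw [map_one] at hL
  have h4 : (mulInvariantVectorField (I := 𝓘(ℝ, E)) (dModel ι X : E) g : E) = L (dModel ι X) :=
    congrArg (fun L : E →L[ℝ] E => L (dModel ι X)) hL.mfderiv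
  rw [h3, h4]

theorem momentMap_apply (hι : ContMDiff 𝓘(ℝ, V) 𝓘(ℝ, E) ∞ ι) {F : H → ℝ}
    (hF : ContMDiff 𝓘(ℝ, E) 𝓘(ℝ, ℝ) ∞ F) (g : H) (X : V) :
    momentMap V E ι F g X = (1 / 2 : ℝ) * dLeft F g (Complex.I • dModel ι X : E) := by
  rw [dLeft_eq_dReal hF, mulInvariantVectorField_I_smul, ← fundField_eq hι]
  rfl

theorem isHamiltonian_ddbar (hι : ContMDiff 𝓘(ℝ, V) 𝓘(ℝ, E) ∞ ι) {F : H → ℝ}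
    (hF : ContMDiff 𝓘(ℝ, E) 𝓘(ℝ, ℝ) ∞ F) (hFι : ∀ g h, F (g * ι h) = F g) :
    IsHamiltonian ι (ddbar (E := E) F) (momentMap V E ι F) where
  smooth := isSmoothForm_ddbar hF
  closed := extD_ddbar hF
  invariant h g := ddbar_mul_right hF (fun g => hFι g h) g
  contMDiff (X : V) := by
    have h : (fun g => momentMap V E ι F g X) =
        fun g => (1 / 2 : ℝ) * dLeft F g (Complex.I • dModel ι (X : V) : E) :=
      funext fun g => momentMap_apply hι hF g X
    rw [h]
    exact (contDiff_const.mul contDiff_id).contMDiff.comp (contMDiff_dLeft hF _)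
  moment (X : V) g v := by
    have h : (fun g => momentMap V E ι F g X) =
        fun g => (1 / 2 : ℝ) * dLeft F g (Complex.I • dModel ι (X : V) : E) :=
      funext fun g => momentMap_apply hι hF g X
    rw [h]
    refine (dReal_dLeft_I_smul hF (dLeft_dModel_eq_zero hι hF hFι · X) g v).trans ?_
    rw [← fundField_eq hι]
  equivariant h g (X : V) := by
    have h1 : momentMap V E ι F g (adj h X) =
      (1 / 2 : ℝ) * dLeft F g (Complex.I • dModel ι (adjModel h X : V) : E) :=
      momentMap_apply hι hF g (adj h X)
    refine (momentMap_apply hι hF (g * ι h) X).trans ?_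
    rw [h1, dLeft_mul hF (fun g => hFι g h), map_smul, Ad_dModel hι]

/-- Invariance kills the derivative on `W` and the moment equation kills it on `iW`, and together
these span `E`. -/
theorem momentMap_eq_zero_iff (hι : IsComplexification (V := V) (E := E) ι) {F : H → ℝ}
    (hF : ContMDiff 𝓘(ℝ, E) 𝓘(ℝ, ℝ) ∞ F) (hFι : ∀ g h, F (g * ι h) = F g) (g : H) :
    momentMap V E ι F g = 0 ↔ dLeft (E := E) F g = 0 := by
  constructor
  · intro h
    have h1 : ∀ X : V, dLeft F g (Complex.I • dModel ι X : E) = 0 := fun X => by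
      have h2 := momentMap_apply hι.contMDiff hF g X
      rw [h] at h2
      have h3 : (0 : ℝ) = (1 / 2 : ℝ) * dLeft F g (Complex.I • dModel ι X : E) := h2
      linarith
    ext v
    obtain ⟨_, ⟨a, rfl⟩, _, ⟨b, rfl⟩, rfl⟩ := hι.isRealForm.exists_add v
    rw [map_add]
    refine (congrArg₂ (· + ·) (dLeft_dModel_eq_zero hι.contMDiff hF hFι g a) (h1 b)).trans ?_
    simp
  · intro h
    ext X
    refine (momentMap_apply hι.contMDiff hF g X).trans ?_
    rw [h]
    simp

variable {B : Type*} [NormedAddCommGroup B] [NormedSpace ℝ B] [ChartedSpace B (H ⧸ ι.range)]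

theorem dLeft_lift_eq_zero_iff
    (hπ : ContMDiff 𝓘(ℝ, E) 𝓘(ℝ, B) ∞ (fun g : H => (g : H ⧸ ι.range)))
    (hπ' : ∀ g : H, Function.Surjective
      (mfderiv 𝓘(ℝ, E) 𝓘(ℝ, B) (fun g : H => (g : H ⧸ ι.range)) g))
    {f : H ⧸ ι.range → ℝ} (hf : ContMDiff 𝓘(ℝ, B) 𝓘(ℝ, ℝ) ∞ f) (g : H) :
    dLeft (E := E) (lift ι f) g = 0 ↔ (g : H ⧸ ι.range) ∈ critSet B f := by
  have hF : ContMDiff 𝓘(ℝ, E) 𝓘(ℝ, ℝ) ∞ (lift ι f) := hf.comp hπ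
  rw [dLeft_eq_zero_iff hF]
  obtain ⟨P, hP, hPs⟩ : ∃ P : E →L[ℝ] B, HasMFDerivAt 𝓘(ℝ, E) 𝓘(ℝ, B)
      (fun g : H => (g : H ⧸ ι.range)) g P ∧ Function.Surjective P :=
    ⟨_, ((hπ g).mdifferentiableAt (by simp)).hasMFDerivAt, hπ' g⟩
  obtain ⟨l, hl⟩ : ∃ l : B →L[ℝ] ℝ, HasMFDerivAt 𝓘(ℝ, B) 𝓘(ℝ, ℝ) f (g : H ⧸ ι.range) l :=
    ⟨_, ((hf _).mdifferentiableAt (by simp)).hasMFDerivAt⟩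
  have h1 : dReal (E := E) (lift ι f) g = l ∘L P := (hl.comp g hP).mfderiv
  have h2 : (g : H ⧸ ι.range) ∈ critSet B f ↔ l = 0 := by
    change mfderiv 𝓘(ℝ, B) 𝓘(ℝ, ℝ) f (g : H ⧸ ι.range) = 0 ↔ l = 0
    rw [hl.mfderiv]
    rfl
  rw [h1, h2]
  constructor
  · intro h
    ext b
    obtain ⟨v, rfl⟩ := hPs b
    exact congrArg (fun L : E →L[ℝ] ℝ => L v) h
  · rintro rfl
    exact ContinuousLinearMap.zero_comp P

end Final

end CplxLie

end

theorem mainTheorem10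
    -- the real Lie group `G`
    {V : Type*} [NormedAddCommGroup V] [NormedSpace ℝ V] [FiniteDimensional ℝ V]
    {G : Type*} [TopologicalSpace G] [ChartedSpace V G] [Group G] [LieGroup 𝓘(ℝ, V) ∞ G]
    -- the complex Lie group `G^c`, a complexification of `G`
    {E : Type*} [NormedAddCommGroup E] [NormedSpace ℂ E] [FiniteDimensional ℂ E]
    {Gc : Type*} [TopologicalSpace Gc] [ChartedSpace E Gc] [Group Gc] [LieGroup 𝓘(ℂ, E) ω Gc]
    (ι : G →* Gc) (hι : CplxLie.IsComplexification (V := V) (E := E) ι)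
    -- the manifold structure of `G^c/G`: the unique one making the projection a smooth submersion
    {B : Type*} [NormedAddCommGroup B] [NormedSpace ℝ B]
    [ChartedSpace B (Gc ⧸ ι.range)] [IsManifold 𝓘(ℝ, B) ∞ (Gc ⧸ ι.range)]
    (hπ : ContMDiff 𝓘(ℝ, E) 𝓘(ℝ, B) ∞ (fun g : Gc => (g : Gc ⧸ ι.range)))
    (hπ' : ∀ g : Gc, Function.Surjective
      (mfderiv 𝓘(ℝ, E) 𝓘(ℝ, B) (fun g : Gc => (g : Gc ⧸ ι.range)) g))
    -- a smooth strictly convex function `f` on `G^c/G`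
    (f : Gc ⧸ ι.range → ℝ) (hf : ContMDiff 𝓘(ℝ, B) 𝓘(ℝ, ℝ) ∞ f)
    (hconv : CplxLie.IsStrictlyConvex V E ι f) :
    -- `ω_f` is of type `(1,1)` (so, being closed, a Kähler form whenever it is positive)
    (∀ (g : Gc) (u v : TangentSpace 𝓘(ℝ, E) g),
      CplxLie.ddbar (CplxLie.lift ι f) g ![CplxLie.cplxJ g u, CplxLie.cplxJ g v] =
        CplxLie.ddbar (CplxLie.lift ι f) g ![u, v]) ∧
    -- the action of `G` is Hamiltonian with moment map `μ_f`
    CplxLie.IsHamiltonian ι (CplxLie.ddbar (E := E) (CplxLie.lift ι f))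
      (CplxLie.momentMap V E ι (CplxLie.lift ι f)) ∧
    -- the zero set of `μ_f` is the preimage of the critical set of `f`
    {g : Gc | CplxLie.momentMap V E ι (CplxLie.lift ι f) g = 0} =
      (fun g : Gc => (g : Gc ⧸ ι.range)) ⁻¹' CplxLie.critSet B f ∧
    -- if `G^c/G` is connected, the critical set has at most one point, the zero set at most one orbit
    (ConnectedSpace (Gc ⧸ ι.range) →
      (CplxLie.critSet B f = ∅ ∨ ∃ p, CplxLie.critSet B f = {p}) ∧
      ({g : Gc | CplxLie.momentMap V E ι (CplxLie.lift ι f) g = 0} = ∅ ∨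
        ∃ g₀ : Gc, {g : Gc | CplxLie.momentMap V E ι (CplxLie.lift ι f) g = 0} =
          Set.range (fun h : G => g₀ * ι h))) := by
  -- All lemmas are stated for smooth structures, so the analytic structure is weakened.
  have : IsManifold 𝓘(ℂ, E) ∞ Gc := IsManifold.of_le (n := ω) (by simp)
  have hLie : LieGroup 𝓘(ℂ, E) ∞ Gc := LieGroup.of_le (n := ω) (by simp)
  have hF : ContMDiff 𝓘(ℝ, E) 𝓘(ℝ, ℝ) ∞ (CplxLie.lift ι f) := hf.comp hπ
  have hFι : ∀ g h, CplxLie.lift ι f (g * ι h) = CplxLie.lift ι f g :=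
    fun g h => CplxLie.lift_mul_range g ⟨h, rfl⟩
  have hcrit := CplxLie.dLeft_lift_eq_zero_iff (E := E) (B := B) hπ hπ' hf
  have hzero := CplxLie.momentMap_eq_zero_iff hι hF hFι
  refine ⟨CplxLie.ddbar_cplxJ hF, CplxLie.isHamiltonian_ddbar hι.contMDiff hF hFι, ?_,
    fun hconn => ?_⟩
  · ext g
    exact (hzero g).trans (hcrit g)
  have hK : ∀ p q : Gc, CplxLie.dLeft (E := E) (CplxLie.lift ι f) p = 0 →
      CplxLie.dLeft (E := E) (CplxLie.lift ι f) q = 0 → p⁻¹ * q ∈ ι.range := fun p q hp hq =>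
    hι.isRealFormSubgroup.inv_mul_mem (hι.isConvexPotential hF hconv)
      (fun g k hk => CplxLie.lift_mul_range g hk) inferInstance hp hq
  by_cases h : ∃ g : Gc, CplxLie.dLeft (E := E) (CplxLie.lift ι f) g = 0
  · obtain ⟨g, hg⟩ := h
    refine ⟨Or.inr ⟨g, ?_⟩, Or.inr ⟨g, ?_⟩⟩
    · ext p
      obtain ⟨q, rfl⟩ := QuotientGroup.mk_surjective p
      rw [← hcrit q, Set.mem_singleton_iff]
      constructor
      · exact fun hq => (QuotientGroup.eq.2 (hK g q hg hq)).symm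
      · intro hq
        rw [hcrit q, hq, ← hcrit g]
        exact hg
    · ext q
      refine (hzero q).trans ⟨fun hq => ?_, ?_⟩
      · obtain ⟨h, hh⟩ := hK g q hg hq
        exact ⟨h, by beta_reduce; rw [hh, mul_inv_cancel_left]⟩
      · rintro ⟨h, rfl⟩
        rw [hcrit, QuotientGroup.mk_mul_of_mem g (MonoidHom.mem_range.2 ⟨h, rfl⟩), ← hcrit]
        exact hg
  · push Not at h
    refine ⟨Or.inl (Set.eq_empty_of_forall_notMem fun p hp => ?_),
      Or.inl (Set.eq_empty_of_forall_notMem fun q hq => h q ((hzero q).1 hq))⟩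
    obtain ⟨q, rfl⟩ := QuotientGroup.mk_surjective p
    exact h q ((hcrit q).2 hp)
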